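/- Let $L_\infty>0$, $\mu>0$, $\mathbb R^3_+=\{(x,y,z): z>0\}$, and let $\boldsymbol\xi$ be three-dimensional Gaussian white noise on $\mathbb R^3_+$, i.e. a linear family of centred Gaussian random variables $\boldsymbol\xi(\boldsymbol\varphi)$, $\boldsymbol\varphi\in[L^2(\mathbb R^3_+)]^3$, with variance $\|\boldsymbol\varphi\|^2$. Let $A=I-L_\infty^2\Delta$ on $[L^2(\mathbb R^3_+)]^3$, with domain the fields $\boldsymbol\psi=(\psi_1,\psi_2,\psi_3)\in[H^2(\mathbb R^3_+)]^3$ that satisfy $\psi_1=\psi_2=0$ and $\partial_z\psi_3=0$ at $z=0$ in the sense of traces, and let $A^{17/12}$ be defined by the spectral theorem. Let $\boldsymbol\psi$ be a square-integrable, mean-square continuous random field on $\mathbb R^3_+$ (real, three components) that solves $$A^{17/12}\boldsymbol\psi=\mu\,L_\infty^{17/6}\,\boldsymbol\xi$$ in the weak sense: for every real $\boldsymbol\varphi\in D(A^{17/12})$ with $A^{17/12}\boldsymbol\varphi\in[C_c^\infty(\mathbb R^3_+)]^3$, almost surely $\int_{\mathbb R^3_+}\boldsymbol\psi\cdot A^{17/12}\boldsymbol\varphi\,d\boldsymbol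 x=\mu L_\infty^{17/6}\boldsymbol\xi(\boldsymbol\varphi)$. (This is the von Kármán half-space model with $\boldsymbol\Theta=L_\infty^2 I$ and $\kappa=0$.) Then $\boldsymbol\psi$ is differentiable in mean square on $\mathbb R^3_+$. Let $(u,v,w)=\nabla\times\boldsymbol\psi$, and let $\langle u^2\rangle$, $\langle v^2\rangle$ be the second moments at a point $(x,y,z)$. As $z\to\infty$ (for fixed $x,y$), $\langle u^2\rangle$ and $\langle v^2\rangle$ tend to a common positive constant $\langle u_\infty^2\rangle=\langle v_\infty^2\rangle$, and at every point of $\mathbb R^3_+$ $$\frac{\langle u^2\rangle}{\langle u_\infty^2\rangle}=\frac{\langle v^2\rangle}{\langle v_\infty^2\rangle}=1+(\nu+1)\,\mathcal M_\nu\!\left(\frac{2z}{L_\infty}\right)-\nu\,\mathcal M_{\nu+1}\!\left(\frac{2z}{L_\infty}\right),\qquad \nu=\tfrac13,$$ where $\mathcal M_\nu(s)=\dfrac{s^\nu K_\nu(s)}{2^{\nu-1}\Gamma(\nu)}$ is the Matérn kernel and $K_\nu$ is the modified Bessel function of the second kind. Hence both ratios tend to $2$ as $z/L_\infty\to0^+$.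 -/

import Mathlib

open MeasureTheory ProbabilityTheory Filter Topology
open scoped ContDiff

noncomputable section

namespace VonKarman

/-! ### The half-space and its Lebesgue spaces -/

/-- Euclidean space `ℝ³`; the coordinates `0, 1, 2` are the paper's `x, y, z`. -/
abbrev E3 : Type := EuclideanSpace ℝ (Fin 3)

/-- The open half-space `ℝ³₊ = {z > 0}`. -/
def halfSpace : Set E3 := {x | 0 < x 2}

/-- Lebesgue measure on the half-space. -/
def halfVol : Measure E3 := volume.restrict halfSpace

/-- The Hilbert space `[L²(ℝ³₊; 𝕜)]³`. -/
abbrev L2Vec (𝕜 : Type) [RCLike 𝕜] : Type := PiLp 2 (fun _ : Fin 3 => Lp 𝕜 2 halfVol)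

/-- The `i`-th standard unit vector of `ℝ³`. -/
def unitVec (i : Fin 3) : E3 := EuclideanSpace.single i 1

/-- `φ ∈ C_c^∞(ℝ³; ℝ)`. -/
def IsTestFunction (φ : E3 → ℝ) : Prop := ContDiff ℝ ∞ φ ∧ HasCompactSupport φ

/-- `φ ∈ C_c^∞(ℝ³₊; ℝ)`: the support is a compact subset of the open half-space. -/
def IsInteriorTestFunction (φ : E3 → ℝ) : Prop := IsTestFunction φ ∧ tsupport φ ⊆ halfSpace

/-! ### Weak derivatives, traces, and the operator `1 - L²Δ` with its boundary conditions -/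

/-- `h = ∂ᵢ f` in the sense of distributions on the half-space. -/
def IsWeakPartial (i : Fin 3) (f h : Lp ℂ 2 halfVol) : Prop :=
  ∀ φ : E3 → ℝ, IsInteriorTestFunction φ →
    ∫ x, fderiv ℝ φ x (unitVec i) • f x ∂halfVol = -∫ x, φ x • h x ∂halfVol

/-- `g` is the trace of `f` on the boundary plane `z = 0`, characterised by the Gauss-Green formula
`∫_{z>0} (f ∂_z φ + φ ∂_z f) = -∫_{ℝ²} g φ(·,·,0)` for all `φ ∈ C_c^∞(ℝ³)`. -/
def IsTrace (f : Lp ℂ 2 halfVol) (g : Lp ℂ 2 (volume : Measure (ℝ × ℝ))) : Prop :=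
  ∃ w : Lp ℂ 2 halfVol, IsWeakPartial 2 f w ∧
    ∀ φ : E3 → ℝ, IsTestFunction φ →
      ∫ x, (fderiv ℝ φ x (unitVec 2) • f x + φ x • w x) ∂halfVol
        = -∫ p : ℝ × ℝ, φ (!₂[p.1, p.2, 0]) • g p

/-- The graph of the operator `A = 1 - ∇·(Θ∇) = 1 - L²Δ`, `Θ = L² I`, on `[L²(ℝ³₊)]³`, with domain
the vector fields in `[H²(ℝ³₊)]³` that satisfy `f₁ = f₂ = 0` and `κ f₃ + L² ∂_z f₃ = 0` at `z = 0`
in the sense of traces: `vkOperator L κ f h` says that `f ∈ D(A)` and `A f = h`. -/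
def vkOperator (L κ : ℝ) (f h : L2Vec ℂ) : Prop :=
  ∃ (D : Fin 3 → Fin 3 → Lp ℂ 2 halfVol) (D2 : Fin 3 → Fin 3 → Fin 3 → Lp ℂ 2 halfVol),
    (∀ c i, IsWeakPartial i (f c) (D c i)) ∧
    (∀ c i j, IsWeakPartial j (D c i) (D2 c i j)) ∧
    IsTrace (f 0) 0 ∧
    IsTrace (f 1) 0 ∧
    IsTrace ((κ : ℂ) • f 2 + ((L ^ 2 : ℝ) : ℂ) • D 2 2) 0 ∧
    ∀ c, h c = f c - ((L ^ 2 : ℝ) : ℂ) • ∑ i, D2 c i i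

/-! ### Fractional powers by the spectral theorem -/

/-- The graph of the power `A^α = U* λ^α U` of the self-adjoint operator with graph `A`, where `U` is
a unitary map onto some `L²(Y, m)` that turns `A` into the multiplication by the real function `λ`
(in the graph sense: `f ∈ D(A)` and `A f = h` if and only if `U h = λ U f`). -/
def spectralPower {H : Type} [NormedAddCommGroup H] [InnerProductSpace ℂ H]
    (A : H → H → Prop) (α : ℝ) (f g : H) : Prop :=
  ∃ (Y : Type) (_ : MeasurableSpace Y) (m : Measure Y) (lam : Y → ℝ) (U : H ≃ₗᵢ[ℂ] Lp ℂ 2 m),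
    SigmaFinite m ∧ Measurable lam ∧
    (∀ p q : H, A p q ↔ U q =ᵐ[m] fun y => (lam y : ℂ) * U p y) ∧
    U g =ᵐ[m] fun y => ((lam y ^ α : ℝ) : ℂ) * U f y

/-! ### White noise, random fields and the boundary value problem -/

section Random

variable {Ω : Type*} [MeasurableSpace Ω]

/-- Three-dimensional Gaussian white noise on the half-space: a linear family of random variables
`ξ(φ)`, `φ ∈ [L²(ℝ³₊; ℝ)]³`, with `ξ(φ)` centred Gaussian of variance `‖φ‖²`. -/
def IsWhiteNoise (P : Measure Ω) (ξ : L2Vec ℝ →ₗ[ℝ] Lp ℝ 2 P) : Prop :=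
  ∀ φ : L2Vec ℝ, P.map (ξ φ) = gaussianReal 0 (‖φ‖₊ ^ 2)

/-- A three-component second-order random field on `ℝ³` (only its values on the half-space will
matter): to each component and each point it assigns a square-integrable random variable.
Continuity and derivatives of such a field are meant in mean square. -/
abbrev RandomField (P : Measure Ω) : Type _ := Fin 3 → E3 → Lp ℝ 2 P

/-- `ψ` is a solution, continuous in mean square, of
`(1 - L²Δ)^{17/12} ψ = μ L^{17/6} ξ` in `ℝ³₊` with `ψ₁ = ψ₂ = 0` and `κ ψ₃ + L² ∂_z ψ₃ = 0` at
`z = 0`. The equation is understood weakly: `⟨ψ, A^α φ⟩ = μ L^{17/6} ξ(φ)` for every `φ` in the domain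
of the self-adjoint operator `A^α`, `α = 17/12`, such that `A^α φ` is a test function `f`. The
boundary conditions are those in the domain of `A`. -/
structure IsSolution (P : Measure Ω) (ξ : L2Vec ℝ →ₗ[ℝ] Lp ℝ 2 P) (μ L κ : ℝ)
    (ψ : RandomField P) : Prop where
  continuousOn : ∀ i, ContinuousOn (ψ i) halfSpace
  equation : ∀ (f : Fin 3 → E3 → ℝ) (φ : L2Vec ℝ) (fC φC : L2Vec ℂ),
    (∀ i, IsInteriorTestFunction (f i)) →
    (∀ i, fC i =ᵐ[halfVol] fun x => (f i x : ℂ)) →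
    (∀ i, φC i =ᵐ[halfVol] fun x => (φ i x : ℂ)) →
    spectralPower (vkOperator L κ) (17 / 12) φC fC →
    ∑ i, ∫ x, f i x • ψ i x ∂halfVol = (μ * L ^ (17 / 6 : ℝ)) • ξ φ

/-- The mean-square partial derivative `∂ᵢ ψ_c`. -/
def partialDeriv {P : Measure Ω} (ψ : RandomField P) (i c : Fin 3) (x : E3) : Lp ℝ 2 P :=
  fderiv ℝ (ψ c) x (unitVec i)

/-- The velocity `(u, v, w) = ∇ × ψ`. -/
def curl {P : Measure Ω} (ψ : RandomField P) : RandomField P :=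
  ![fun x => partialDeriv ψ 1 2 x - partialDeriv ψ 2 1 x,
    fun x => partialDeriv ψ 2 0 x - partialDeriv ψ 0 2 x,
    fun x => partialDeriv ψ 0 1 x - partialDeriv ψ 1 0 x]

/-- The Reynolds stress `⟨uᵢ²⟩` at the point `x`. -/
def reynoldsStress (P : Measure Ω) (u : RandomField P) (i : Fin 3) (x : E3) : ℝ :=
  ∫ s, (u i x s) ^ 2 ∂P

end Random

/-! ### The Matérn kernel -/

/-- The modified Bessel function of the second kind,
`K_ν(x) = ∫₀^∞ exp (-x cosh t) cosh (ν t) dt` for `x > 0`. -/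
def besselK (ν x : ℝ) : ℝ :=
  ∫ t in Set.Ioi (0 : ℝ), Real.exp (-x * Real.cosh t) * Real.cosh (ν * t)

/-- The Matérn kernel `M_ν(x) = x^ν K_ν(x) / (2^{ν-1} Γ(ν))`. -/
def matern (ν x : ℝ) : ℝ :=
  x ^ ν * besselK ν x / (2 ^ (ν - 1) * Real.Gamma ν)

end VonKarman

end

noncomputable section

namespace VonKarman

open scoped FourierTransform SchwartzMap ENNReal ComplexConjugate LineDeriv

/-! ### Bessel functions as Gamma type integrals -/

/-! Reflection in the plane z = 0 removes the boundary. Extend the tangential components oddly and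
the normal component evenly. The conditions ψ₁ = ψ₂ = 0 and ∂_z ψ₃ = 0 then say exactly that the
weak derivatives of the extension up to second order have no singular part on the plane. So A
becomes multiplication by λ(k) = 1 + 4π²L²|k|² on the Fourier side (`vkOperator_iff`), and the sine
and cosine transforms diagonalise it. Solving A^{17/12} φ = f amounts to dividing by λ^{17/12}.

Testing the equation with mollifiers at x yields ψ_i(x) = μ L^{17/6} ξ(G_x e_i)
(`IsSolution.eq_green`). Here the Fourier transform of the extension of G_x is λ^{-17/12} times the
plane wave at x plus or minus the wave at the mirror image of x. White noise is an isometry into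
L²(P), so mean-square calculus for ψ is L² calculus for x ↦ G_x. The first derivative exists because
λ^{-17/6}|k|² decays like |k|^{-11/3}, which is integrable in dimension three
(`integrable_wt_sq_mul`).

Each of u and v is a difference of a horizontal derivative of ψ₃ and a vertical derivative of a
tangential component. Different components are orthogonal, so the second moments add. In both
derivatives the mirror wave carries a plus sign, and its interference with the direct wave gives the
factor 1 + cos(4π z k_z). Hence the stress is a constant times ∫ λ^{-17/6} (k_j² + k_z²)(1 + cos(4π
z k_z)) dk with j horizontal (`reynoldsStress_eq`).

Writing Γ(β) λ^{-β} as ∫ t^{β-1} e^{-λt} dt makes the k-integral Gaussian. What remains is ∫ t^{ν-1}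
e^{-t-s²/(4t)} (1 - s²/(4t)) dt with ν = 17/6 - 5/2 = 1/3 and s = 2z/L
(`Gamma_mul_integral_lam_rpow_cos`). One integration by parts, the Bessel recurrence, turns this
into Matérn kernels (`profileInt_eq_matern`). The summand 1 in 1 + cos gives the value at infinity.
The cosine part tends to 0 as s → ∞ and to that same value as s → 0, which is why the ratio doubles
at the wall. -/

/-- The weight `t^{ν-1} e^{-t}` of the Gamma integral, damped by `e^{-s²/(4t)}`. -/
def besselWeight (ν s t : ℝ) : ℝ := t ^ (ν - 1) * Real.exp (-t - s ^ 2 / (4 * t))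

/-- `∫₀^∞ t^{ν-1} e^{-t-s²/(4t)} dt`. -/
def besselInt (ν s : ℝ) : ℝ := ∫ t in Set.Ioi (0 : ℝ), besselWeight ν s t

theorem continuousOn_besselWeight (ν s : ℝ) : ContinuousOn (besselWeight ν s) (Set.Ioi 0) := by
  intro t ht
  have ht' : t ≠ 0 := ne_of_gt ht
  have h1 : ContinuousAt (fun t : ℝ => t ^ (ν - 1)) t := Real.continuousAt_rpow_const _ _ (Or.inl ht')
  have h2 : ContinuousAt (fun t : ℝ => Real.exp (-t - s ^ 2 / (4 * t))) t := by
    have : 4 * t ≠ 0 := by simpa using ht'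
    fun_prop (disch := assumption)
  exact (h1.mul h2).continuousWithinAt

theorem besselWeight_nonneg (ν s : ℝ) {t : ℝ} (ht : 0 < t) : 0 ≤ besselWeight ν s t := by
  unfold besselWeight; positivity

theorem besselWeight_eq (ν s t : ℝ) :
    besselWeight ν s t = Real.exp (-t) * t ^ (ν - 1) * Real.exp (-(s ^ 2 / (4 * t))) := by
  rw [besselWeight, sub_eq_add_neg (-t), Real.exp_add]
  ring

theorem integrableOn_besselWeight {ν : ℝ} (hν : 0 < ν) (s : ℝ) :
    IntegrableOn (besselWeight ν s) (Set.Ioi 0) := by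
  refine Integrable.mono' (Real.GammaIntegral_convergent hν)
    ((continuousOn_besselWeight ν s).aestronglyMeasurable measurableSet_Ioi) ?_
  filter_upwards [ae_restrict_mem measurableSet_Ioi] with t ht
  have ht' : (0 : ℝ) < t := ht
  rw [Real.norm_eq_abs, abs_of_nonneg (besselWeight_nonneg ν s ht), besselWeight_eq]
  refine mul_le_of_le_one_right (by positivity) (Real.exp_le_one_iff.mpr ?_)
  have : 0 ≤ s ^ 2 / (4 * t) := by positivity
  linarith

/-- The damping absorbs the extra singularity at 0: with x = s²/(4t) one has x e^{-x} ≤ 1, so the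
Gamma integrand of the same order ν still dominates. -/
theorem integrableOn_besselWeight_mul {ν : ℝ} (hν : 0 < ν) (s : ℝ) :
    IntegrableOn (fun t => besselWeight ν s t * (s ^ 2 / (4 * t))) (Set.Ioi 0) := by
  have hc : ContinuousOn (fun t : ℝ => s ^ 2 / (4 * t)) (Set.Ioi 0) := fun t ht => by
    have : 4 * t ≠ 0 := by simpa using (ne_of_gt ht : t ≠ 0)
    fun_prop (disch := assumption)
  refine Integrable.mono' (Real.GammaIntegral_convergent hν)
    (((continuousOn_besselWeight ν s).mul hc).aestronglyMeasurable measurableSet_Ioi) ?_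
  filter_upwards [ae_restrict_mem measurableSet_Ioi] with t ht
  have ht' : (0 : ℝ) < t := ht
  have h := besselWeight_nonneg ν s ht
  rw [Real.norm_eq_abs, abs_of_nonneg (by positivity), besselWeight_eq, mul_assoc]
  refine mul_le_of_le_one_right (by positivity) ?_
  rw [Real.exp_neg, inv_mul_le_iff₀ (Real.exp_pos _), mul_one]
  linarith [Real.add_one_le_exp (s ^ 2 / (4 * t))]

theorem besselInt_zero {ν : ℝ} (hν : 0 < ν) : besselInt ν 0 = Real.Gamma ν := by
  rw [besselInt, Real.Gamma_eq_integral hν]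
  exact integral_congr_ae (ae_of_all _ fun t => by simp [besselWeight_eq])

/-- The recurrence relation of the Bessel functions. -/
theorem integral_besselWeight_mul {ν : ℝ} (hν : 0 < ν) (s : ℝ) :
    ∫ t in Set.Ioi (0 : ℝ), besselWeight ν s t * (s ^ 2 / (4 * t)) =
      besselInt (ν + 1) s - ν * besselInt ν s := by
  -- The recurrence is the integral over (0, ∞) of the derivative of t^ν e^{-t-s²/(4t)}, whose
  -- boundary values vanish at both ends.
  have hd : ∀ t ∈ Set.Ioi (0 : ℝ), HasDerivAt (besselWeight (ν + 1) s)
      (ν * besselWeight ν s t - besselWeight (ν + 1) s t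
        + besselWeight ν s t * (s ^ 2 / (4 * t))) t := by
    intro t ht
    have ht' : (0 : ℝ) < t := ht
    have h1 : HasDerivAt (fun t : ℝ => t ^ (ν + 1 - 1)) ((ν + 1 - 1) * t ^ (ν + 1 - 1 - 1)) t :=
      Real.hasDerivAt_rpow_const (Or.inl ht'.ne')
    have h2 : HasDerivAt (fun t : ℝ => -t - s ^ 2 / (4 * t))
        (-1 - (0 * (4 * t) - s ^ 2 * (4 * 1)) / (4 * t) ^ 2) t :=
      (hasDerivAt_id t).neg.sub ((hasDerivAt_const t (s ^ 2)).div ((hasDerivAt_id t).const_mul 4)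
        (by positivity))
    have h3 := h1.mul h2.exp
    refine h3.congr_deriv ?_
    rw [besselWeight, besselWeight, add_sub_cancel_right]
    have h4 : t ^ ν = t ^ (ν - 1) * t := by rw [Real.rpow_sub_one ht'.ne']; field_simp
    rw [h4]
    field_simp
    ring
  have hlim0 : Tendsto (besselWeight (ν + 1) s) (𝓝[>] 0) (𝓝 0) := by
    have h1 : Tendsto (fun t : ℝ => t ^ ν) (𝓝[>] 0) (𝓝 0) := by
      have := (Real.continuousAt_rpow_const 0 ν (Or.inr hν.le)).tendsto.mono_left
        (nhdsWithin_le_nhds (s := Set.Ioi 0))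
      rwa [Real.zero_rpow hν.ne'] at this
    refine squeeze_zero' ?_ ?_ h1
    · filter_upwards [self_mem_nhdsWithin] with t ht using besselWeight_nonneg _ _ ht
    · filter_upwards [self_mem_nhdsWithin] with t ht
      have ht' : (0 : ℝ) < t := ht
      rw [besselWeight, add_sub_cancel_right]
      refine mul_le_of_le_one_right (by positivity) (Real.exp_le_one_iff.mpr ?_)
      have : 0 ≤ s ^ 2 / (4 * t) := by positivity
      linarith
  have hlimt : Tendsto (besselWeight (ν + 1) s) atTop (𝓝 0) := by
    have h1 := tendsto_rpow_mul_exp_neg_mul_atTop_nhds_zero ν 1 one_pos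
    refine squeeze_zero' ?_ ?_ h1
    · filter_upwards [eventually_gt_atTop 0] with t ht using besselWeight_nonneg _ _ ht
    · filter_upwards [eventually_gt_atTop 0] with t ht
      rw [besselWeight, add_sub_cancel_right]
      have : 0 ≤ s ^ 2 / (4 * t) := by positivity
      gcongr
      linarith
  have i1 := (integrableOn_besselWeight hν s).const_mul ν
  have i2 := integrableOn_besselWeight (add_pos hν one_pos) s
  have i3 := integrableOn_besselWeight_mul hν s
  -- The quotient s²/(4t) is 0 by convention at t = 0, but the factor 0^ν vanishes, so the value
  -- there agrees with the right limit.
  have h0 : besselWeight (ν + 1) s 0 = 0 := by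
    rw [besselWeight, add_sub_cancel_right, Real.zero_rpow hν.ne', zero_mul]
  have hcont : ContinuousWithinAt (besselWeight (ν + 1) s) (Set.Ici 0) 0 := by
    rw [← continuousWithinAt_Ioi_iff_Ici, ContinuousWithinAt, h0]
    exact hlim0
  have h := integral_Ioi_of_hasDerivAt_of_tendsto hcont hd ((i1.sub i2).add i3) hlimt
  have i12 : Integrable (fun t => ν * besselWeight ν s t - besselWeight (ν + 1) s t)
    (volume.restrict (Set.Ioi 0)) := i1.sub i2
  rw [integral_add i12 i3, integral_sub i1 i2, integral_const_mul, h0] at h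
  rw [besselInt, besselInt]
  linarith

/-- The substitution u = (s/2) e^t turns -u - s²/(4u) into -s cosh t and (0, ∞) into the whole line.
Folding the line at 0 replaces e^{νt} by 2 cosh(νt). -/
theorem rpow_mul_besselK {ν s : ℝ} (hν : 0 < ν) (hs : 0 < s) :
    s ^ ν * besselK ν s = 2 ^ (ν - 1) * besselInt ν s := by
  have himg : (fun t : ℝ => s / 2 * Real.exp t) '' Set.univ = Set.Ioi 0 := by
    ext u
    simp only [Set.image_univ, Set.mem_range, Set.mem_Ioi]
    constructor
    · rintro ⟨t, rfl⟩
      positivity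
    · intro hu
      refine ⟨Real.log (2 * u / s), ?_⟩
      rw [Real.exp_log (by positivity)]
      field_simp
  have hder : ∀ t ∈ (Set.univ : Set ℝ), HasDerivWithinAt (fun t : ℝ => s / 2 * Real.exp t)
      (s / 2 * Real.exp t) Set.univ t := fun t _ =>
    ((Real.hasDerivAt_exp t).const_mul _).hasDerivWithinAt
  have hinj : Set.InjOn (fun t : ℝ => s / 2 * Real.exp t) Set.univ := fun x _ y _ h =>
    Real.exp_injective (mul_left_cancel₀ (by positivity) h)
  have hF : ∀ t : ℝ, |s / 2 * Real.exp t| • besselWeight ν s (s / 2 * Real.exp t) =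
      (s / 2) ^ ν * (Real.exp (-s * Real.cosh t) * Real.exp (ν * t)) := by
    intro t
    have hu : 0 < s / 2 * Real.exp t := by positivity
    have h1 : -(s / 2 * Real.exp t) - s ^ 2 / (4 * (s / 2 * Real.exp t)) = -s * Real.cosh t := by
      rw [Real.cosh_eq, Real.exp_neg]
      field_simp
      ring
    rw [abs_of_pos hu, besselWeight, h1, smul_eq_mul, Real.rpow_sub_one hu.ne',
      Real.mul_rpow (by positivity) (Real.exp_pos t).le, ← Real.exp_mul, mul_comm ν t]
    field_simp
  have h1 := integral_image_eq_integral_abs_deriv_smul MeasurableSet.univ hder hinj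
    (besselWeight ν s)
  have h2 := (integrableOn_image_iff_integrableOn_abs_deriv_smul MeasurableSet.univ hder hinj
    (besselWeight ν s)).mp (by rw [himg]; exact integrableOn_besselWeight hν s)
  rw [himg] at h1
  simp_rw [hF] at h1 h2
  rw [integrableOn_univ, integrable_const_mul_iff (by simp; positivity)] at h2
  rw [setIntegral_univ, integral_const_mul] at h1
  have h3 := integral_comp_neg_Ioi 0 fun t => Real.exp (-s * Real.cosh t) * Real.exp (ν * t)
  rw [neg_zero] at h3
  have h4 : ∫ t, Real.exp (-s * Real.cosh t) * Real.exp (ν * t) = 2 * besselK ν s := by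
    rw [← integral_add_compl measurableSet_Iic h2, Set.compl_Iic, ← h3,
      ← integral_add h2.comp_neg.integrableOn h2.integrableOn, besselK, ← integral_const_mul]
    congr 1
    ext t
    rw [Real.cosh_neg, Real.cosh_eq (ν * t), mul_neg]
    ring
  rw [besselInt, h1, h4, Real.div_rpow hs.le zero_le_two, Real.rpow_sub_one two_ne_zero]
  field_simp

theorem Gamma_mul_matern {ν s : ℝ} (hν : 0 < ν) (hs : 0 < s) :
    Real.Gamma ν * matern ν s = besselInt ν s := by
  have h1 := Real.Gamma_pos_of_pos hν
  have h2 : (0 : ℝ) < 2 ^ (ν - 1) := by positivity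
  rw [matern, rpow_mul_besselK hν hs]
  field_simp

/-- `∫₀^∞ t^{ν-1} e^{-t-s²/(4t)} (1 - s²/(4t)) dt`. -/
def profileInt (ν s : ℝ) : ℝ :=
  ∫ t in Set.Ioi (0 : ℝ), besselWeight ν s t * (1 - s ^ 2 / (4 * t))

theorem profileInt_zero {ν : ℝ} (hν : 0 < ν) : profileInt ν 0 = Real.Gamma ν := by
  rw [← besselInt_zero hν, profileInt, besselInt]
  simp

/-- The recurrence contributes ν + 1 copies of the integral of order ν and minus one copy of order ν
+ 1. The coefficient ν of the second kernel comes from Γ(ν + 1) = ν Γ(ν). -/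
theorem profileInt_eq_matern {ν s : ℝ} (hν : 0 < ν) (hs : 0 < s) :
    profileInt ν s = Real.Gamma ν * ((ν + 1) * matern ν s - ν * matern (ν + 1) s) := by
  have h1 := Gamma_mul_matern hν hs
  have h2 := Gamma_mul_matern (add_pos hν one_pos) hs
  have h3 := integral_besselWeight_mul hν s
  rw [Real.Gamma_add_one hν.ne'] at h2
  simp_rw [profileInt, mul_sub, mul_one]
  rw [integral_sub (integrableOn_besselWeight hν s) (integrableOn_besselWeight_mul hν s), h3,
    ← besselInt, ← h1, ← h2]
  ring

/-! ### Limits of the profile integral at zero and at infinity -/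

theorem abs_one_sub_mul_exp_neg_le {x : ℝ} (hx : 0 ≤ x) : |Real.exp (-x) * (1 - x)| ≤ 1 := by
  have h1 : |1 - x| ≤ Real.exp x :=
    abs_le.mpr ⟨by linarith [Real.add_one_le_exp x], by linarith [Real.add_one_le_exp x]⟩
  rw [abs_mul, abs_of_pos (Real.exp_pos _), Real.exp_neg, inv_mul_le_iff₀ (Real.exp_pos x), mul_one]
  exact h1

/-- Since |e^{-x}(1 - x)| ≤ 1 for x ≥ 0, the Gamma integrand dominates uniformly in s, so limits in
s may be taken under the integral. -/
theorem tendsto_profileInt {ν : ℝ} (hν : 0 < ν) {l : Filter ℝ} [l.IsCountablyGenerated]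
    {g : ℝ → ℝ} (hg : ∀ t, 0 < t → Tendsto (fun s => besselWeight ν s t * (1 - s ^ 2 / (4 * t))) l
      (𝓝 (g t))) :
    Tendsto (profileInt ν) l (𝓝 (∫ t in Set.Ioi (0 : ℝ), g t)) := by
  refine tendsto_integral_filter_of_dominated_convergence _ (Eventually.of_forall fun s => ?_)
    (Eventually.of_forall fun s => ?_) (Real.GammaIntegral_convergent hν) ?_
  · have h := (integrableOn_besselWeight hν s).sub (integrableOn_besselWeight_mul hν s)
    refine h.aestronglyMeasurable.congr (ae_of_all _ fun t => ?_)
    simp only [Pi.sub_apply]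
    ring
  · filter_upwards [ae_restrict_mem measurableSet_Ioi] with t ht
    have ht' : (0 : ℝ) < t := ht
    rw [besselWeight_eq, mul_assoc, norm_mul, Real.norm_eq_abs, Real.norm_eq_abs,
      abs_of_nonneg (by positivity : 0 ≤ Real.exp (-t) * t ^ (ν - 1))]
    exact mul_le_of_le_one_right (by positivity) (abs_one_sub_mul_exp_neg_le (by positivity))
  · filter_upwards [ae_restrict_mem measurableSet_Ioi] with t ht using hg t ht

theorem tendsto_profileInt_zero {ν : ℝ} (hν : 0 < ν) :
    Tendsto (profileInt ν) (𝓝 0) (𝓝 (Real.Gamma ν)) := by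
  rw [← profileInt_zero hν]
  refine tendsto_profileInt hν fun t _ => ?_
  have : Continuous fun s => besselWeight ν s t * (1 - s ^ 2 / (4 * t)) := by
    unfold besselWeight
    fun_prop
  exact this.tendsto 0

theorem tendsto_profileInt_atTop {ν : ℝ} (hν : 0 < ν) :
    Tendsto (profileInt ν) atTop (𝓝 0) := by
  have h := tendsto_profileInt hν (l := atTop) (g := fun _ => 0) fun t ht => ?_
  · simpa using h
  · have h1 : Tendsto (fun s : ℝ => s ^ 2 / (4 * t)) atTop atTop :=
      (tendsto_pow_atTop two_ne_zero).atTop_div_const (by positivity)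
    have h2 : Tendsto (fun x : ℝ => Real.exp (-x) * (1 - x)) atTop (𝓝 0) := by
      have a := Real.tendsto_pow_mul_exp_neg_atTop_nhds_zero 0
      have b := Real.tendsto_pow_mul_exp_neg_atTop_nhds_zero 1
      simpa using (a.sub b).congr fun x => by simp; ring
    have h3 := (h2.comp h1).const_mul (Real.exp (-t) * t ^ (ν - 1))
    rw [mul_zero] at h3
    refine h3.congr fun s => ?_
    rw [besselWeight_eq]
    simp only [Function.comp]
    ring

/-! ### Reflection in the boundary plane -/

/-- The reflection `(x, y, z) ↦ (x, y, -z)`. -/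
def refl : E3 ≃ₗᵢ[ℝ] E3 :=
  LinearIsometryEquiv.piLpCongrRight 2 (fun i : Fin 3 =>
    if i = 2 then LinearIsometryEquiv.neg ℝ else LinearIsometryEquiv.refl ℝ ℝ)

theorem refl_apply (x : E3) (i : Fin 3) : refl x i = if i = 2 then -x i else x i := by
  simp only [refl, LinearIsometryEquiv.piLpCongrRight_apply]
  split_ifs with h <;> simp [h]

theorem refl_apply_two (x : E3) : refl x 2 = -x 2 := by simp [refl_apply]

@[simp] theorem refl_refl (x : E3) : refl (refl x) = x := by
  ext i
  simp only [refl_apply]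
  split_ifs <;> simp

theorem refl_unitVec (i : Fin 3) : refl (unitVec i) = (if i = 2 then (-1 : ℝ) else 1) • unitVec i := by
  ext j
  rw [refl_apply]
  fin_cases i <;> fin_cases j <;> simp [unitVec]

theorem inner_refl_left (x y : E3) : inner ℝ (refl x) y = inner ℝ x (refl y) := by
  rw [← refl.inner_map_map (refl x) y, refl_refl]

theorem measurePreserving_refl : MeasurePreserving refl (volume : Measure E3) volume :=
  refl.measurePreserving

theorem isOpen_halfSpace : IsOpen halfSpace :=
  isOpen_lt continuous_const (by fun_prop)

theorem measurableSet_halfSpace : MeasurableSet halfSpace := isOpen_halfSpace.measurableSet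

theorem ae_apply_two_ne_zero : ∀ᵐ x : E3, x 2 ≠ 0 := by
  have h := Measure.addHaar_submodule (volume : Measure E3)
    (LinearMap.ker (EuclideanSpace.proj (𝕜 := ℝ) (2 : Fin 3) : E3 →L[ℝ] ℝ).toLinearMap) (by
      intro h
      have : unitVec 2 ∈ LinearMap.ker (EuclideanSpace.proj (𝕜 := ℝ) (2 : Fin 3) : E3 →L[ℝ] ℝ).toLinearMap := by
        rw [h]; trivial
      simp [unitVec] at this)
  rw [ae_iff]
  refine measure_mono_null (fun x hx => ?_) h
  simpa using hx

/-- Off the null plane z = 0 the reflection exchanges the half-space with its complement. Statements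
and integrals on the whole space therefore split into two over the half-space. -/
theorem volume_eq_add_map : (volume : Measure E3) = halfVol + halfVol.map refl := by
  have h1 : halfVol.map refl = volume.restrict halfSpaceᶜ := by
    have h2 : halfVol.map refl = volume.restrict (refl ⁻¹' halfSpace) := by
      have := (measurePreserving_refl.restrict_preimage (s := refl ⁻¹' halfSpace)
        (refl.continuous.measurable measurableSet_halfSpace)).map_eq
      rw [← this, halfVol]
      congr 2
      ext x
      simp
    rw [h2]
    refine Measure.restrict_congr_set ?_
    filter_upwards [ae_apply_two_ne_zero] with x hx
    apply propext
    change 0 < refl x 2 ↔ ¬ (0 < x 2)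
    rw [refl_apply_two]
    constructor
    · intro h; linarith
    · intro h
      have := lt_of_le_of_ne (not_lt.mp h) hx
      linarith
  rw [h1, halfVol, Measure.restrict_add_restrict_compl measurableSet_halfSpace]

theorem measurable_refl : Measurable refl := refl.continuous.measurable

theorem measurableEmbedding_refl : MeasurableEmbedding refl :=
  refl.toHomeomorph.measurableEmbedding

theorem ae_iff_half {p : E3 → Prop} :
    (∀ᵐ x, p x) ↔ (∀ᵐ x ∂halfVol, p x) ∧ ∀ᵐ x ∂halfVol, p (refl x) := by
  rw [volume_eq_add_map, ae_add_measure_iff, measurableEmbedding_refl.ae_map_iff]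

theorem ae_halfVol_of_ae {p : E3 → Prop} (h : ∀ᵐ x, p x) : ∀ᵐ x ∂halfVol, p x :=
  (ae_iff_half.mp h).1

theorem ae_halfVol_mem : ∀ᵐ x ∂halfVol, x ∈ halfSpace :=
  ae_restrict_mem measurableSet_halfSpace

theorem integral_eq_half {F : Type*} [NormedAddCommGroup F] [NormedSpace ℝ F] {g : E3 → F}
    (hg : Integrable g) :
    ∫ x, g x = ∫ x, g x ∂halfVol + ∫ x, g (refl x) ∂halfVol := by
  rw [volume_eq_add_map] at hg ⊢
  rw [integral_add_measure hg.left_of_add_measure hg.right_of_add_measure,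
    measurableEmbedding_refl.integral_map]

/-! ### Even and odd extensions -/

theorem memLp_of_half {g : E3 → ℂ} (hg : StronglyMeasurable g) (h1 : MemLp g 2 halfVol)
    (h2 : MemLp (fun x => g (refl x)) 2 halfVol) : MemLp g 2 volume := by
  refine ⟨hg.aestronglyMeasurable, ?_⟩
  have h3 : MemLp g 2 (halfVol.map refl) := measurableEmbedding_refl.memLp_map_measure_iff.mpr h2
  rw [eLpNorm_lt_top_iff_lintegral_rpow_enorm_lt_top (by simp) (by simp), volume_eq_add_map,
    lintegral_add_measure]
  exact ENNReal.add_lt_top.mpr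
    ⟨(eLpNorm_lt_top_iff_lintegral_rpow_enorm_lt_top (by simp) (by simp)).mp h1.2,
     (eLpNorm_lt_top_iff_lintegral_rpow_enorm_lt_top (by simp) (by simp)).mp h3.2⟩

open Classical in
/-- The extension of a function on the half-space by `f (R x) = σ f(x)`. -/
def extFun (σ : ℝ) (f : E3 → ℂ) (x : E3) : ℂ := if 0 < x 2 then f x else σ * f (refl x)

theorem extFun_ae (σ : ℝ) (f : E3 → ℂ) : extFun σ f =ᵐ[halfVol] f := by
  filter_upwards [ae_halfVol_mem] with x hx
  have : 0 < x 2 := hx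
  simp [extFun, this]

theorem extFun_refl_ae (σ : ℝ) (f : E3 → ℂ) :
    (fun x => extFun σ f (refl x)) =ᵐ[halfVol] fun x => σ * f x := by
  filter_upwards [ae_halfVol_mem] with x hx
  have : 0 < x 2 := hx
  simp [extFun, refl_apply_two, this.le]

theorem memLp_extFun (σ : ℝ) (f : Lp ℂ 2 halfVol) : MemLp (extFun σ f) 2 volume := by
  have hf := Lp.stronglyMeasurable f
  refine memLp_of_half ?_ ((memLp_congr_ae (extFun_ae σ f)).mpr (Lp.memLp f))
    ((memLp_congr_ae (extFun_refl_ae σ f)).mpr ((Lp.memLp f).const_mul _))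
  exact StronglyMeasurable.ite measurableSet_halfSpace hf
    ((hf.comp_measurable measurable_refl).const_mul _)

/-- Extension of `L²` functions on the half-space to the whole space with parity `σ` under the
reflection. -/
def extLp (σ : ℝ) : Lp ℂ 2 halfVol →ₗ[ℂ] Lp ℂ 2 (volume : Measure E3) where
  toFun f := (memLp_extFun σ f).toLp _
  map_add' f g := by
    ext1
    refine (MemLp.coeFn_toLp _).trans (EventuallyEq.trans ?_ (Lp.coeFn_add _ _).symm)
    refine EventuallyEq.trans ?_ ((MemLp.coeFn_toLp _).add (MemLp.coeFn_toLp _)).symm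
    refine ae_iff_half.mpr ⟨?_, ?_⟩
    · filter_upwards [extFun_ae σ f, extFun_ae σ g, extFun_ae σ (f + g : Lp ℂ 2 halfVol),
        Lp.coeFn_add f g] with x h1 h2 h3 h4
      simp only [Pi.add_apply] at *
      rw [h1, h2, h3, h4]
    · filter_upwards [extFun_refl_ae σ f, extFun_refl_ae σ g,
        extFun_refl_ae σ (f + g : Lp ℂ 2 halfVol), Lp.coeFn_add f g] with x h1 h2 h3 h4
      simp only [Pi.add_apply] at *
      rw [h1, h2, h3, h4, mul_add]
  map_smul' c f := by
    ext1
    refine (MemLp.coeFn_toLp _).trans (EventuallyEq.trans ?_ (Lp.coeFn_smul _ _).symm)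
    refine EventuallyEq.trans ?_ ((MemLp.coeFn_toLp (memLp_extFun σ f)).const_smul c).symm
    refine ae_iff_half.mpr ⟨?_, ?_⟩
    · filter_upwards [extFun_ae σ f, extFun_ae σ (c • f : Lp ℂ 2 halfVol),
        Lp.coeFn_smul c f] with x h1 h3 h4
      simp only [Pi.smul_apply] at *
      rw [h1, h3, h4]
    · filter_upwards [extFun_refl_ae σ f,
        extFun_refl_ae σ (c • f : Lp ℂ 2 halfVol), Lp.coeFn_smul c f] with x h1 h3 h4
      simp only [Pi.smul_apply, smul_eq_mul] at *
      rw [h1, h3, h4]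
      ring

theorem extLp_ae_half (σ : ℝ) (f : Lp ℂ 2 halfVol) : extLp σ f =ᵐ[halfVol] f :=
  EventuallyEq.trans (ae_halfVol_of_ae (MemLp.coeFn_toLp (memLp_extFun σ f))) (extFun_ae σ f)

theorem extLp_refl_ae_half (σ : ℝ) (f : Lp ℂ 2 halfVol) :
    (fun x => extLp σ f (refl x)) =ᵐ[halfVol] fun x => σ * f x :=
  EventuallyEq.trans (ae_iff_half.mp (MemLp.coeFn_toLp (memLp_extFun σ f))).2
    (extFun_refl_ae σ f)

/-- Restriction to the half-space. -/
def restrLp : Lp ℂ 2 (volume : Measure E3) →L[ℂ] Lp ℂ 2 halfVol :=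
  LpToLpRestrictCLM E3 ℂ ℂ volume 2 halfSpace

theorem restrLp_ae (P : Lp ℂ 2 (volume : Measure E3)) : restrLp P =ᵐ[halfVol] P :=
  LpToLpRestrictCLM_coeFn ℂ halfSpace P

/-- Composition with the reflection. -/
def reflLp : Lp ℂ 2 (volume : Measure E3) →ₗᵢ[ℂ] Lp ℂ 2 (volume : Measure E3) :=
  Lp.compMeasurePreservingₗᵢ ℂ refl measurePreserving_refl

theorem reflLp_ae (P : Lp ℂ 2 (volume : Measure E3)) : reflLp P =ᵐ[volume] fun x => P (refl x) :=
  Lp.coeFn_compMeasurePreserving P measurePreserving_refl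

/-- `P` has parity `σ` under the reflection. -/
def HasParity (σ : ℝ) (P : Lp ℂ 2 (volume : Measure E3)) : Prop := reflLp P = (σ : ℂ) • P

theorem hasParity_iff {σ : ℝ} {P : Lp ℂ 2 (volume : Measure E3)} :
    HasParity σ P ↔ ∀ᵐ x, P (refl x) = σ * P x := by
  constructor
  · intro h
    have h1 := reflLp_ae P
    rw [h] at h1
    filter_upwards [h1, Lp.coeFn_smul (σ : ℂ) P] with x h2 h3
    rw [← h2, h3]; simp
  · intro h
    refine Lp.ext ?_
    filter_upwards [reflLp_ae P, Lp.coeFn_smul (σ : ℂ) P, h] with x h1 h2 h3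
    rw [h1, h2, h3]; simp

theorem restrLp_extLp (σ : ℝ) (f : Lp ℂ 2 halfVol) : restrLp (extLp σ f) = f :=
  Lp.ext ((restrLp_ae _).trans (extLp_ae_half σ f))

theorem hasParity_extLp {σ : ℝ} (hσ : σ * σ = 1) (f : Lp ℂ 2 halfVol) :
    HasParity σ (extLp σ f) := by
  refine hasParity_iff.mpr (ae_iff_half.mpr ⟨?_, ?_⟩)
  · filter_upwards [extLp_ae_half σ f, extLp_refl_ae_half σ f] with x h1 h2
    rw [h1, h2]
  · filter_upwards [extLp_ae_half σ f, extLp_refl_ae_half σ f] with x h1 h2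
    rw [refl_refl, h1, h2, ← mul_assoc]
    norm_cast
    simp [hσ]

theorem extLp_restrLp {σ : ℝ} {P : Lp ℂ 2 (volume : Measure E3)} (hP : HasParity σ P) :
    extLp σ (restrLp P) = P := by
  refine Lp.ext (ae_iff_half.mpr ⟨?_, ?_⟩)
  · exact (extLp_ae_half σ _).trans (restrLp_ae P)
  · filter_upwards [extLp_refl_ae_half σ (restrLp P), restrLp_ae P,
      ae_halfVol_of_ae (hasParity_iff.mp hP)] with x h1 h2 h3
    rw [h1, h2, h3]

theorem integrable_norm_sq_Lp {α : Type*} [MeasurableSpace α] {m : Measure α} (P : Lp ℂ 2 m) :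
    Integrable (fun x => ‖P x‖ ^ 2) m :=
  (memLp_two_iff_integrable_sq_norm (Lp.aestronglyMeasurable P)).mp (Lp.memLp P)

theorem norm_sq_Lp {α : Type*} [MeasurableSpace α] {m : Measure α} (P : Lp ℂ 2 m) :
    ‖P‖ ^ 2 = ∫ x, ‖P x‖ ^ 2 ∂m := by
  have h := L2.inner_def (𝕜 := ℂ) P P
  have h2 : ∀ a, inner ℂ (P a) (P a) = ((‖P a‖ ^ 2 : ℝ) : ℂ) := fun a => by
    rw [inner_self_eq_norm_sq_to_K]
    norm_cast
  simp_rw [h2] at h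
  rw [integral_complex_ofReal, inner_self_eq_norm_sq_to_K] at h
  have h3 : ((‖P‖ ^ 2 : ℝ) : ℂ) = ((∫ x, ‖P x‖ ^ 2 ∂m : ℝ) : ℂ) := by
    rw [← h]
    norm_cast
  exact_mod_cast h3

/-- Both halves carry the same mass because σ² = 1. -/
theorem norm_sq_of_hasParity {σ : ℝ} (hσ : σ * σ = 1) {P : Lp ℂ 2 (volume : Measure E3)}
    (hP : HasParity σ P) : ‖P‖ ^ 2 = 2 * ‖restrLp P‖ ^ 2 := by
  rw [norm_sq_Lp, integral_eq_half (integrable_norm_sq_Lp P), norm_sq_Lp, two_mul]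
  have h1 : ∫ x, ‖P x‖ ^ 2 ∂halfVol = ∫ x, ‖restrLp P x‖ ^ 2 ∂halfVol := by
    refine integral_congr_ae ?_
    filter_upwards [restrLp_ae P] with x hx
    rw [hx]
  congr 1
  rw [← h1]
  refine integral_congr_ae ?_
  filter_upwards [ae_halfVol_of_ae (hasParity_iff.mp hP)] with x hx
  simp only [hx, norm_mul, mul_pow]
  have : ‖(σ : ℂ)‖ ^ 2 = 1 := by
    rw [Complex.norm_real, Real.norm_eq_abs, sq_abs, sq, hσ]
  rw [this, one_mul]

/-! ### Symmetries of the `L²` Fourier transform -/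

theorem reflLp_toLp (S : 𝓢(E3, ℂ)) :
    reflLp (S.toLp 2 volume)
      = (SchwartzMap.compCLMOfContinuousLinearEquiv ℂ refl.toContinuousLinearEquiv S).toLp 2 volume := by
  refine Lp.ext ?_
  filter_upwards [reflLp_ae (S.toLp 2 volume), SchwartzMap.coeFn_toLp
    (SchwartzMap.compCLMOfContinuousLinearEquiv ℂ refl.toContinuousLinearEquiv S) 2 volume,
    measurePreserving_refl.quasiMeasurePreserving.ae (SchwartzMap.coeFn_toLp S 2 volume)]
    with x h1 h2 h3
  rw [h1, h2, h3]
  rfl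

/-- On Schwartz functions this is the invariance of the Fourier integral under a linear isometry;
density and continuity extend it to L². It makes the transform preserve parity. -/
theorem fourier_reflLp (P : Lp ℂ 2 (volume : Measure E3)) : 𝓕 (reflLp P) = reflLp (𝓕 P) := by
  have hd := SchwartzMap.denseRange_toLpCLM (E := E3) (F := ℂ) (p := 2) (μ := volume)
    ENNReal.ofNat_ne_top
  refine congrFun (hd.equalizer (g := fun P => 𝓕 (reflLp P)) (h := fun P => reflLp (𝓕 P))
    (by fun_prop) (by fun_prop) ?_) P
  funext S
  simp only [Function.comp_apply, SchwartzMap.toLpCLM_apply]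
  rw [reflLp_toLp, SchwartzMap.toLp_fourier_eq, SchwartzMap.toLp_fourier_eq, reflLp_toLp]
  congr 1
  ext k
  rw [SchwartzMap.compCLMOfContinuousLinearEquiv_apply]
  simp only [SchwartzMap.fourier_coe, Function.comp]
  exact Real.fourier_comp_linearIsometry refl S k

theorem HasParity.fourier {σ : ℝ} {P : Lp ℂ 2 (volume : Measure E3)} (hP : HasParity σ P) :
    HasParity σ (𝓕 P) := by
  unfold HasParity at *
  rw [← fourier_reflLp, hP, FourierTransform.fourier_smul]

theorem HasParity.of_fourier {σ : ℝ} {P : Lp ℂ 2 (volume : Measure E3)} (hP : HasParity σ (𝓕 P)) :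
    HasParity σ P := by
  unfold HasParity at *
  rw [← fourier_reflLp, ← FourierTransform.fourier_smul] at hP
  simpa using congrArg 𝓕⁻ hP

/-- Complex conjugation on `L²`. -/
def conjLp {α : Type*} [MeasurableSpace α] (m : Measure α) : Lp ℂ 2 m →L[ℝ] Lp ℂ 2 m :=
  (Complex.conjCLE : ℂ →L[ℝ] ℂ).compLpL 2 m

theorem conjLp_ae {α : Type*} [MeasurableSpace α] {m : Measure α} (P : Lp ℂ 2 m) :
    conjLp m P =ᵐ[m] fun x => conj (P x) :=
  ContinuousLinearMap.coeFn_compLpL _ _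

/-- Composition with `x ↦ -x`. -/
def negLp : Lp ℂ 2 (volume : Measure E3) →ₗᵢ[ℂ] Lp ℂ 2 (volume : Measure E3) :=
  Lp.compMeasurePreservingₗᵢ ℂ (fun x => -x) (Measure.measurePreserving_neg volume)

theorem negLp_ae (P : Lp ℂ 2 (volume : Measure E3)) : negLp P =ᵐ[volume] fun x => P (-x) :=
  Lp.coeFn_compMeasurePreserving P (Measure.measurePreserving_neg volume)

theorem conjLp_negLp_toLp (S : 𝓢(E3, ℂ)) : ∃ T : 𝓢(E3, ℂ), (∀ x, T x = conj (S (-x))) ∧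
    conjLp volume (negLp (S.toLp 2 volume)) = T.toLp 2 volume := by
  refine ⟨SchwartzMap.postcompCLM (𝕜 := ℝ) (Complex.conjCLE : ℂ →L[ℝ] ℂ)
    (SchwartzMap.compCLMOfContinuousLinearEquiv ℝ (ContinuousLinearEquiv.neg ℝ) S), ?_, ?_⟩
  · intro x
    simp
  · refine Lp.ext ?_
    filter_upwards [conjLp_ae (negLp (S.toLp 2 volume)), negLp_ae (S.toLp 2 volume),
      SchwartzMap.coeFn_toLp (SchwartzMap.postcompCLM (𝕜 := ℝ) (Complex.conjCLE : ℂ →L[ℝ] ℂ)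
    (SchwartzMap.compCLMOfContinuousLinearEquiv ℝ (ContinuousLinearEquiv.neg ℝ) S)) 2 volume,
      (Measure.measurePreserving_neg volume).quasiMeasurePreserving.ae
        (SchwartzMap.coeFn_toLp S 2 volume)] with x h1 h2 h3 h4
    rw [h1, h2, h3, h4]
    simp

theorem conjLp_toLp (S : 𝓢(E3, ℂ)) : ∃ T : 𝓢(E3, ℂ), (∀ x, T x = conj (S x)) ∧
    conjLp volume (S.toLp 2 volume) = T.toLp 2 volume := by
  refine ⟨SchwartzMap.postcompCLM (𝕜 := ℝ) (Complex.conjCLE : ℂ →L[ℝ] ℂ) S, ?_, ?_⟩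
  · intro x
    simp
  · refine Lp.ext ?_
    filter_upwards [conjLp_ae (S.toLp 2 volume), 
      SchwartzMap.coeFn_toLp (SchwartzMap.postcompCLM (𝕜 := ℝ) (Complex.conjCLE : ℂ →L[ℝ] ℂ) S)
        2 volume, (SchwartzMap.coeFn_toLp S 2 volume)] with x h1 h2 h3
    rw [h1, h2, h3]
    simp

/-- Proved on Schwartz functions and extended by density. It serves to show that Hermitian symbols
are transforms of real functions, since the noise accepts real fields only. -/
theorem fourier_conjLp (P : Lp ℂ 2 (volume : Measure E3)) :
    𝓕 (conjLp volume P) = conjLp volume (negLp (𝓕 P)) := by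
  have hd := SchwartzMap.denseRange_toLpCLM (E := E3) (F := ℂ) (p := 2) (μ := volume)
    ENNReal.ofNat_ne_top
  refine congrFun (hd.equalizer (g := fun P => 𝓕 (conjLp volume P))
    (h := fun P => conjLp volume (negLp (𝓕 P))) (by fun_prop) (by fun_prop) ?_) P
  funext S
  simp only [Function.comp_apply, SchwartzMap.toLpCLM_apply]
  obtain ⟨T, hT, hT'⟩ := conjLp_toLp S
  rw [hT', SchwartzMap.toLp_fourier_eq, SchwartzMap.toLp_fourier_eq]
  obtain ⟨T2, hT2, hT2'⟩ := conjLp_negLp_toLp (𝓕 S)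
  rw [hT2']
  congr 1
  ext k
  rw [hT2]
  simp only [SchwartzMap.fourier_coe, Real.fourier_eq']
  rw [← integral_conj]
  congr 1
  ext v
  simp only [smul_eq_mul, map_mul, hT, ← Complex.exp_conj, inner_neg_right]
  have h2 : conj (2 : ℂ) = 2 := Complex.conj_ofReal 2
  simp [h2]

theorem conjLp_fourierInv_of_ae {G : Lp ℂ 2 (volume : Measure E3)}
    (hG : ∀ᵐ k, conj (G (-k)) = G k) : conjLp volume (𝓕⁻ G) = 𝓕⁻ G := by
  have h1 : conjLp volume (negLp G) = G := by
    refine Lp.ext ?_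
    filter_upwards [conjLp_ae (negLp G), negLp_ae G, hG] with x h1 h2 h3
    rw [h1, h2, h3]
  have h2 := fourier_conjLp (𝓕⁻ G)
  rw [FourierInvPair.fourier_fourierInv_eq, h1] at h2
  rw [← FourierPair.fourierInv_fourier_eq (conjLp volume (𝓕⁻ G)) (F := Lp ℂ 2 (volume : Measure E3)), h2]

/-! ### Test functions and cutoffs -/

theorem integrable_smul_of_memLp_two {α : Type*} [MeasurableSpace α] {m : Measure α} {u : α → ℝ}
    (hu : MemLp u 2 m) (f : Lp ℂ 2 m) : Integrable (fun x => u x • f x) m :=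
  memLp_one_iff_integrable.mp ((Lp.memLp f).smul hu)

theorem memLp_of_continuous_hasCompactSupport {u : E3 → ℝ} (hu : Continuous u)
    (h : HasCompactSupport u) (m : Measure E3) [IsFiniteMeasureOnCompacts m] : MemLp u 2 m :=
  hu.memLp_of_hasCompactSupport h

instance : IsFiniteMeasureOnCompacts halfVol := by unfold halfVol; infer_instance

instance : SigmaFinite halfVol := by unfold halfVol; infer_instance

theorem IsTestFunction.memLp {φ : E3 → ℝ} (hφ : IsTestFunction φ) (m : Measure E3)
    [IsFiniteMeasureOnCompacts m] : MemLp φ 2 m :=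
  memLp_of_continuous_hasCompactSupport hφ.1.continuous hφ.2 m

theorem IsTestFunction.contDiff_partial {φ : E3 → ℝ} (hφ : IsTestFunction φ) (v : E3) :
    ContDiff ℝ ∞ (fun x => fderiv ℝ φ x v) :=
  (hφ.1.fderiv_right (m := ∞) (by simp)).clm_apply contDiff_const

theorem IsTestFunction.partial {φ : E3 → ℝ} (hφ : IsTestFunction φ) (v : E3) :
    IsTestFunction (fun x => fderiv ℝ φ x v) :=
  ⟨hφ.contDiff_partial v, hφ.2.fderiv_apply (𝕜 := ℝ) v⟩

theorem IsTestFunction.differentiable {φ : E3 → ℝ} (hφ : IsTestFunction φ) : Differentiable ℝ φ :=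
  hφ.1.differentiable (by simp)

theorem IsTestFunction.comp_refl {φ : E3 → ℝ} (hφ : IsTestFunction φ) :
    IsTestFunction (fun x => φ (refl x)) :=
  ⟨hφ.1.comp refl.contDiff, hφ.2.comp_homeomorph refl.toHomeomorph⟩

theorem IsTestFunction.add_smul {φ χ : E3 → ℝ} (hφ : IsTestFunction φ) (hχ : IsTestFunction χ)
    (c : ℝ) : IsTestFunction (fun x => φ x + c * χ x) :=
  ⟨hφ.1.add (contDiff_const.mul hχ.1), hφ.2.add hχ.2.mul_left⟩

theorem fderiv_comp_refl {φ : E3 → ℝ} (hφ : Differentiable ℝ φ) (x v : E3) :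
    fderiv ℝ (fun x => φ (refl x)) x v = fderiv ℝ φ (refl x) (refl v) := by
  have := ((hφ (refl x)).hasFDerivAt.comp x (refl.toContinuousLinearEquiv.hasFDerivAt (x := x)))
  have h2 := this.fderiv
  change fderiv ℝ (φ ∘ refl) x v = _
  erw [h2]
  rfl

/-- A smooth cutoff, `0` on `t ≤ 1` and `1` on `t ≥ 2`. -/
def cutoff (t : ℝ) : ℝ := Real.smoothTransition (t - 1)

theorem contDiff_cutoff : ContDiff ℝ ∞ cutoff :=
  Real.smoothTransition.contDiff.comp (contDiff_id.sub contDiff_const)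

theorem cutoff_of_le {t : ℝ} (h : t ≤ 1) : cutoff t = 0 :=
  Real.smoothTransition.zero_of_nonpos (by linarith)

theorem cutoff_of_ge {t : ℝ} (h : 2 ≤ t) : cutoff t = 1 :=
  Real.smoothTransition.one_of_one_le (by linarith)

theorem abs_cutoff_le (t : ℝ) : |cutoff t| ≤ 1 := by
  unfold cutoff
  rw [abs_of_nonneg (Real.smoothTransition.nonneg _)]
  exact Real.smoothTransition.le_one _

theorem deriv_cutoff_of_gt {t : ℝ} (h : 2 < t) : deriv cutoff t = 0 := by
  have : cutoff =ᶠ[𝓝 t] fun _ => 1 := by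
    filter_upwards [lt_mem_nhds h] with s hs using cutoff_of_ge hs.le
  rw [this.deriv_eq]; simp

theorem deriv_cutoff_of_lt {t : ℝ} (h : t < 1) : deriv cutoff t = 0 := by
  have : cutoff =ᶠ[𝓝 t] fun _ => 0 := by
    filter_upwards [gt_mem_nhds h] with s hs using cutoff_of_le hs.le
  rw [this.deriv_eq]; simp

/-- The derivative lives on [1, 2]. The bound is scale invariant, so the factor n from
differentiating `cutoff (n * z)` is harmless against a function of size O(z). -/
theorem exists_bound_deriv_cutoff : ∃ C, ∀ t, |t * deriv cutoff t| ≤ C := by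
  have hc : Continuous (fun t => t * deriv cutoff t) :=
    continuous_id.mul (contDiff_cutoff.continuous_deriv (by simp))
  have hs : HasCompactSupport (fun t => t * deriv cutoff t) := by
    refine HasCompactSupport.intro (K := Set.Icc 1 2) isCompact_Icc (fun t ht => ?_)
    rw [Set.mem_Icc, not_and_or, not_le, not_le] at ht
    rcases ht with h | h
    · rw [deriv_cutoff_of_lt h, mul_zero]
    · rw [deriv_cutoff_of_gt h, mul_zero]
  obtain ⟨C, hC⟩ := hs.exists_bound_of_continuous hc
  exact ⟨C, hC⟩

/-- `Φ` cut off near the boundary plane. -/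
def boundaryCut (n : ℕ) (Φ : E3 → ℝ) (x : E3) : ℝ := cutoff (n * x 2) * Φ x

theorem isInteriorTestFunction_boundaryCut (n : ℕ) {Φ : E3 → ℝ} (hΦ : IsTestFunction Φ) :
    IsInteriorTestFunction (boundaryCut n Φ) := by
  refine ⟨⟨(contDiff_cutoff.comp (contDiff_const.mul (by fun_prop))).mul hΦ.1, hΦ.2.mul_left⟩, ?_⟩
  have h1 : tsupport (boundaryCut n Φ) ⊆ {x | 1 ≤ n * x 2} := by
    refine closure_minimal (fun x hx => ?_) (isClosed_le continuous_const (by fun_prop))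
    by_contra h
    exact hx (by simp [boundaryCut, cutoff_of_le (not_le.mp h).le])
  intro x hx
  have h2 : 1 ≤ n * x 2 := h1 hx
  by_contra h3
  have h4 : x 2 ≤ 0 := not_lt.mp h3
  have := mul_nonpos_of_nonneg_of_nonpos (Nat.cast_nonneg (α := ℝ) n) h4
  linarith

theorem fderiv_boundaryCut (n : ℕ) {Φ : E3 → ℝ} (hΦ : IsTestFunction Φ) (x v : E3) :
    fderiv ℝ (boundaryCut n Φ) x v
      = cutoff (n * x 2) * fderiv ℝ Φ x v + (deriv cutoff (n * x 2) * (n * v 2)) * Φ x := by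
  have h1 : HasFDerivAt (fun y : E3 => (n : ℝ) * y 2)
      ((n : ℝ) • (EuclideanSpace.proj (𝕜 := ℝ) (2 : Fin 3) : E3 →L[ℝ] ℝ)) x :=
    ((EuclideanSpace.proj (𝕜 := ℝ) (2 : Fin 3) : E3 →L[ℝ] ℝ).hasFDerivAt (x := x)).const_mul _
  have h2 : HasDerivAt cutoff (deriv cutoff (n * x 2)) (n * x 2) :=
    (contDiff_cutoff.differentiable (by simp) _).hasDerivAt
  have h3 := (h2.comp_hasFDerivAt x h1).mul (hΦ.differentiable x).hasFDerivAt
  have h4 : fderiv ℝ (boundaryCut n Φ) x = _ := h3.fderiv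
  rw [h4]
  simp
  ring

theorem IsTestFunction.exists_bound_of_vanish {Φ : E3 → ℝ} (hΦ : IsTestFunction Φ)
    (h0 : ∀ x : E3, x 2 = 0 → Φ x = 0) : ∃ M : ℝ, 0 ≤ M ∧ ∀ x, |Φ x| ≤ M * |x 2| := by
  obtain ⟨K, hK⟩ := ContDiff.lipschitzWith_of_hasCompactSupport hΦ.2 hΦ.1 (by simp)
  refine ⟨K, K.2, fun x => ?_⟩
  have h1 := hK.dist_le_mul x (x - x 2 • unitVec 2)
  rw [h0 (x - x 2 • unitVec 2) (by simp [unitVec]), dist_zero_right, dist_eq_norm, sub_sub_cancel,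
    norm_smul] at h1
  simpa [unitVec] using h1

theorem tendsto_natCast_mul_atTop {a : ℝ} (ha : 0 < a) :
    Tendsto (fun n : ℕ => (n : ℝ) * a) atTop atTop :=
  tendsto_natCast_atTop_atTop.atTop_mul_const ha

/-- Integration by parts against test functions that need not vanish near the boundary, but vanish
on it if the derivative is normal to it. -/
theorem IsWeakPartial.integral_eq {i : Fin 3} {f h : Lp ℂ 2 halfVol} (hw : IsWeakPartial i f h)
    {Φ : E3 → ℝ} (hΦ : IsTestFunction Φ) (h0 : i = 2 → ∀ x : E3, x 2 = 0 → Φ x = 0) :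
    ∫ x, fderiv ℝ Φ x (unitVec i) • f x ∂halfVol = -∫ x, Φ x • h x ∂halfVol := by
  have hcont : ∀ n : ℕ, Continuous fun x : E3 => cutoff (n * x 2) := fun n =>
    contDiff_cutoff.continuous.comp (by fun_prop)
  have hlim : ∀ x ∈ halfSpace, ∀ᶠ n : ℕ in atTop, 2 < (n : ℝ) * x 2 := fun x hx =>
    (tendsto_natCast_mul_atTop hx).eventually_gt_atTop 2
  have hR : Tendsto (fun n : ℕ => ∫ x, boundaryCut n Φ x • h x ∂halfVol) atTop
      (𝓝 (∫ x, Φ x • h x ∂halfVol)) := by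
    refine tendsto_integral_of_dominated_convergence (fun x => ‖Φ x • h x‖) ?_
      (integrable_smul_of_memLp_two (hΦ.memLp _) h).norm ?_ ?_
    · intro n
      exact ((isInteriorTestFunction_boundaryCut n hΦ).1.1.continuous.aestronglyMeasurable).smul
        (Lp.aestronglyMeasurable h)
    · intro n
      refine ae_of_all _ fun x => ?_
      rw [norm_smul, norm_smul, boundaryCut, norm_mul]
      have := abs_cutoff_le (n * x 2)
      gcongr
      exact mul_le_of_le_one_left (norm_nonneg _) this
    · filter_upwards [ae_halfVol_mem] with x hx
      refine Tendsto.congr' ?_ tendsto_const_nhds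
      filter_upwards [hlim x hx] with n hn
      rw [boundaryCut, cutoff_of_ge hn.le, one_mul]
  -- This bounds, uniformly in n, the term in which the cut-off is differentiated. For a tangential
  -- derivative the term is 0. For the normal one, |Φ| ≤ M|z| turns n cutoff'(nz) Φ into at most M
  -- times a value of |t cutoff'(t)|.
  obtain ⟨C, hC0, hC⟩ : ∃ C : ℝ, 0 ≤ C ∧ ∀ (n : ℕ) (x : E3),
      |deriv cutoff (n * x 2) * (n * unitVec i 2) * Φ x| ≤ C := by
    by_cases hi : i = 2
    · obtain ⟨M, hM0, hM⟩ := hΦ.exists_bound_of_vanish (h0 hi)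
      obtain ⟨C, hC⟩ := exists_bound_deriv_cutoff
      refine ⟨C * M, mul_nonneg ((abs_nonneg _).trans (hC 0)) hM0, fun n x => ?_⟩
      have h1 : |deriv cutoff (n * x 2) * (n * unitVec i 2) * Φ x|
          = |deriv cutoff (n * x 2)| * n * |Φ x| := by
        rw [hi, abs_mul, abs_mul, abs_mul]
        simp [unitVec]
      rw [h1]
      calc |deriv cutoff (n * x 2)| * n * |Φ x|
          ≤ |deriv cutoff (n * x 2)| * n * (M * |x 2|) := by gcongr; exact hM x
        _ = |(n * x 2) * deriv cutoff (n * x 2)| * M := by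
          rw [abs_mul, abs_mul, Nat.abs_cast]; ring
        _ ≤ C * M := by gcongr; exact hC _
    · refine ⟨0, le_rfl, fun n x => ?_⟩
      simp [unitVec, Ne.symm hi]
  have hL : Tendsto (fun n : ℕ => ∫ x, fderiv ℝ (boundaryCut n Φ) x (unitVec i) • f x ∂halfVol) atTop
      (𝓝 (∫ x, fderiv ℝ Φ x (unitVec i) • f x ∂halfVol)) := by
    have hK : MemLp ((tsupport Φ).indicator fun _ => C) 2 halfVol :=
      memLp_indicator_const 2 (isClosed_tsupport Φ).measurableSet C
        (Or.inr hΦ.2.measure_lt_top.ne)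
    refine tendsto_integral_of_dominated_convergence
      (fun x => ‖fderiv ℝ Φ x (unitVec i) • f x‖ + ‖(tsupport Φ).indicator (fun _ => C) x • f x‖) ?_
      ((integrable_smul_of_memLp_two ((hΦ.partial _).memLp _) f).norm.add
        (integrable_smul_of_memLp_two hK f).norm) ?_ ?_
    · intro n
      exact (((isInteriorTestFunction_boundaryCut n hΦ).1.contDiff_partial
        (unitVec i)).continuous.aestronglyMeasurable).smul (Lp.aestronglyMeasurable f)
    · intro n
      refine ae_of_all _ fun x => ?_
      rw [norm_smul, norm_smul, norm_smul, ← add_mul]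
      gcongr
      rw [fderiv_boundaryCut n hΦ]
      refine (norm_add_le _ _).trans (add_le_add ?_ ?_)
      · rw [norm_mul]
        exact mul_le_of_le_one_left (norm_nonneg _) (abs_cutoff_le _)
      · by_cases hx : x ∈ tsupport Φ
        · rw [Set.indicator_of_mem hx, Real.norm_eq_abs, Real.norm_eq_abs, abs_of_nonneg hC0]
          exact hC n x
        · rw [image_eq_zero_of_notMem_tsupport hx]
          simp
    · filter_upwards [ae_halfVol_mem] with x hx
      refine Tendsto.congr' ?_ tendsto_const_nhds
      filter_upwards [hlim x hx] with n hn
      rw [fderiv_boundaryCut n hΦ, cutoff_of_ge hn.le, deriv_cutoff_of_gt hn]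
      simp
  have hEq : ∀ n : ℕ, ∫ x, fderiv ℝ (boundaryCut n Φ) x (unitVec i) • f x ∂halfVol
      = -∫ x, boundaryCut n Φ x • h x ∂halfVol := fun n =>
    hw _ (isInteriorTestFunction_boundaryCut n hΦ)
  simp_rw [hEq] at hL
  exact tendsto_nhds_unique hL hR.neg

/-! ### Weak derivatives on the whole space and the Fourier transform -/

/-- `H = ∂ᵢ P` in the sense of distributions on the whole space. -/
def IsFullWeakPartial (i : Fin 3) (P H : Lp ℂ 2 (volume : Measure E3)) : Prop :=
  ∀ φ : E3 → ℝ, IsTestFunction φ →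
    ∫ x, fderiv ℝ φ x (unitVec i) • P x = -∫ x, φ x • H x

theorem exists_smooth_bump : ∃ ρ : E3 → ℝ, ContDiff ℝ ∞ ρ ∧ HasCompactSupport ρ ∧
    (∀ y, ‖y‖ < 1 → ρ y = 1) ∧ ∀ y, ‖ρ y‖ ≤ 1 := by
  let ρ : ContDiffBump (0 : E3) := ⟨1, 2, one_pos, one_lt_two⟩
  refine ⟨ρ, ρ.contDiff, ρ.hasCompactSupport, fun y hy => ?_, fun y => ?_⟩
  · exact ρ.one_of_mem_closedBall (by simpa using hy.le)
  · rw [Real.norm_eq_abs, abs_of_nonneg ρ.nonneg]; exact ρ.le_one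

theorem isTestFunction_dilate_mul {ρ u : E3 → ℝ} (hρ : ContDiff ℝ ∞ ρ) (hρc : HasCompactSupport ρ)
    {c : ℝ} (hc : c ≠ 0) (hu : ContDiff ℝ ∞ u) : IsTestFunction (fun x => ρ (c • x) * u x) := by
  refine ⟨(hρ.comp (by fun_prop : ContDiff ℝ ∞ fun x : E3 => c • x)).mul hu, ?_⟩
  have h1 : HasCompactSupport (fun x => ρ (c • x)) :=
    hρc.comp_homeomorph (Homeomorph.smulOfNeZero c hc)
  exact h1.mul_right

/-- Cut u off by ρ(x/(n+1)). The derivative of the cut-off vanishes on growing balls and is bounded,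
so dominated convergence passes to the limit. -/
theorem IsFullWeakPartial.integral_schwartz {i : Fin 3} {P H : Lp ℂ 2 (volume : Measure E3)}
    (hw : IsFullWeakPartial i P H) (u : 𝓢(E3, ℝ)) :
    ∫ x, fderiv ℝ u x (unitVec i) • P x = -∫ x, u x • H x := by
  obtain ⟨ρ, hρ, hρc, hρ1, hρle⟩ := exists_smooth_bump
  obtain ⟨φ, hφe⟩ : ∃ φ : ℕ → E3 → ℝ, ∀ n x, φ n x = ρ ((n + 1 : ℝ)⁻¹ • x) * u x :=
    ⟨_, fun _ _ => rfl⟩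
  have hpos : ∀ n : ℕ, (0 : ℝ) < (n + 1 : ℝ)⁻¹ := fun n => by positivity
  have hφ : ∀ n, IsTestFunction (φ n) := fun n => by
    rw [funext (hφe n)]
    exact isTestFunction_dilate_mul hρ hρc (hpos n).ne' (u.smooth _)
  have hfd : ∀ n x, fderiv ℝ (φ n) x (unitVec i) = ρ ((n + 1 : ℝ)⁻¹ • x) * fderiv ℝ u x (unitVec i)
      + ((n + 1 : ℝ)⁻¹ * fderiv ℝ ρ ((n + 1 : ℝ)⁻¹ • x) (unitVec i)) * u x := fun n x => by
    have h1 : HasFDerivAt (fun y : E3 => (n + 1 : ℝ)⁻¹ • y)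
        ((n + 1 : ℝ)⁻¹ • ContinuousLinearMap.id ℝ E3) x :=
      ((n + 1 : ℝ)⁻¹ • ContinuousLinearMap.id ℝ E3).hasFDerivAt
    have h2 := (hρ.differentiable (by simp) ((n + 1 : ℝ)⁻¹ • x)).hasFDerivAt
    have h3 := (h2.comp x h1).mul u.differentiableAt.hasFDerivAt
    rw [funext (hφe n)]
    have h4 : fderiv ℝ (fun x => ρ ((n + 1 : ℝ)⁻¹ • x) * u x) x = _ := h3.fderiv
    rw [h4]
    simp
    ring
  have hin : ∀ x : E3, ∀ᶠ n : ℕ in atTop, ‖(n + 1 : ℝ)⁻¹ • x‖ < 1 := fun x => by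
    have : Tendsto (fun n : ℕ => ‖((n : ℝ) + 1)⁻¹ • x‖) atTop (𝓝 0) := by
      have h := (tendsto_one_div_add_atTop_nhds_zero_nat (𝕜 := ℝ)).smul_const x
      simp only [one_div, zero_smul] at h
      simpa using h.norm
    exact this.eventually_lt_const one_pos
  have hρ2 : ∀ y : E3, ‖y‖ < 1 → fderiv ℝ ρ y = 0 := fun y hy => by
    have : ρ =ᶠ[𝓝 y] fun _ => 1 := by
      filter_upwards [(isOpen_lt continuous_norm continuous_const).mem_nhds hy] with z hz
        using hρ1 z hz
    rw [this.fderiv_eq]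
    simp
  obtain ⟨C, hC⟩ := (hρc.fderiv_apply (𝕜 := ℝ) (unitVec i)).exists_bound_of_continuous
    ((hρ.continuous_fderiv (by simp)).clm_apply continuous_const)
  have hum : MemLp u 2 volume := u.memLp 2
  have hiH : Integrable (fun x => u x • H x) volume := integrable_smul_of_memLp_two hum H
  have hiP : Integrable (fun x => u x • P x) volume := integrable_smul_of_memLp_two hum P
  have hR : Tendsto (fun n : ℕ => ∫ x, φ n x • H x) atTop (𝓝 (∫ x, u x • H x)) := by
    refine tendsto_integral_of_dominated_convergence (fun x => ‖u x • H x‖) ?_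
      hiH.norm ?_ ?_
    · intro n
      exact ((hφ n).1.continuous.aestronglyMeasurable).smul (Lp.aestronglyMeasurable H)
    · intro n
      refine ae_of_all _ fun x => ?_
      rw [norm_smul, norm_smul, hφe, norm_mul]
      gcongr
      exact mul_le_of_le_one_left (norm_nonneg _) (hρle _)
    · refine ae_of_all _ fun x => ?_
      refine Tendsto.congr' ?_ tendsto_const_nhds
      filter_upwards [hin x] with n hn
      rw [hφe, hρ1 _ hn, one_mul]
  have hL : Tendsto (fun n : ℕ => ∫ x, fderiv ℝ (φ n) x (unitVec i) • P x) atTop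
      (𝓝 (∫ x, fderiv ℝ u x (unitVec i) • P x)) := by
    have hu : MemLp (fun x => fderiv ℝ u x (unitVec i)) 2 volume := by
      simpa only [← SchwartzMap.lineDerivOp_apply_eq_fderiv] using
        SchwartzMap.memLp (∂_{unitVec i} u : 𝓢(E3, ℝ)) 2 volume
    refine tendsto_integral_of_dominated_convergence
      (fun x => ‖fderiv ℝ u x (unitVec i) • P x‖ + C * ‖u x • P x‖) ?_
      ((integrable_smul_of_memLp_two hu P).norm.add (hiP.norm.const_mul C)) ?_ ?_
    · intro n
      exact (((hφ n).contDiff_partial (unitVec i)).continuous.aestronglyMeasurable).smul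
        (Lp.aestronglyMeasurable P)
    · intro n
      refine ae_of_all _ fun x => ?_
      rw [norm_smul, norm_smul, norm_smul, ← mul_assoc, ← add_mul, hfd]
      gcongr
      refine (norm_add_le _ _).trans (add_le_add ?_ ?_)
      · rw [norm_mul]
        exact mul_le_of_le_one_left (norm_nonneg _) (hρle _)
      · rw [norm_mul, norm_mul]
        gcongr
        refine (mul_le_of_le_one_left (norm_nonneg _) ?_).trans (hC _)
        rw [Real.norm_eq_abs, abs_of_pos (hpos n)]
        exact inv_le_one_of_one_le₀ (by linarith [Nat.cast_nonneg (α := ℝ) n])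
    · refine ae_of_all _ fun x => ?_
      refine Tendsto.congr' ?_ tendsto_const_nhds
      filter_upwards [hin x] with n hn
      rw [hfd, hρ1 _ hn, hρ2 _ hn]
      simp
  simp_rw [hw _ (hφ _)] at hL
  exact tendsto_nhds_unique hL hR.neg

/-- The Fourier symbol `2π i kⱼ` of `∂ⱼ`. -/
def symb (i : Fin 3) (k : E3) : ℂ := 2 * Real.pi * Complex.I * (k i : ℂ)

theorem inner_toLp_eq (S : 𝓢(E3, ℂ)) (P : Lp ℂ 2 (volume : Measure E3)) :
    inner ℂ (S.toLp 2 volume) P = ∫ x, conj (S x) * P x := by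
  rw [L2.inner_def]
  refine integral_congr_ae ?_
  filter_upwards [S.coeFn_toLp 2 volume] with x hx
  rw [hx, RCLike.inner_apply]
  ring

theorem integrable_conj_mul (S : 𝓢(E3, ℂ)) (P : Lp ℂ 2 (volume : Measure E3)) :
    Integrable (fun x => conj (S x) * P x) := by
  refine (L2.integrable_inner (𝕜 := ℂ) (S.toLp 2 volume) P).congr ?_
  filter_upwards [S.coeFn_toLp 2 volume] with x hx
  rw [hx, RCLike.inner_apply]
  ring

theorem fourier_lineDeriv_apply (S : 𝓢(E3, ℂ)) (i : Fin 3) (k : E3) :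
    𝓕 (∂_{unitVec i} S) k = symb i k * 𝓕 S k := by
  rw [SchwartzMap.fourier_lineDerivOp_eq]
  have : (fun x : E3 => inner ℝ x (unitVec i)).HasTemperateGrowth := by fun_prop
  rw [smul_apply, SchwartzMap.smulLeftCLM_apply_apply this]
  simp [symb, unitVec, EuclideanSpace.inner_single_right]
  ring

theorem conj_symb (i : Fin 3) (k : E3) : conj (symb i k) = -symb i k := by
  have h2 : conj (2 : ℂ) = 2 := Complex.conj_ofReal 2
  simp [symb, h2]

/-- Plancherel for both terms. As the symbol is purely imaginary, its conjugate supplies the minus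
sign, and the defect of the weak identity equals the defect of the multiplier identity. Both
directions of the equivalence rest on this. -/
theorem fourier_pairing (i : Fin 3) (P H : Lp ℂ 2 (volume : Measure E3)) (S : 𝓢(E3, ℂ)) :
    (∫ x, conj (fderiv ℝ S x (unitVec i)) * P x) + ∫ x, conj (S x) * H x
      = ∫ k, conj (𝓕 S k) * (𝓕 H k - symb i k * 𝓕 P k) := by
  have h1 := inner_toLp_eq (∂_{unitVec i} S) P
  have h2 := inner_toLp_eq S H
  rw [← Lp.inner_fourier_eq, SchwartzMap.toLp_fourier_eq, inner_toLp_eq] at h1 h2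
  simp only [SchwartzMap.lineDerivOp_apply_eq_fderiv] at h1
  rw [← h1, ← h2, ← integral_add (integrable_conj_mul _ _) (integrable_conj_mul _ _)]
  congr 1
  ext k
  rw [fourier_lineDeriv_apply, map_mul, conj_symb]
  ring

theorem IsFullWeakPartial.of_fourier {i : Fin 3} {P H : Lp ℂ 2 (volume : Measure E3)}
    (h : ∀ᵐ k, 𝓕 H k = symb i k * 𝓕 P k) : IsFullWeakPartial i P H := by
  intro φ hφ
  have hc : ContDiff ℝ ∞ (fun x => (φ x : ℂ)) := Complex.ofRealCLM.contDiff.comp hφ.1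
  have hs : HasCompactSupport (fun x => (φ x : ℂ)) := hφ.2.comp_left (g := fun t : ℝ => (t : ℂ)) rfl
  have h1 := fourier_pairing i P H (hs.toSchwartzMap hc)
  have h2 : ∫ k, conj (𝓕 (hs.toSchwartzMap hc) k) * (𝓕 H k - symb i k * 𝓕 P k) = 0 := by
    rw [← integral_zero E3 ℂ]
    refine integral_congr_ae ?_
    filter_upwards [h] with k hk
    simp [hk]
  rw [h2] at h1
  have h3 : ∀ x, fderiv ℝ (hs.toSchwartzMap hc) x (unitVec i)
      = ((fderiv ℝ φ x (unitVec i) : ℝ) : ℂ) := fun x => by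
    have : HasFDerivAt (fun x => (φ x : ℂ)) (Complex.ofRealCLM.comp (fderiv ℝ φ x)) x :=
      (Complex.ofRealCLM.hasFDerivAt (x := φ x)).comp x (hφ.differentiable x).hasFDerivAt
    change fderiv ℝ (fun x => (φ x : ℂ)) x (unitVec i) = _
    rw [this.fderiv]
    rfl
  simp_rw [h3] at h1
  simp only [HasCompactSupport.toSchwartzMap_toFun, Complex.conj_ofReal] at h1
  simp only [Complex.real_smul]
  exact eq_neg_of_add_eq_zero_left h1

theorem locallyIntegrable_fourier_sub (i : Fin 3) (P H : Lp ℂ 2 (volume : Measure E3)) :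
    LocallyIntegrable (fun k => H k - symb i k * P k) volume := by
  have hP : LocallyIntegrable P volume := (Lp.memLp P).locallyIntegrable (by norm_num)
  have hH : LocallyIntegrable H volume := (Lp.memLp H).locallyIntegrable (by norm_num)
  refine hH.sub ?_
  have hs : Continuous (symb i) := by unfold symb; fun_prop
  rw [locallyIntegrable_iff] at hP ⊢
  intro K hK
  exact (hP K hK).continuousOn_mul hs.continuousOn hK

theorem IsFullWeakPartial.fourier {i : Fin 3} {P H : Lp ℂ 2 (volume : Measure E3)}
    (hw : IsFullWeakPartial i P H) : ∀ᵐ k, 𝓕 H k = symb i k * 𝓕 P k := by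
  have hS : ∀ S : 𝓢(E3, ℂ), ∫ k, conj (𝓕 S k) * (𝓕 H k - symb i k * 𝓕 P k) = 0 := by
    intro S
    rw [← fourier_pairing]
    -- Weak derivatives are tested with real functions, so S is split into real and imaginary parts.
    let u : 𝓢(E3, ℝ) := S.postcompCLM (𝕜 := ℝ) Complex.reCLM
    let v : 𝓢(E3, ℝ) := S.postcompCLM (𝕜 := ℝ) Complex.imCLM
    have hu := hw.integral_schwartz u
    have hv := hw.integral_schwartz v
    have hdu : ∀ x, fderiv ℝ u x (unitVec i) = (fderiv ℝ S x (unitVec i)).re := fun x => by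
      have : HasFDerivAt u (Complex.reCLM.comp (fderiv ℝ S x)) x :=
        (Complex.reCLM.hasFDerivAt (x := S x)).comp x S.differentiableAt.hasFDerivAt
      rw [this.fderiv]
      rfl
    have hdv : ∀ x, fderiv ℝ v x (unitVec i) = (fderiv ℝ S x (unitVec i)).im := fun x => by
      have : HasFDerivAt v (Complex.imCLM.comp (fderiv ℝ S x)) x :=
        (Complex.imCLM.hasFDerivAt (x := S x)).comp x S.differentiableAt.hasFDerivAt
      rw [this.fderiv]
      rfl
    have key : ∀ z w : ℂ, conj z * w = z.re • w - Complex.I * (z.im • w) := fun z w => by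
      apply Complex.ext
      · simp
      · simp; ring
    have hi1 := integrable_smul_of_memLp_two ((∂_{unitVec i} u : 𝓢(E3, ℝ)).memLp 2) P
    have hi2 := integrable_smul_of_memLp_two ((∂_{unitVec i} v : 𝓢(E3, ℝ)).memLp 2) P
    simp only [SchwartzMap.lineDerivOp_apply_eq_fderiv] at hi1 hi2
    have hi3 := integrable_smul_of_memLp_two (u.memLp 2) H
    have hi4 := integrable_smul_of_memLp_two (v.memLp 2) H
    have e1 : ∫ x, conj (fderiv ℝ S x (unitVec i)) * P x
        = (∫ x, fderiv ℝ u x (unitVec i) • P x)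
          - Complex.I * ∫ x, fderiv ℝ v x (unitVec i) • P x := by
      rw [← integral_const_mul, ← integral_sub hi1 (hi2.const_mul _)]
      congr 1
      ext x
      rw [key, hdu, hdv]
    have e2 : ∫ x, conj (S x) * H x
        = (∫ x, u x • H x) - Complex.I * ∫ x, v x • H x := by
      rw [← integral_const_mul, ← integral_sub hi3 (hi4.const_mul _)]
      congr 1
      ext x
      rw [key]
      rfl
    rw [e1, e2, hu, hv]
    ring
  -- Taking S to be the inverse transform of an arbitrary test function in k reduces the claim to
  -- the fundamental lemma of the calculus of variations.
  have h0 := ae_eq_zero_of_integral_contDiff_smul_eq_zero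
    (locallyIntegrable_fourier_sub i (𝓕 P) (𝓕 H)) (fun g hg hgs => by
      have hc : ContDiff ℝ ∞ (fun x => (g x : ℂ)) := Complex.ofRealCLM.contDiff.comp hg
      have hs : HasCompactSupport (fun x => (g x : ℂ)) :=
        hgs.comp_left (g := fun t : ℝ => (t : ℂ)) rfl
      have := hS (𝓕⁻ (hs.toSchwartzMap hc))
      rw [FourierInvPair.fourier_fourierInv_eq] at this
      simpa using this)
  filter_upwards [h0] with k hk
  exact sub_eq_zero.mp hk

/-! ### The operator `1 - L²Δ` as a Fourier multiplier -/

/-- The parity of `∂ᵢ f` when `f` has parity `σ`. -/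
def flipParity (σ : ℝ) (i : Fin 3) : ℝ := if i = 2 then -σ else σ

theorem flipParity_sq {σ : ℝ} (hσ : σ * σ = 1) (i : Fin 3) :
    flipParity σ i * flipParity σ i = 1 := by
  unfold flipParity; split_ifs <;> simp [hσ]

@[simp] theorem flipParity_flipParity (σ : ℝ) (i : Fin 3) :
    flipParity (flipParity σ i) i = σ := by
  unfold flipParity; split_ifs <;> simp

/-! ### Weak derivatives and traces under even and odd extension -/

theorem memLp_comp_refl {ψ : E3 → ℝ} (hψ : MemLp ψ 2 volume) :
    MemLp (fun x => ψ (refl x)) 2 volume :=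
  hψ.comp_measurePreserving measurePreserving_refl

theorem MemLp.halfVol {ψ : E3 → ℝ} (hψ : MemLp ψ 2 volume) : MemLp ψ 2 halfVol :=
  hψ.restrict _

/-- Folding the lower half-space onto the upper one moves the symmetrisation from f to the test
function. -/
theorem integral_smul_extLp {σ : ℝ} {ψ : E3 → ℝ} (hψ : MemLp ψ 2 volume) (f : Lp ℂ 2 halfVol) :
    ∫ x, ψ x • extLp σ f x = ∫ x, (ψ x + σ * ψ (refl x)) • f x ∂halfVol := by
  rw [integral_eq_half (integrable_smul_of_memLp_two hψ _)]
  have h1 : ∫ x, ψ x • extLp σ f x ∂halfVol = ∫ x, ψ x • f x ∂halfVol := by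
    refine integral_congr_ae ?_
    filter_upwards [extLp_ae_half σ f] with x hx
    rw [hx]
  have h2 : ∫ x, ψ (refl x) • extLp σ f (refl x) ∂halfVol
      = ∫ x, (σ * ψ (refl x)) • f x ∂halfVol := by
    refine integral_congr_ae ?_
    filter_upwards [extLp_refl_ae_half σ f] with x hx
    rw [hx]
    simp only [Complex.real_smul]
    push_cast
    ring
  rw [h1, h2, ← integral_add (integrable_smul_of_memLp_two (MemLp.halfVol hψ) f)
    (integrable_smul_of_memLp_two ((MemLp.halfVol (memLp_comp_refl hψ)).const_mul σ) f)]
  simp_rw [add_smul]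

theorem fderiv_add_refl {φ : E3 → ℝ} (hφ : IsTestFunction φ) (σ : ℝ) (i : Fin 3) (x : E3) :
    fderiv ℝ (fun x => φ x + flipParity σ i * φ (refl x)) x (unitVec i)
      = fderiv ℝ φ x (unitVec i) + σ * fderiv ℝ φ (refl x) (unitVec i) := by
  have h1 := (hφ.differentiable x).hasFDerivAt
  have h2 := (hφ.comp_refl.differentiable x).hasFDerivAt
  have h3 : fderiv ℝ (fun x => φ x + flipParity σ i * φ (refl x)) x = _ :=
    (h1.add (h2.const_mul (flipParity σ i))).fderiv
  rw [h3]
  simp only [add_apply, smul_apply, smul_eq_mul]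
  rw [fderiv_comp_refl hφ.differentiable, refl_unitVec, map_smul, flipParity]
  split_ifs <;> simp

theorem IsWeakPartial.ae_eq {i : Fin 3} {f h h' : Lp ℂ 2 halfVol} (hw : IsWeakPartial i f h)
    (hw' : IsWeakPartial i f h') : h = h' := by
  have hl : LocallyIntegrable (fun x => h x - h' x) halfVol :=
    ((Lp.memLp h).locallyIntegrable (by norm_num)).sub
      ((Lp.memLp h').locallyIntegrable (by norm_num))
  have h0 := isOpen_halfSpace.ae_eq_zero_of_integral_contDiff_smul_eq_zero
    (hl.locallyIntegrableOn halfSpace) (fun g hg hgs hgt => by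
      have e := (hw g ⟨⟨hg, hgs⟩, hgt⟩).symm.trans (hw' g ⟨⟨hg, hgs⟩, hgt⟩)
      have hm : MemLp g 2 halfVol := IsTestFunction.memLp ⟨hg, hgs⟩ _
      simp_rw [smul_sub]
      rw [integral_sub (integrable_smul_of_memLp_two hm h) (integrable_smul_of_memLp_two hm h'),
        neg_injective e, sub_self])
  refine Lp.ext ?_
  filter_upwards [h0, ae_halfVol_mem] with x h1 h2
  exact sub_eq_zero.mp (h1 h2)

/-- Weak derivatives are unique, so the w in the definition of a trace must be h. A zero trace then
means that integration by parts in z holds even for test functions that do not vanish on the plane.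
-/
theorem isTrace_zero_iff {f h : Lp ℂ 2 halfVol} (hw : IsWeakPartial 2 f h) :
    IsTrace f 0 ↔ ∀ φ : E3 → ℝ, IsTestFunction φ →
      ∫ x, fderiv ℝ φ x (unitVec 2) • f x ∂halfVol = -∫ x, φ x • h x ∂halfVol := by
  have hz : ∀ φ : E3 → ℝ, -∫ p : ℝ × ℝ, φ (!₂[p.1, p.2, 0]) •
      (0 : Lp ℂ 2 (volume : Measure (ℝ × ℝ))) p = 0 := fun φ => by
    rw [neg_eq_zero, ← integral_zero (ℝ × ℝ) ℂ]
    refine integral_congr_ae ?_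
    filter_upwards [Lp.coeFn_zero ℂ 2 (volume : Measure (ℝ × ℝ))] with p hp
    simp
  have hs : ∀ φ : E3 → ℝ, IsTestFunction φ →
      ∫ x, (fderiv ℝ φ x (unitVec 2) • f x + φ x • h x) ∂halfVol
      = ∫ x, fderiv ℝ φ x (unitVec 2) • f x ∂halfVol + ∫ x, φ x • h x ∂halfVol := fun φ hφ =>
    integral_add (integrable_smul_of_memLp_two ((hφ.partial _).memLp _) f)
      (integrable_smul_of_memLp_two (hφ.memLp _) h)
  constructor
  · rintro ⟨w, hw', ht⟩ φ hφ
    rw [hw'.ae_eq hw] at ht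
    have := ht φ hφ
    rw [hz, hs φ hφ] at this
    exact eq_neg_of_add_eq_zero_left this
  · intro H
    refine ⟨h, hw, fun φ hφ => ?_⟩
    rw [hz, hs φ hφ, H φ hφ, neg_add_cancel]

/-- Everything depends on whether the symmetrised test function sees the boundary. Tangential
derivatives create no boundary term. For the normal derivative of an even extension the test
function becomes φ - φ∘R (R the reflection), which vanishes on the plane. Only the normal derivative
of an odd extension needs a zero trace. -/
theorem IsWeakPartial.extLp {i : Fin 3} {f h : Lp ℂ 2 halfVol} (hw : IsWeakPartial i f h)
    {σ : ℝ} (hσ : σ = 1 ∨ σ = -1) (ht : i = 2 → σ = -1 → IsTrace f 0) :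
    IsFullWeakPartial i (extLp σ f) (extLp (flipParity σ i) h) := by
  intro φ hφ
  rw [integral_smul_extLp ((hφ.partial _).memLp _), integral_smul_extLp (hφ.memLp _)]
  simp_rw [← fderiv_add_refl hφ]
  have hΦ := hφ.add_smul hφ.comp_refl (flipParity σ i)
  by_cases h2 : i = 2 ∧ σ = -1
  · obtain ⟨rfl, rfl⟩ := h2
    exact (isTrace_zero_iff hw).mp (ht rfl rfl) _ hΦ
  · refine hw.integral_eq hΦ fun hi x hx => ?_
    have h1 : σ = 1 := by tauto
    have hr : refl x = x := by
      ext j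
      rw [refl_apply]
      split_ifs with hj
      · rw [hj, hx, neg_zero]
      · rfl
    simp [hr, h1, hi, flipParity]

theorem IsFullWeakPartial.restr {i : Fin 3} {P H : Lp ℂ 2 (volume : Measure E3)}
    (hw : IsFullWeakPartial i P H) : IsWeakPartial i (restrLp P) (restrLp H) := by
  have key : ∀ (ψ : E3 → ℝ) (Q : Lp ℂ 2 (volume : Measure E3)), (∀ x, x ∉ halfSpace → ψ x = 0) →
      ∫ x, ψ x • restrLp Q x ∂halfVol = ∫ x, ψ x • Q x := fun ψ Q h0 => by
    rw [← setIntegral_eq_integral_of_forall_compl_eq_zero (μ := volume) (s := halfSpace)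
      (f := fun x => ψ x • Q x) (fun x hx => by rw [h0 x hx, zero_smul])]
    refine integral_congr_ae ?_
    filter_upwards [restrLp_ae Q] with x hx
    rw [hx]
  intro φ hφ
  rw [key φ H fun x hx => image_eq_zero_of_notMem_tsupport fun h => hx (hφ.2 h),
    key (fun x => fderiv ℝ φ x (unitVec i)) P fun x hx =>
      image_eq_zero_of_notMem_tsupport (f := fun x => fderiv ℝ φ x (unitVec i)) fun h =>
        hx (hφ.2 (tsupport_fderiv_apply_subset ℝ _ h))]
  exact hw φ hφ.1

/-- The weak identity holds for the odd extension by assumption and for the even one without any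
condition. In their average the reflected terms cancel, which leaves the Gauss-Green formula without
boundary term. -/
theorem isTrace_of_full {f h : Lp ℂ 2 halfVol}
    (hw : IsFullWeakPartial 2 (extLp (-1) f) (extLp 1 h)) : IsTrace f 0 := by
  have hw2 : IsWeakPartial 2 f h := by
    have := hw.restr
    rwa [restrLp_extLp, restrLp_extLp] at this
  refine (isTrace_zero_iff hw2).mpr fun φ hφ => ?_
  have e1 := hw φ hφ
  rw [integral_smul_extLp ((hφ.partial _).memLp _), integral_smul_extLp (hφ.memLp _)] at e1
  have hw3 := hw2.extLp (σ := 1) (Or.inl rfl) (by norm_num)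
  have e2 := hw3 φ hφ
  rw [integral_smul_extLp ((hφ.partial _).memLp _), integral_smul_extLp (hφ.memLp _)] at e2
  have i1 := integrable_smul_of_memLp_two ((hφ.partial (unitVec 2)).memLp halfVol) f
  have i2 := integrable_smul_of_memLp_two (hφ.memLp halfVol) h
  have i3 := integrable_smul_of_memLp_two ((hφ.partial (unitVec 2)).comp_refl.memLp halfVol) f
  have i4 := integrable_smul_of_memLp_two (hφ.comp_refl.memLp halfVol) h
  have i5 : Integrable (fun x => -(fderiv ℝ φ (refl x) (unitVec 2) • f x)) halfVol := i3.neg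
  have i6 : Integrable (fun x => -(φ (refl x) • h x)) halfVol := i4.neg
  simp only [flipParity, if_true, one_mul, neg_mul, add_smul, neg_smul] at e1 e2
  rw [integral_add i1 i5, integral_add i2 i4, integral_neg] at e1
  rw [integral_add i1 i3, integral_add i2 i6, integral_neg] at e2
  linear_combination (e1 + e2) / 2

theorem IsWeakPartial.const_smul {i : Fin 3} {f h : Lp ℂ 2 halfVol} (hw : IsWeakPartial i f h)
    (c : ℂ) : IsWeakPartial i (c • f) (c • h) := by
  have key : ∀ (ψ : E3 → ℝ) (g : Lp ℂ 2 halfVol),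
      ∫ x, ψ x • (c • g : Lp ℂ 2 halfVol) x ∂halfVol = c • ∫ x, ψ x • g x ∂halfVol :=
    fun ψ g => by
      rw [← integral_smul]
      refine integral_congr_ae ?_
      filter_upwards [Lp.coeFn_smul c g] with x hx
      rw [hx, Pi.smul_apply, smul_comm]
  intro φ hφ
  rw [key, key, hw φ hφ, smul_neg]

theorem IsTrace.const_smul {f : Lp ℂ 2 halfVol} (h : IsTrace f 0) (c : ℂ) :
    IsTrace (c • f) 0 := by
  have key : ∀ (ψ : E3 → ℝ) (g : Lp ℂ 2 halfVol),
      ∫ x, ψ x • (c • g : Lp ℂ 2 halfVol) x ∂halfVol = c • ∫ x, ψ x • g x ∂halfVol :=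
    fun ψ g => by
      rw [← integral_smul]
      refine integral_congr_ae ?_
      filter_upwards [Lp.coeFn_smul c g] with x hx
      rw [hx, Pi.smul_apply, smul_comm]
  obtain ⟨w, hw, -⟩ := id h
  refine (isTrace_zero_iff (hw.const_smul c)).mpr fun φ hφ => ?_
  rw [key, key, (isTrace_zero_iff hw).mp h φ hφ, smul_neg]

theorem isTrace_const_smul_iff {f : Lp ℂ 2 halfVol} {c : ℂ} (hc : c ≠ 0) :
    IsTrace (c • f) 0 ↔ IsTrace f 0 :=
  ⟨fun h => by simpa [smul_smul, hc] using h.const_smul c⁻¹, fun h => h.const_smul c⟩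

/-- The symbol `1 + 4π²L²|k|²` of `1 - L²Δ`. -/
def lam (L : ℝ) (k : E3) : ℝ := 1 + (2 * Real.pi * L) ^ 2 * ‖k‖ ^ 2

theorem one_le_lam (L : ℝ) (k : E3) : 1 ≤ lam L k := by
  unfold lam; nlinarith [mul_nonneg (sq_nonneg (2 * Real.pi * L)) (sq_nonneg ‖k‖)]

theorem lam_pos (L : ℝ) (k : E3) : 0 < lam L k := one_pos.trans_le (one_le_lam L k)

theorem continuous_lam (L : ℝ) : Continuous (lam L) := by unfold lam; fun_prop

theorem lam_refl (L : ℝ) (k : E3) : lam L (refl k) = lam L k := by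
  simp [lam]

theorem lam_neg (L : ℝ) (k : E3) : lam L (-k) = lam L k := by simp [lam]

theorem continuous_symb (i : Fin 3) : Continuous (symb i) := by unfold symb; fun_prop

theorem symb_refl (i : Fin 3) (k : E3) : symb i (refl k) = (flipParity 1 i : ℝ) * symb i k := by
  unfold symb flipParity
  rw [refl_apply]
  split_ifs <;> simp

theorem norm_symb_le (i : Fin 3) (k : E3) : ‖symb i k‖ ≤ 2 * Real.pi * ‖k‖ := by
  have : ‖symb i k‖ = 2 * Real.pi * |k i| := by
    simp [symb, abs_of_pos Real.pi_pos]
  rw [this]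
  gcongr
  exact PiLp.norm_apply_le k i

theorem sum_symb_sq (k : E3) : ∑ i, symb i k * symb i k = -(((2 * Real.pi) ^ 2 * ‖k‖ ^ 2 : ℝ) : ℂ) := by
  rw [EuclideanSpace.norm_sq_eq]
  simp only [Fin.sum_univ_three, symb, Real.norm_eq_abs, sq_abs]
  push_cast
  linear_combination (4 * (Real.pi : ℂ) ^ 2 * (k 0 ^ 2 + k 1 ^ 2 + k 2 ^ 2)) * Complex.I_sq

theorem lam_eq (L : ℝ) (k : E3) :
    (lam L k : ℂ) = 1 - ((L ^ 2 : ℝ) : ℂ) * ∑ i, symb i k * symb i k := by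
  rw [sum_symb_sq, lam]
  push_cast
  ring

/-! ### Symbols dominated by λ and the two directions of the diagonalisation -/

theorem norm_symb_le_lam {L : ℝ} (hL : 0 < L) (i : Fin 3) (k : E3) :
    ‖symb i k‖ ≤ (2 * L)⁻¹ * lam L k := by
  refine (norm_symb_le i k).trans ?_
  rw [le_inv_mul_iff₀ (by positivity), lam]
  nlinarith [sq_nonneg (2 * Real.pi * L * ‖k‖ - 1)]

theorem norm_symb_symb_le_lam {L : ℝ} (hL : 0 < L) (i j : Fin 3) (k : E3) :
    ‖symb i k * symb j k‖ ≤ (L ^ 2)⁻¹ * lam L k := by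
  rw [norm_mul]
  refine (mul_le_mul (norm_symb_le i k) (norm_symb_le j k) (norm_nonneg _)
    (by positivity)).trans ?_
  rw [le_inv_mul_iff₀ (by positivity), lam]
  nlinarith

/-- Elliptic regularity on the Fourier side: if λ 𝓕P is in L², so is m 𝓕P for each m = O(λ). Parity
is tracked so that the result is again the extension of its restriction. -/
theorem exists_multiplier {L C : ℝ} {m : E3 → ℂ} (hm : Continuous m)
    (hC : ∀ k, ‖m k‖ ≤ C * lam L k) {P Q : Lp ℂ 2 (volume : Measure E3)}
    (h : ∀ᵐ k, 𝓕 Q k = lam L k * 𝓕 P k) {s σ : ℝ} (hs : ∀ k, m (refl k) = s * m k)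
    (hP : HasParity σ P) :
    ∃ H : Lp ℂ 2 (volume : Measure E3), (∀ᵐ k, 𝓕 H k = m k * 𝓕 P k) ∧ HasParity (s * σ) H := by
  have hmem : MemLp (fun k => m k * 𝓕 P k) 2 volume := by
    refine MemLp.of_le_mul (c := C) (Lp.memLp (𝓕 Q))
      (hm.aestronglyMeasurable.mul (Lp.aestronglyMeasurable (𝓕 P))) ?_
    filter_upwards [h] with k hk
    rw [hk, norm_mul, norm_mul, ← mul_assoc, Complex.norm_real, Real.norm_eq_abs,
      abs_of_pos (lam_pos L k)]
    gcongr
    exact hC k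
  have hae : ∀ᵐ k, 𝓕 (𝓕⁻ hmem.toLp : Lp ℂ 2 (volume : Measure E3)) k = m k * 𝓕 P k := by
    rw [FourierInvPair.fourier_fourierInv_eq]
    exact hmem.coeFn_toLp
  refine ⟨𝓕⁻ hmem.toLp, hae, HasParity.of_fourier (hasParity_iff.mpr ?_)⟩
  filter_upwards [hae, measurePreserving_refl.quasiMeasurePreserving.ae hae,
    hasParity_iff.mp hP.fourier] with k h1 h2 h3
  rw [h2, h1, hs, h3]
  push_cast
  ring

/-- ∂_z exchanges the parities. An odd extension therefore needs a trace condition at the first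
normal derivative, hence on f, and an even one at the second, hence on ∂_z f. -/
theorem lam_mul_fourier_extLp {L σ : ℝ} (hσ : σ = 1 ∨ σ = -1) {f : Lp ℂ 2 halfVol}
    {D : Fin 3 → Lp ℂ 2 halfVol} {D2 : Fin 3 → Fin 3 → Lp ℂ 2 halfVol}
    (hD : ∀ i, IsWeakPartial i f (D i)) (hD2 : ∀ i j, IsWeakPartial j (D i) (D2 i j))
    (h1 : σ = -1 → IsTrace f 0) (h2 : σ = 1 → IsTrace (D 2) 0) :
    ∀ᵐ k, 𝓕 (extLp σ (f - ((L ^ 2 : ℝ) : ℂ) • ∑ i, D2 i i)) k = lam L k * 𝓕 (extLp σ f) k := by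
  have e1 : ∀ i, ∀ᵐ k, 𝓕 (extLp σ (D2 i i)) k = symb i k * (symb i k * 𝓕 (extLp σ f) k) := by
    intro i
    have a1 := ((hD i).extLp hσ fun _ h => h1 h).fourier
    have hσ' : flipParity σ i = 1 ∨ flipParity σ i = -1 := by
      unfold flipParity
      split_ifs
      · rcases hσ with rfl | rfl <;> simp
      · exact hσ
    have a2 := ((hD2 i i).extLp hσ' fun hi h => by
      subst hi
      refine h2 ?_
      simp only [flipParity, if_true] at h
      linarith).fourier
    rw [flipParity_flipParity] at a2
    filter_upwards [a1, a2] with k b1 b2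
    rw [b2, b1]
  have e2 : 𝓕 (extLp σ (f - ((L ^ 2 : ℝ) : ℂ) • ∑ i, D2 i i))
      = 𝓕 (extLp σ f) - ((L ^ 2 : ℝ) : ℂ) • (𝓕 (extLp σ (D2 0 0)) + 𝓕 (extLp σ (D2 1 1))
        + 𝓕 (extLp σ (D2 2 2))) := by
    rw [Fin.sum_univ_three, map_sub, map_smul, map_add, map_add]
    simp only [sub_eq_add_neg, ← neg_smul, FourierTransform.fourier_add,
      FourierTransform.fourier_smul]
  rw [e2]
  filter_upwards [e1 0, e1 1, e1 2, Lp.coeFn_sub (𝓕 (extLp σ f)) (((L ^ 2 : ℝ) : ℂ) •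
    (𝓕 (extLp σ (D2 0 0)) + 𝓕 (extLp σ (D2 1 1)) + 𝓕 (extLp σ (D2 2 2)))),
    Lp.coeFn_smul (((L ^ 2 : ℝ) : ℂ)) (𝓕 (extLp σ (D2 0 0)) + 𝓕 (extLp σ (D2 1 1))
      + 𝓕 (extLp σ (D2 2 2))),
    Lp.coeFn_add (𝓕 (extLp σ (D2 0 0)) + 𝓕 (extLp σ (D2 1 1))) (𝓕 (extLp σ (D2 2 2))),
    Lp.coeFn_add (𝓕 (extLp σ (D2 0 0))) (𝓕 (extLp σ (D2 1 1)))] with k c0 c1 c2 c3 c4 c5 c6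
  rw [c3, Pi.sub_apply, c4, Pi.smul_apply, c5, Pi.add_apply, c6, Pi.add_apply, c0, c1, c2, lam_eq,
    Fin.sum_univ_three, smul_eq_mul]
  ring

/-- The derivatives are built on the whole space as Fourier multipliers and then restricted. By
parity they are extensions of their restrictions, so `isTrace_of_full` yields the boundary
condition. -/
theorem exists_weakPartials {L σ : ℝ} (hL : 0 < L) (hσ : σ = 1 ∨ σ = -1) {f h : Lp ℂ 2 halfVol}
    (hfh : ∀ᵐ k, 𝓕 (extLp σ h) k = lam L k * 𝓕 (extLp σ f) k) :
    ∃ (D : Fin 3 → Lp ℂ 2 halfVol) (D2 : Fin 3 → Fin 3 → Lp ℂ 2 halfVol),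
      (∀ i, IsWeakPartial i f (D i)) ∧ (∀ i j, IsWeakPartial j (D i) (D2 i j)) ∧
      (σ = -1 → IsTrace f 0) ∧ (σ = 1 → IsTrace (D 2) 0) ∧
      h = f - ((L ^ 2 : ℝ) : ℂ) • ∑ i, D2 i i := by
  have hσ2 : σ * σ = 1 := by rcases hσ with rfl | rfl <;> norm_num
  have hpar := hasParity_extLp hσ2 f
  have hfl : ∀ (τ : ℝ) i, flipParity 1 i * τ = flipParity τ i := fun τ i => by
    unfold flipParity; split_ifs <;> simp
  have ex1 := fun i => exists_multiplier (continuous_symb i) (norm_symb_le_lam hL i) hfh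
    (symb_refl i) hpar
  choose H hH hHp using ex1
  have ex2 := fun i j => exists_multiplier (m := fun k => symb i k * symb j k)
    (s := flipParity 1 j * flipParity 1 i)
    ((continuous_symb i).mul (continuous_symb j)) (norm_symb_symb_le_lam hL i j) hfh
    (fun k => by rw [symb_refl, symb_refl]; push_cast; ring) hpar
  choose H2 hH2 hH2p using ex2
  have hHw : ∀ i, IsFullWeakPartial i (extLp σ f) (H i) := fun i => .of_fourier (hH i)
  have hH2w : ∀ i j, IsFullWeakPartial j (H i) (H2 i j) := fun i j => .of_fourier (by
    filter_upwards [hH i, hH2 i j] with k a b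
    rw [a, b]
    ring)
  have hHe : ∀ i, extLp (flipParity σ i) (restrLp (H i)) = H i := fun i =>
    extLp_restrLp (by simpa only [hfl] using hHp i)
  have hH2e : ∀ i, extLp σ (restrLp (H2 i i)) = H2 i i := fun i =>
    extLp_restrLp (by simpa only [flipParity_sq (one_mul 1), one_mul] using hH2p i i)
  refine ⟨fun i => restrLp (H i), fun i j => restrLp (H2 i j), fun i => ?_, fun i j => ?_,
    fun h1 => ?_, fun h1 => ?_, ?_⟩
  · have := (hHw i).restr
    rwa [restrLp_extLp] at this
  · exact (hH2w i j).restr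
  · subst h1
    refine isTrace_of_full (h := restrLp (H 2)) ?_
    have := hHe 2
    simp only [flipParity, if_true, neg_neg] at this
    rw [this]
    exact hHw 2
  · subst h1
    refine isTrace_of_full (h := restrLp (H2 2 2)) ?_
    have := hHe 2
    simp only [flipParity, if_true] at this
    rw [this, hH2e]
    exact hH2w 2 2
  · have e : 𝓕 (extLp σ h) = 𝓕 (extLp σ f - ((L ^ 2 : ℝ) : ℂ) • (H2 0 0 + H2 1 1 + H2 2 2)) := by
      have e2 : 𝓕 (extLp σ f - ((L ^ 2 : ℝ) : ℂ) • (H2 0 0 + H2 1 1 + H2 2 2))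
          = 𝓕 (extLp σ f) - ((L ^ 2 : ℝ) : ℂ) • (𝓕 (H2 0 0) + 𝓕 (H2 1 1) + 𝓕 (H2 2 2)) := by
        simp only [sub_eq_add_neg, ← neg_smul, FourierTransform.fourier_add,
          FourierTransform.fourier_smul]
      rw [e2]
      refine Lp.ext ?_
      filter_upwards [hfh, hH2 0 0, hH2 1 1, hH2 2 2, Lp.coeFn_sub (𝓕 (extLp σ f))
        (((L ^ 2 : ℝ) : ℂ) • (𝓕 (H2 0 0) + 𝓕 (H2 1 1) + 𝓕 (H2 2 2))),
        Lp.coeFn_smul (((L ^ 2 : ℝ) : ℂ)) (𝓕 (H2 0 0) + 𝓕 (H2 1 1) + 𝓕 (H2 2 2)),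
        Lp.coeFn_add (𝓕 (H2 0 0) + 𝓕 (H2 1 1)) (𝓕 (H2 2 2)),
        Lp.coeFn_add (𝓕 (H2 0 0)) (𝓕 (H2 1 1))] with k c c0 c1 c2 c3 c4 c5 c6
      rw [c, c3, Pi.sub_apply, c4, Pi.smul_apply, c5, Pi.add_apply, c6, Pi.add_apply, c0, c1, c2,
        lam_eq, Fin.sum_univ_three, smul_eq_mul]
      ring
    have e3 := congrArg (fun P => restrLp (𝓕⁻ P)) e
    simp only [FourierPair.fourierInv_fourier_eq, restrLp_extLp, map_sub, map_smul, map_add] at e3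
    rw [e3, Fin.sum_univ_three]

/-- The parity of the `c`-th component: odd for the tangential ones, even for the normal one. -/
def par (c : Fin 3) : ℝ := if c = 2 then 1 else -1

theorem par_cases (c : Fin 3) : par c = 1 ∨ par c = -1 := by
  unfold par; split_ifs <;> simp

theorem par_eq_one {c : Fin 3} (h : par c = 1) : c = 2 := by
  by_contra hc
  norm_num [par, hc] at h

theorem par_eq_neg_one {c : Fin 3} (h : par c = -1) : c = 0 ∨ c = 1 := by
  by_cases hc : c = 2
  · norm_num [par, hc] at h
  · omega

theorem par_sq (c : Fin 3) : par c * par c = 1 := by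
  unfold par; split_ifs <;> simp

/-- For κ = 0 the third condition is ∂_z f₃ = 0 up to the nonzero factor L². The boundary conditions
are then exactly those that the parities `par` require. -/
theorem vkOperator_iff {L : ℝ} (hL : 0 < L) (f h : L2Vec ℂ) :
    vkOperator L 0 f h ↔
      ∀ c, ∀ᵐ k, 𝓕 (extLp (par c) (h c)) k = lam L k * 𝓕 (extLp (par c) (f c)) k := by
  have hc : ((L ^ 2 : ℝ) : ℂ) ≠ 0 := by exact_mod_cast (pow_pos hL 2).ne'
  constructor
  · rintro ⟨D, D2, hD, hD2, t0, t1, t2, e⟩ c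
    rw [Complex.ofReal_zero, zero_smul, zero_add, isTrace_const_smul_iff hc] at t2
    rw [e c]
    refine lam_mul_fourier_extLp (par_cases c) (hD c) (hD2 c) (fun hp => ?_) (fun hp => ?_)
    · rcases par_eq_neg_one hp with rfl | rfl
      · exact t0
      · exact t1
    · rw [par_eq_one hp]
      exact t2
  · intro H
    choose D D2 hD hD2 t1 t2 e using fun c => exists_weakPartials hL (par_cases c) (H c)
    refine ⟨D, D2, hD, hD2, t1 0 (by simp [par]), t1 1 (by simp [par]), ?_, e⟩
    rw [Complex.ofReal_zero, zero_smul, zero_add, isTrace_const_smul_iff hc]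
    exact t2 2 (by simp [par])

/-! ### The spectral representation -/

/-- The sine transform (`σ = -1`) or cosine transform (`σ = 1`) on the half-space. -/
def halfFourier {σ : ℝ} (hσ : σ * σ = 1) : Lp ℂ 2 halfVol ≃ₗᵢ[ℂ] Lp ℂ 2 halfVol :=
  LinearIsometryEquiv.ofSurjective
    { toLinearMap := restrLp.toLinearMap ∘ₗ
        (Lp.fourierTransformₗᵢ E3 ℂ).toLinearEquiv.toLinearMap ∘ₗ extLp σ
      norm_map' := fun f => by
        have h1 := norm_sq_of_hasParity hσ (hasParity_extLp hσ f)
        have h2 := norm_sq_of_hasParity hσ (hasParity_extLp hσ f).fourier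
        rw [restrLp_extLp] at h1
        rw [Lp.norm_fourier_eq, h1] at h2
        have h3 : ‖f‖ ^ 2 = ‖restrLp (𝓕 (extLp σ f))‖ ^ 2 := by linarith
        exact ((sq_eq_sq₀ (norm_nonneg _) (norm_nonneg _)).mp h3).symm }
    (fun g => by
      have hp : HasParity σ (𝓕⁻ (extLp σ g)) := by
        refine HasParity.of_fourier ?_
        rw [FourierInvPair.fourier_fourierInv_eq]
        exact hasParity_extLp hσ g
      refine ⟨restrLp (𝓕⁻ (extLp σ g)), ?_⟩
      change restrLp (𝓕 (extLp σ (restrLp (𝓕⁻ (extLp σ g))))) = g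
      rw [extLp_restrLp hp, FourierInvPair.fourier_fourierInv_eq, restrLp_extLp])

theorem halfFourier_apply {σ : ℝ} (hσ : σ * σ = 1) (f : Lp ℂ 2 halfVol) :
    halfFourier hσ f = restrLp (𝓕 (extLp σ f)) := rfl

/-- A multiplier relation between even or odd functions may be checked on the half-space. -/
theorem halfFourier_multiplier_iff {σ : ℝ} (hσ : σ * σ = 1) {r : E3 → ℝ}
    (hr : ∀ k, r (refl k) = r k) (f h : Lp ℂ 2 halfVol) :
    (∀ᵐ k ∂halfVol, halfFourier hσ h k = r k * halfFourier hσ f k) ↔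
      ∀ᵐ k, 𝓕 (extLp σ h) k = r k * 𝓕 (extLp σ f) k := by
  have e1 := restrLp_ae (𝓕 (extLp σ h))
  have e2 := restrLp_ae (𝓕 (extLp σ f))
  rw [halfFourier_apply, halfFourier_apply]
  constructor
  · intro H
    refine ae_iff_half.mpr ⟨?_, ?_⟩
    · filter_upwards [H, e1, e2] with k a b c
      rw [← b, ← c, a]
    · filter_upwards [H, e1, e2,
        ae_halfVol_of_ae (hasParity_iff.mp (hasParity_extLp hσ h).fourier),
        ae_halfVol_of_ae (hasParity_iff.mp (hasParity_extLp hσ f).fourier)] with k a b c d e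
      rw [d, e, hr, ← b, ← c, a]
      ring
  · intro H
    filter_upwards [ae_halfVol_of_ae H, e1, e2] with k a b c
    rw [b, c, a]

/-- Three copies of the half-space. -/
def specMeasure : Measure (Fin 3 × E3) := Measure.sum fun c => halfVol.map (Prod.mk c)

theorem specEmbedding (c : Fin 3) : MeasurableEmbedding (Prod.mk c : E3 → Fin 3 × E3) :=
  measurableEmbedding_prodMk_left c

theorem ae_specMeasure_iff {p : Fin 3 × E3 → Prop} :
    (∀ᵐ y ∂specMeasure, p y) ↔ ∀ c, ∀ᵐ k ∂halfVol, p (c, k) := by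
  unfold specMeasure
  rw [Measure.ae_sum_iff]
  simp_rw [(specEmbedding _).ae_map_iff]

theorem sigmaFinite_specMeasure : SigmaFinite specMeasure := by
  have : ∀ c : Fin 3, SigmaFinite (halfVol.map (Prod.mk c)) := fun c =>
    (specEmbedding c).sigmaFinite_map
  unfold specMeasure
  infer_instance

theorem map_le_specMeasure (c : Fin 3) : halfVol.map (Prod.mk c) ≤ specMeasure :=
  Measure.le_sum (fun c => halfVol.map (Prod.mk c)) c

theorem measurable_glue (f : Fin 3 → Lp ℂ 2 halfVol) :
    Measurable (fun y : Fin 3 × E3 => f y.1 y.2) :=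
  measurable_from_prod_countable_right fun c => (Lp.stronglyMeasurable (f c)).measurable

theorem memLp_glue (f : Fin 3 → Lp ℂ 2 halfVol) :
    MemLp (fun y : Fin 3 × E3 => f y.1 y.2) 2 specMeasure := by
  refine ⟨(measurable_glue f).aestronglyMeasurable, ?_⟩
  rw [eLpNorm_lt_top_iff_lintegral_rpow_enorm_lt_top (by simp) (by simp), specMeasure,
    lintegral_sum_measure, tsum_fintype]
  refine ENNReal.sum_lt_top.mpr fun c _ => ?_
  rw [(specEmbedding c).lintegral_map]
  exact (eLpNorm_lt_top_iff_lintegral_rpow_enorm_lt_top (by simp) (by simp)).mp (Lp.memLp (f c)).2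

/-- The unitary identification of vector fields with functions on three copies of the half-space. -/
def glueLp : L2Vec ℂ ≃ₗᵢ[ℂ] Lp ℂ 2 specMeasure :=
  LinearIsometryEquiv.ofSurjective
    { toFun := fun f => (memLp_glue f).toLp
      map_add' := fun f g => by
        refine Lp.ext ((MemLp.coeFn_toLp _).trans (EventuallyEq.trans ?_
          ((Lp.coeFn_add _ _).trans ((MemLp.coeFn_toLp _).add (MemLp.coeFn_toLp _))).symm))
        refine ae_specMeasure_iff.mpr fun c => ?_
        exact Lp.coeFn_add (f c) (g c)
      map_smul' := fun r f => by
        refine Lp.ext ((MemLp.coeFn_toLp _).trans (EventuallyEq.trans ?_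
          ((Lp.coeFn_smul _ _).trans ((MemLp.coeFn_toLp (memLp_glue f)).const_smul r)).symm))
        refine ae_specMeasure_iff.mpr fun c => ?_
        exact Lp.coeFn_smul r (f c)
      norm_map' := fun f => by
        refine (sq_eq_sq₀ (norm_nonneg _) (norm_nonneg _)).mp ?_
        have hi := (memLp_two_iff_integrable_sq_norm (memLp_glue f).1).mp (memLp_glue f)
        have h1 : ‖(memLp_glue f).toLp‖ ^ 2 = ∫ y, ‖f y.1 y.2‖ ^ 2 ∂specMeasure := by
          rw [norm_sq_Lp]
          refine integral_congr_ae ?_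
          filter_upwards [(memLp_glue f).coeFn_toLp] with y hy
          rw [hy]
        change ‖(memLp_glue f).toLp‖ ^ 2 = ‖f‖ ^ 2
        rw [h1, specMeasure, integral_sum_measure hi, tsum_fintype, PiLp.norm_sq_eq_of_L2]
        refine Finset.sum_congr rfl fun c _ => ?_
        rw [(specEmbedding c).integral_map, norm_sq_Lp] }
    (fun g => by
      have hm : ∀ c, MemLp (fun k => g (c, k)) 2 halfVol := fun c =>
        (specEmbedding c).memLp_map_measure_iff.mp
          ((Lp.memLp g).mono_measure (map_le_specMeasure c))
      refine ⟨WithLp.toLp 2 fun c => (hm c).toLp, ?_⟩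
      refine Lp.ext ((MemLp.coeFn_toLp (memLp_glue _)).trans ?_)
      exact ae_specMeasure_iff.mpr fun c => (hm c).coeFn_toLp)

theorem glueLp_ae (f : L2Vec ℂ) : glueLp f =ᵐ[specMeasure] fun y => f y.1 y.2 :=
  (memLp_glue f).coeFn_toLp

/-- The unitary transformation that diagonalises the operator. -/
def specUnitary : L2Vec ℂ ≃ₗᵢ[ℂ] Lp ℂ 2 specMeasure :=
  (LinearIsometryEquiv.piLpCongrRight 2 fun c => halfFourier (par_sq c)).trans glueLp

theorem specUnitary_multiplier_iff {r : E3 → ℝ} (hr : ∀ k, r (refl k) = r k) (f h : L2Vec ℂ) :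
    (specUnitary h =ᵐ[specMeasure] fun y => (r y.2 : ℂ) * specUnitary f y) ↔
      ∀ c, ∀ᵐ k, 𝓕 (extLp (par c) (h c)) k = r k * 𝓕 (extLp (par c) (f c)) k := by
  have e : ∀ f : L2Vec ℂ, ∀ c, ∀ᵐ k ∂halfVol, specUnitary f (c, k) = halfFourier (par_sq c) (f c) k :=
    fun f => ae_specMeasure_iff.mp (glueLp_ae _)
  have h1 : (specUnitary h =ᵐ[specMeasure] fun y => (r y.2 : ℂ) * specUnitary f y) ↔
      ∀ c, ∀ᵐ k ∂halfVol, specUnitary h (c, k) = r k * specUnitary f (c, k) := ae_specMeasure_iff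
  rw [h1]
  refine forall_congr' fun c => ?_
  rw [← halfFourier_multiplier_iff (par_sq c) hr]
  refine eventually_congr ?_
  filter_upwards [e f c, e h c] with k a b
  rw [a, b]

/-- The definition of the power asks for one diagonalisation; the sine and cosine transforms supply
it. The multiplier identity may be checked on one half because λ is invariant under reflection. -/
theorem spectralPower_vkOperator {L : ℝ} (hL : 0 < L) (α : ℝ) {f h : L2Vec ℂ}
    (H : ∀ c, ∀ᵐ k, 𝓕 (extLp (par c) (h c)) k
      = ((lam L k ^ α : ℝ) : ℂ) * 𝓕 (extLp (par c) (f c)) k) :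
    spectralPower (vkOperator L 0) α f h := by
  refine ⟨Fin 3 × E3, inferInstance, specMeasure, fun y => lam L y.2, specUnitary,
    sigmaFinite_specMeasure, (continuous_lam L).measurable.comp measurable_snd, fun p q => ?_, ?_⟩
  · rw [vkOperator_iff hL, specUnitary_multiplier_iff (lam_refl L)]
  · exact (specUnitary_multiplier_iff (r := fun k => lam L k ^ α)
      (fun k => by rw [lam_refl]) f h).mpr H

/-! ### Real parts and components -/

/-- The real part of an `L²` function. -/
def reLp {α : Type*} [MeasurableSpace α] (m : Measure α) : Lp ℂ 2 m →L[ℝ] Lp ℝ 2 m :=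
  Complex.reCLM.compLpL 2 m

theorem reLp_ae {α : Type*} [MeasurableSpace α] {m : Measure α} (P : Lp ℂ 2 m) :
    reLp m P =ᵐ[m] fun x => (P x).re :=
  ContinuousLinearMap.coeFn_compLpL _ _

theorem ofReal_reLp_ae {α : Type*} [MeasurableSpace α] {m : Measure α} {P : Lp ℂ 2 m}
    (h : conjLp m P = P) : P =ᵐ[m] fun x => (reLp m P x : ℂ) := by
  have h1 := conjLp_ae P
  rw [h] at h1
  filter_upwards [h1, reLp_ae P] with x a b
  rw [b]
  exact (Complex.conj_eq_iff_re.mp a.symm).symm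

theorem norm_reLp {α : Type*} [MeasurableSpace α] {m : Measure α} {P : Lp ℂ 2 m}
    (h : conjLp m P = P) : ‖reLp m P‖ = ‖P‖ := by
  rw [Lp.norm_def, Lp.norm_def]
  congr 1
  refine eLpNorm_congr_norm_ae ?_
  filter_upwards [ofReal_reLp_ae h] with x hx
  rw [hx, Complex.norm_real]

theorem conjLp_restrLp {P : Lp ℂ 2 (volume : Measure E3)} (h : conjLp volume P = P) :
    conjLp halfVol (restrLp P) = restrLp P := by
  refine Lp.ext ?_
  have h1 := conjLp_ae P
  rw [h] at h1
  filter_upwards [conjLp_ae (restrLp P), restrLp_ae P, ae_halfVol_of_ae h1] with x a b c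
  rw [a, b, ← c]

/-- The vector field with `i`-th component `f` and the other components `0`. -/
def singleL (i : Fin 3) : Lp ℝ 2 halfVol →L[ℝ] L2Vec ℝ :=
  (PiLp.continuousLinearEquiv 2 ℝ (fun _ : Fin 3 => Lp ℝ 2 halfVol)).symm.toContinuousLinearMap ∘L
    ContinuousLinearMap.single ℝ (fun _ : Fin 3 => Lp ℝ 2 halfVol) i

theorem singleL_apply (i : Fin 3) (f : Lp ℝ 2 halfVol) (j : Fin 3) :
    singleL i f j = if j = i then f else 0 := by
  by_cases h : j = i
  · subst h
    simp [singleL]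
  · simp [singleL, h]

/-- Different components are orthogonal; this is what removes the cross terms from the second
moments of the curl. -/
theorem norm_sq_singleL_sub {i j : Fin 3} (hij : i ≠ j) (f g : Lp ℝ 2 halfVol) :
    ‖singleL i f - singleL j g‖ ^ 2 = ‖f‖ ^ 2 + ‖g‖ ^ 2 := by
  rw [PiLp.norm_sq_eq_of_L2]
  have h : ∀ c, ‖(singleL i f - singleL j g) c‖ ^ 2
      = (if c = i then ‖f‖ ^ 2 else 0) + (if c = j then ‖g‖ ^ 2 else 0) := fun c => by
    rw [PiLp.sub_apply, singleL_apply, singleL_apply]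
    by_cases h1 : c = i
    · subst h1; simp [hij]
    · by_cases h2 : c = j
      · subst h2; simp [h1]
      · simp [h1, h2]
  simp_rw [h]
  rw [Finset.sum_add_distrib]
  simp

/-- The real-valued function on the half-space with the given Fourier transform. -/
def synth : Lp ℂ 2 (volume : Measure E3) →L[ℝ] Lp ℝ 2 halfVol :=
  reLp halfVol ∘L restrLp.restrictScalars ℝ ∘L
    (Lp.fourierTransformₗᵢ E3 ℂ).symm.toContinuousLinearEquiv.toContinuousLinearMap.restrictScalars ℝ

theorem synth_apply (G : Lp ℂ 2 (volume : Measure E3)) :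
    synth G = reLp halfVol (restrLp (𝓕⁻ G)) := rfl

/-- Hermitian symmetry makes the inverse transform real, so taking real parts loses nothing. Parity
puts half of its squared norm on the half-space. -/
theorem norm_sq_synth {σ : ℝ} (hσ : σ * σ = 1) {G : Lp ℂ 2 (volume : Measure E3)}
    (hp : HasParity σ G) (hc : ∀ᵐ k, conj (G (-k)) = G k) : 2 * ‖synth G‖ ^ 2 = ‖G‖ ^ 2 := by
  have hp' : HasParity σ (𝓕⁻ G) := by
    refine HasParity.of_fourier ?_
    rwa [FourierInvPair.fourier_fourierInv_eq]
  rw [synth_apply, norm_reLp (conjLp_restrLp (conjLp_fourierInv_of_ae hc)),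
    ← norm_sq_of_hasParity hσ hp', ← Lp.norm_fourier_eq, FourierInvPair.fourier_fourierInv_eq]

/-! ### White noise -/

section Noise

variable {Ω : Type*} [MeasurableSpace Ω] {P : Measure Ω}

theorem integral_sq_Lp (f : Lp ℝ 2 P) : ∫ s, f s ^ 2 ∂P = ‖f‖ ^ 2 := by
  have h := L2.inner_def (𝕜 := ℝ) f f
  rw [real_inner_self_eq_norm_sq] at h
  rw [h]
  refine integral_congr_ae (ae_of_all _ fun s => ?_)
  simp [sq]

theorem IsWhiteNoise.norm_apply {ξ : L2Vec ℝ →ₗ[ℝ] Lp ℝ 2 P} (hξ : IsWhiteNoise P ξ)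
    (φ : L2Vec ℝ) : ‖ξ φ‖ = ‖φ‖ := by
  refine (sq_eq_sq₀ (norm_nonneg _) (norm_nonneg _)).mp ?_
  rw [← integral_sq_Lp]
  have h1 : ∫ s, ξ φ s ^ 2 ∂P = ∫ t, t ^ 2 ∂(P.map (ξ φ)) :=
    (integral_map (Lp.aestronglyMeasurable (ξ φ)).aemeasurable
      (by fun_prop : Continuous fun t : ℝ => t ^ 2).aestronglyMeasurable).symm
  have h2 := variance_fun_id_gaussianReal (μ := 0) (v := ‖φ‖₊ ^ 2)
  rw [variance_eq_integral (by fun_prop), integral_id_gaussianReal] at h2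
  rw [h1, hξ φ]
  simpa using h2

/-- White noise as an isometry. -/
def IsWhiteNoise.isometry {ξ : L2Vec ℝ →ₗ[ℝ] Lp ℝ 2 P} (hξ : IsWhiteNoise P ξ) :
    L2Vec ℝ →ₗᵢ[ℝ] Lp ℝ 2 P :=
  ⟨ξ, hξ.norm_apply⟩

end Noise

/-! ### The field tested against smooth functions -/

/-- The plane wave `exp (-2π i y·k)`. -/
def wave (y k : E3) : ℂ := Complex.exp (((-2 * Real.pi * inner ℝ y k : ℝ) : ℂ) * Complex.I)

theorem norm_wave (y k : E3) : ‖wave y k‖ = 1 := Complex.norm_exp_ofReal_mul_I _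

theorem continuous_wave_left (k : E3) : Continuous (fun y => wave y k) := by
  unfold wave; fun_prop

theorem continuous_wave_right (y : E3) : Continuous (fun k => wave y k) := by
  unfold wave; fun_prop

theorem wave_refl (y k : E3) : wave y (refl k) = wave (refl y) k := by
  rw [wave, wave, inner_refl_left]

theorem conj_wave_neg (y k : E3) : conj (wave y (-k)) = wave y k := by
  rw [wave, wave, ← Complex.exp_conj]
  have h2 : conj (2 : ℂ) = 2 := Complex.conj_ofReal 2
  simp [inner_neg_right, h2]

/-- The symmetrised plane wave. -/
def symWave (σ : ℝ) (y k : E3) : ℂ := wave y k + σ * wave (refl y) k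

theorem integral_halfVol_of_interior {F : Type*} [NormedAddCommGroup F] [NormedSpace ℝ F]
    {φ : E3 → ℝ} (hφ : IsInteriorTestFunction φ) (g : E3 → F) :
    ∫ x, φ x • g x ∂halfVol = ∫ x, φ x • g x :=
  setIntegral_eq_integral_of_forall_compl_eq_zero fun x hx => by
    rw [image_eq_zero_of_notMem_tsupport fun h => hx (hφ.2 h), zero_smul]

theorem integrable_test_smul {φ : E3 → ℝ} (hφ : IsTestFunction φ) {g : E3 → ℂ}
    (hg : Continuous g) (m : Measure E3) [IsFiniteMeasureOnCompacts m] :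
    Integrable (fun x => φ x • g x) m := by
  have hc : Continuous (fun x => φ x • g x) := hφ.1.continuous.smul hg
  have hs : HasCompactSupport (fun x => φ x • g x) :=
    hφ.2.mono' fun x hx => subset_tsupport _ fun h => hx (by simp [h])
  exact hc.integrable_of_hasCompactSupport hs

theorem fourier_symmetrize {φ : E3 → ℝ} (hφ : IsTestFunction φ) (σ : ℝ) (k : E3) :
    𝓕 (fun y => ((φ y + σ * φ (refl y) : ℝ) : ℂ)) k = ∫ y, φ y • symWave σ y k := by
  rw [Real.fourier_eq']
  have hw : Continuous fun y => wave y k := continuous_wave_left k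
  have h1 := integrable_test_smul hφ hw volume
  have h2 := integrable_test_smul hφ (g := fun y => wave (refl y) k)
    (hw.comp refl.continuous) volume
  have h3 := integrable_test_smul hφ.comp_refl hw volume
  have e1 : ∫ y, φ y • wave (refl y) k = ∫ y, φ (refl y) • wave y k := by
    rw [← measurePreserving_refl.integral_comp measurableEmbedding_refl
      (fun y => φ (refl y) • wave y k)]
    simp only [refl_refl]
  have e2 : ∫ y, φ y • symWave σ y k = (∫ y, φ y • wave y k) + σ * ∫ y, φ y • wave (refl y) k := by
    rw [← integral_const_mul, ← integral_add h1 (h2.const_mul _)]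
    congr 1
    ext y
    simp only [symWave, Complex.real_smul]
    ring
  rw [e2, e1, ← integral_const_mul, ← integral_add h1 (h3.const_mul _)]
  congr 1
  ext y
  simp only [wave, Complex.real_smul, smul_eq_mul]
  push_cast
  ring

/-- The support stays away from the plane, so the extension is smooth for either parity and its
transform is an ordinary integral against symmetrised waves. -/
theorem extLp_test {φ : E3 → ℝ} (hφ : IsInteriorTestFunction φ) {σ : ℝ}
    {f : Lp ℂ 2 halfVol} (hf : ∀ᵐ x ∂halfVol, f x = (φ x : ℂ)) :
    ∃ S : 𝓢(E3, ℂ), extLp σ f = S.toLp 2 volume ∧ ∀ k, 𝓕 S k = ∫ y, φ y • symWave σ y k := by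
  have hΦ := hφ.1.add_smul hφ.1.comp_refl σ
  have hc : ContDiff ℝ ∞ (fun y => ((φ y + σ * φ (refl y) : ℝ) : ℂ)) :=
    Complex.ofRealCLM.contDiff.comp hΦ.1
  have hs : HasCompactSupport (fun y => ((φ y + σ * φ (refl y) : ℝ) : ℂ)) :=
    hΦ.2.comp_left (g := fun t : ℝ => (t : ℂ)) rfl
  have h0 : ∀ x ∈ halfSpace, φ (refl x) = 0 := fun x hx => by
    refine image_eq_zero_of_notMem_tsupport fun h => ?_
    have h1 : 0 < refl x 2 := hφ.2 h
    have h2 : 0 < x 2 := hx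
    rw [refl_apply_two] at h1
    linarith
  refine ⟨hs.toSchwartzMap hc, ?_, fun k => ?_⟩
  · refine Lp.ext (EventuallyEq.trans ?_ (SchwartzMap.coeFn_toLp _ 2 volume).symm)
    refine ae_iff_half.mpr ⟨?_, ?_⟩
    · filter_upwards [extLp_ae_half σ f, hf, ae_halfVol_mem] with x a b c
      rw [a, b, HasCompactSupport.toSchwartzMap_toFun, h0 x c]
      simp
    · filter_upwards [extLp_refl_ae_half σ f, hf, ae_halfVol_mem] with x a b c
      rw [a, b, HasCompactSupport.toSchwartzMap_toFun, h0 x c, refl_refl]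
      simp
  · rw [SchwartzMap.fourier_coe]
    exact fourier_symmetrize hφ.1 σ k

section Field

variable {Ω : Type*} [MeasurableSpace Ω] {P : Measure Ω}

/-- The weak equation is applied to A^{-17/12}(φ e_i), obtained by dividing the transform of φ by
λ^{17/12}. Γ is Hermitian, so this field is real, and it has the right parity, so it is determined
by its restriction. -/
theorem IsSolution.integral_test {ξ : L2Vec ℝ →ₗ[ℝ] Lp ℝ 2 P} {μ L : ℝ} (hL : 0 < L)
    {ψ : RandomField P} (hψ : IsSolution P ξ μ L 0 ψ) (i : Fin 3) {φ : E3 → ℝ}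
    (hφ : IsInteriorTestFunction φ) {Γ : Lp ℂ 2 (volume : Measure E3)}
    (hΓ : ∀ᵐ k, Γ k = ((lam L k ^ (-(17 / 12) : ℝ) : ℝ) : ℂ) * ∫ y, φ y • symWave (par i) y k) :
    ∫ x, φ x • ψ i x ∂halfVol = (μ * L ^ (17 / 6 : ℝ)) • ξ (singleL i (synth Γ)) := by
  have hm : MemLp (fun x => (φ x : ℂ)) 2 halfVol := (hφ.1.memLp halfVol).ofReal
  obtain ⟨S, hS, hS'⟩ := extLp_test hφ (σ := par i) (f := hm.toLp) hm.coeFn_toLp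
  have hFS : ∀ᵐ k, 𝓕 (extLp (par i) hm.toLp) k = ∫ y, φ y • symWave (par i) y k := by
    rw [hS, SchwartzMap.toLp_fourier_eq]
    filter_upwards [SchwartzMap.coeFn_toLp (𝓕 S) 2 volume] with k hk
    rw [hk, hS']
  have hFS' : ∀ᵐ k, Γ k = ((lam L k ^ (-(17 / 12) : ℝ) : ℝ) : ℂ) * 𝓕 (extLp (par i) hm.toLp) k := by
    filter_upwards [hΓ, hFS] with k a b
    rw [a, b]
  have hpar : HasParity (par i) Γ := by
    refine hasParity_iff.mpr ?_
    filter_upwards [hFS', measurePreserving_refl.quasiMeasurePreserving.ae hFS',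
      hasParity_iff.mp (hasParity_extLp (par_sq i) hm.toLp).fourier] with k a b c
    rw [b, a, c, lam_refl]
    ring
  have hconj : ∀ᵐ k, conj (Γ (-k)) = Γ k := by
    filter_upwards [hΓ, (Measure.measurePreserving_neg volume).quasiMeasurePreserving.ae hΓ]
      with k a b
    rw [b, a, lam_neg, map_mul, Complex.conj_ofReal, ← integral_conj]
    congr 2
    ext y
    simp only [Complex.real_smul, map_mul, Complex.conj_ofReal, symWave, map_add, conj_wave_neg]
  have hreal := conjLp_restrLp (conjLp_fourierInv_of_ae hconj)
  have hpar' : HasParity (par i) (𝓕⁻ Γ) := by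
    refine HasParity.of_fourier ?_
    rwa [FourierInvPair.fourier_fourierInv_eq]
  have hzero : ∀ σ, extLp σ (0 : Lp ℂ 2 halfVol) = 0 := fun σ => map_zero _
  have h := hψ.equation (fun c => if c = i then φ else 0) (singleL i (synth Γ))
    (WithLp.toLp 2 fun c => if c = i then hm.toLp else 0)
    (WithLp.toLp 2 fun c => if c = i then restrLp (𝓕⁻ Γ) else 0) ?_ ?_ ?_ ?_
  · rw [← h, Finset.sum_eq_single i]
    · simp
    · intro b _ hb
      simp [hb]
    · simp
  · intro c
    split_ifs
    · exact hφ
    · refine ⟨⟨contDiff_const, HasCompactSupport.zero⟩, ?_⟩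
      simp [tsupport]
  · intro c
    by_cases hc : c = i
    · simpa [hc] using hm.coeFn_toLp
    · simp only [hc, if_false]
      filter_upwards [Lp.coeFn_zero ℂ 2 halfVol] with x hx
      rw [hx]
      simp
  · intro c
    rw [singleL_apply, synth_apply]
    by_cases hc : c = i
    · simpa [hc] using ofReal_reLp_ae hreal
    · simp only [hc, if_false]
      filter_upwards [Lp.coeFn_zero ℂ 2 halfVol, Lp.coeFn_zero ℝ 2 halfVol] with x hx hx'
      rw [hx, hx']
      simp
  · refine spectralPower_vkOperator hL _ fun c => ?_
    by_cases hc : c = i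
    · subst hc
      simp only [if_true]
      rw [extLp_restrLp hpar', FourierInvPair.fourier_fourierInv_eq]
      filter_upwards [hFS'] with k hk
      rw [hk, ← mul_assoc]
      norm_cast
      rw [← Real.rpow_add (lam_pos L k)]
      norm_num
    · simp only [hc, if_false]
      have h0 : 𝓕 (extLp (par c) (0 : Lp ℂ 2 halfVol)) = 0 := by
        rw [map_zero]
        exact map_zero (Lp.fourierTransformₗᵢ E3 ℂ)
      rw [h0]
      filter_upwards [Lp.coeFn_zero ℂ 2 (volume : Measure E3)] with k hk
      rw [hk]
      simp

end Field

/-! ### Mollification -/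

theorem exists_mollifier {x : E3} (hx : x ∈ halfSpace) : ∃ ρ : ℕ → E3 → ℝ,
    (∀ n, IsInteriorTestFunction (ρ n)) ∧ (∀ n y, 0 ≤ ρ n y) ∧ (∀ n, ∫ y, ρ n y ∂halfVol = 1) ∧
    ∀ U ∈ 𝓝 x, ∀ᶠ n in atTop, ∀ y ∉ U, ρ n y = 0 := by
  have hx2 : 0 < x 2 := hx
  -- The denominator n + 2 keeps the closed ball inside the open half-space already for n = 0.
  have hr : ∀ n : ℕ, 0 < x 2 / (n + 2) := fun n => by positivity
  let b : ∀ n : ℕ, ContDiffBump x := fun n =>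
    ⟨x 2 / (n + 2) / 2, x 2 / (n + 2), half_pos (hr n), half_lt_self (hr n)⟩
  have hts : ∀ n, tsupport ((b n).normed volume) = Metric.closedBall x (x 2 / (n + 2)) := fun n =>
    (b n).tsupport_normed_eq
  have hint : ∀ n, IsInteriorTestFunction ((b n).normed volume) := fun n => by
    refine ⟨⟨(b n).contDiff_normed, (b n).hasCompactSupport_normed⟩, ?_⟩
    rw [hts]
    intro y hy
    have h1 : |y 2 - x 2| ≤ x 2 / (n + 2) :=
      (PiLp.norm_apply_le (y - x) 2).trans (by simpa [dist_eq_norm] using hy)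
    have h2 : x 2 / (n + 2) < x 2 := by
      rw [div_lt_iff₀ (by positivity)]
      nlinarith [Nat.cast_nonneg (α := ℝ) n]
    have h3 := abs_le.mp h1
    change 0 < y 2
    linarith
  refine ⟨fun n => (b n).normed volume, hint, fun n y => (b n).nonneg_normed y, fun n => ?_,
    fun U hU => ?_⟩
  · have h1 := integral_halfVol_of_interior (hint n) (fun _ => (1 : ℝ))
    simp only [smul_eq_mul, mul_one] at h1
    rw [h1, (b n).integral_normed]
  · obtain ⟨ε, hε, hU'⟩ := Metric.mem_nhds_iff.mp hU
    have ht : Tendsto (fun n : ℕ => x 2 / ((n : ℝ) + 2)) atTop (𝓝 0) :=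
      Tendsto.div_atTop tendsto_const_nhds
        (tendsto_atTop_add_const_right _ _ tendsto_natCast_atTop_atTop)
    filter_upwards [ht.eventually_lt_const hε] with n hn y hy
    refine image_eq_zero_of_notMem_tsupport fun h => hy (hU' ?_)
    rw [hts] at h
    exact (Metric.mem_closedBall.mp h).trans_lt hn

theorem tendsto_mollify {F : Type*} [NormedAddCommGroup F] [NormedSpace ℝ F] [CompleteSpace F]
    {x : E3} {ρ : ℕ → E3 → ℝ} (h0 : ∀ n y, 0 ≤ ρ n y) (h1 : ∀ n, ∫ y, ρ n y ∂halfVol = 1)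
    (hU : ∀ U ∈ 𝓝 x, ∀ᶠ n in atTop, ∀ y ∉ U, ρ n y = 0) {g : E3 → F} (hg : ContinuousAt g x)
    (hint : ∀ n, Integrable (fun y => ρ n y • g y) halfVol) :
    Tendsto (fun n => ∫ y, ρ n y • g y ∂halfVol) atTop (𝓝 (g x)) := by
  have hρ : ∀ n, Integrable (ρ n) halfVol := fun n =>
    Integrable.of_integral_ne_zero (by rw [h1]; exact one_ne_zero)
  refine Metric.tendsto_nhds.mpr fun ε hε => ?_
  have hn := Metric.ball_mem_nhds (g x) (half_pos hε)
  filter_upwards [hU _ (hg hn)] with n hn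
  have e1 : (∫ y, ρ n y • g y ∂halfVol) - g x = ∫ y, ρ n y • (g y - g x) ∂halfVol := by
    simp_rw [smul_sub]
    rw [integral_sub (hint n) ((hρ n).smul_const _), integral_smul_const, h1, one_smul]
  rw [dist_eq_norm, e1]
  refine lt_of_le_of_lt (norm_integral_le_of_norm_le ((hρ n).mul_const (ε / 2))
    (ae_of_all _ fun y => ?_)) (?_ : ∫ y, ρ n y * (ε / 2) ∂halfVol < ε)
  · rw [norm_smul, Real.norm_eq_abs, abs_of_nonneg (h0 n y)]
    by_cases hy : y ∈ g ⁻¹' Metric.ball (g x) (ε / 2)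
    · refine mul_le_mul_of_nonneg_left ?_ (h0 n y)
      have : dist (g y) (g x) < ε / 2 := hy
      rw [dist_eq_norm] at this
      exact this.le
    · rw [hn y hy]
      simp
  · rw [integral_mul_const, h1, one_mul]
    exact half_lt_self hε

theorem tendsto_norm_Lp_of_dominated {α ι : Type*} [MeasurableSpace α] {m : Measure α}
    {l : Filter ι} [l.IsCountablyGenerated] {G : ι → Lp ℂ 2 m} {F : ι → α → ℂ} {g : α → ℝ}
    (hGF : ∀ i, G i =ᵐ[m] F i) (hg : Integrable (fun k => g k ^ 2) m)
    (hb : ∀ i k, ‖F i k‖ ≤ g k)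
    (ht : ∀ k, Tendsto (fun i => F i k) l (𝓝 0)) : Tendsto (fun i => ‖G i‖) l (𝓝 0) := by
  have h1 : Tendsto (fun i => ∫ k, ‖G i k‖ ^ 2 ∂m) l (𝓝 (∫ _, (0 : ℝ) ∂m)) := by
    have e : ∀ i, ∫ k, ‖G i k‖ ^ 2 ∂m = ∫ k, ‖F i k‖ ^ 2 ∂m := fun i =>
      integral_congr_ae (by filter_upwards [hGF i] with k hk; rw [hk])
    simp_rw [e]
    refine tendsto_integral_filter_of_dominated_convergence (fun k => g k ^ 2) ?_ ?_ hg ?_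
    · refine Eventually.of_forall fun i => ?_
      exact (((Lp.aestronglyMeasurable (G i)).congr (hGF i)).norm).pow 2
    · refine Eventually.of_forall fun i => ae_of_all _ fun k => ?_
      rw [norm_pow, norm_norm]
      exact pow_le_pow_left₀ (norm_nonneg _) (hb i k) 2
    · refine ae_of_all _ fun k => ?_
      simpa using ((ht k).norm).pow 2
  simp_rw [← norm_sq_Lp] at h1
  simpa using h1.sqrt

/-! ### Decay of the symbol -/

/-- The symbol `λ^{-17/12}`. -/
def wt (L : ℝ) (k : E3) : ℝ := lam L k ^ (-(17 / 12) : ℝ)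

theorem wt_pos (L : ℝ) (k : E3) : 0 < wt L k := Real.rpow_pos_of_pos (lam_pos L k) _

theorem continuous_wt (L : ℝ) : Continuous (wt L) :=
  (continuous_lam L).rpow_const fun k => Or.inl (lam_pos L k).ne'

theorem wt_refl (L : ℝ) (k : E3) : wt L (refl k) = wt L k := by rw [wt, lam_refl, wt]

theorem wt_neg (L : ℝ) (k : E3) : wt L (-k) = wt L k := by rw [wt, lam_neg, wt]

theorem wt_sq (L : ℝ) (k : E3) : wt L k ^ 2 = lam L k ^ (-(17 / 6) : ℝ) := by
  rw [wt, ← Real.rpow_natCast, ← Real.rpow_mul (lam_pos L k).le]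
  norm_num

/-- Here the exponent 17/12 matters: λ^{-17/6}(1 + |k|²) is of order |k|^{-11/3}, and 11/3 > 3. This
one bound gives both the continuity and the differentiability of the Green functions in L². -/
theorem integrable_wt_sq_mul {L : ℝ} (hL : 0 < L) :
    Integrable (fun k : E3 => wt L k ^ 2 * (1 + ‖k‖ ^ 2)) := by
  have h1 : Integrable (fun k : E3 => (1 + ‖k‖ ^ 2) ^ (-(11 / 3 : ℝ) / 2)) :=
    integrable_rpow_neg_one_add_norm_sq (by simp; norm_num)
  obtain ⟨c, hc, hc'⟩ : ∃ c : ℝ, 0 < c ∧ ∀ k, c * (1 + ‖k‖ ^ 2) ≤ lam L k := by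
    refine ⟨min 1 ((2 * Real.pi * L) ^ 2), by positivity, fun k => ?_⟩
    rw [mul_add, mul_one, lam]
    gcongr
    · exact min_le_left _ _
    · exact min_le_right _ _
  refine Integrable.mono' (h1.const_mul (c ^ (-(17 / 6) : ℝ)))
    ((((continuous_wt L).pow 2).mul (by fun_prop)).aestronglyMeasurable) (ae_of_all _ fun k => ?_)
  have hk : (0 : ℝ) < 1 + ‖k‖ ^ 2 := by positivity
  have h2 : wt L k ^ 2 ≤ c ^ (-(17 / 6) : ℝ) * (1 + ‖k‖ ^ 2) ^ (-(17 / 6) : ℝ) := by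
    rw [wt_sq, ← Real.mul_rpow hc.le hk.le]
    exact Real.rpow_le_rpow_of_nonpos (by positivity) (hc' k) (by norm_num)
  have h3 : (1 + ‖k‖ ^ 2) ^ (-(17 / 6) : ℝ) * (1 + ‖k‖ ^ 2) = (1 + ‖k‖ ^ 2) ^ (-(11 / 3 : ℝ) / 2) := by
    nth_rewrite 2 [← Real.rpow_one (1 + ‖k‖ ^ 2)]
    rw [← Real.rpow_add hk]
    norm_num
  rw [Real.norm_eq_abs, abs_of_nonneg (by positivity), ← h3, ← mul_assoc]
  gcongr

theorem integrable_wt_mul_norm_sq {L : ℝ} (hL : 0 < L) (C : ℝ) :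
    Integrable (fun k : E3 => (C * (wt L k * ‖k‖)) ^ 2) := by
  have hc := continuous_wt L
  refine Integrable.mono' ((integrable_wt_sq_mul hL).const_mul (C ^ 2))
    (by fun_prop : Continuous fun k : E3 => (C * (wt L k * ‖k‖)) ^ 2).aestronglyMeasurable
    (ae_of_all _ fun k => ?_)
  rw [Real.norm_eq_abs, abs_of_nonneg (by positivity), mul_pow, mul_pow]
  gcongr
  linarith

theorem integrable_wt_sq {L : ℝ} (hL : 0 < L) (C : ℝ) :
    Integrable (fun k : E3 => (C * wt L k) ^ 2) := by
  have hc := continuous_wt L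
  refine Integrable.mono' ((integrable_wt_sq_mul hL).const_mul (C ^ 2))
    (by fun_prop : Continuous fun k : E3 => (C * wt L k) ^ 2).aestronglyMeasurable
    (ae_of_all _ fun k => ?_)
  rw [Real.norm_eq_abs, abs_of_nonneg (by positivity), mul_pow]
  gcongr
  exact le_mul_of_one_le_right (by positivity) (by nlinarith [sq_nonneg ‖k‖])

theorem memLp_of_sq_le {F : E3 → ℂ} (hF : AEStronglyMeasurable F volume) {g : E3 → ℝ}
    (hg : Integrable (fun k => g k ^ 2)) (h : ∀ k, ‖F k‖ ≤ g k) : MemLp F 2 volume := by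
  rw [memLp_two_iff_integrable_sq_norm hF]
  refine hg.mono' (hF.norm.pow 2) (ae_of_all _ fun k => ?_)
  rw [Real.norm_eq_abs, abs_of_nonneg (by positivity)]
  exact pow_le_pow_left₀ (norm_nonneg _) (h k) 2

/-! ### The Green functions -/

theorem memLp_wave {L : ℝ} (hL : 0 < L) (y : E3) :
    MemLp (fun k => (wt L k : ℂ) * wave y k) 2 volume := by
  have h1 := continuous_wt L
  have h2 := continuous_wave_right y
  refine memLp_of_sq_le (by fun_prop : Continuous fun k => (wt L k : ℂ) * wave y k).aestronglyMeasurable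
    (integrable_wt_sq hL 1) fun k => ?_
  rw [norm_mul, norm_wave, Complex.norm_real, Real.norm_eq_abs, abs_of_pos (wt_pos L k)]
  simp

theorem memLp_dwave {L : ℝ} (hL : 0 < L) (i : Fin 3) (y : E3) :
    MemLp (fun k => (wt L k : ℂ) * (-symb i k) * wave y k) 2 volume := by
  have h1 := continuous_wt L
  have h2 := continuous_wave_right y
  have h3 := continuous_symb i
  refine memLp_of_sq_le
    (by fun_prop : Continuous fun k => (wt L k : ℂ) * (-symb i k) * wave y k).aestronglyMeasurable
    (integrable_wt_mul_norm_sq hL (2 * Real.pi)) fun k => ?_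
  rw [norm_mul, norm_mul, norm_wave, Complex.norm_real, Real.norm_eq_abs, abs_of_pos (wt_pos L k),
    norm_neg]
  nlinarith [norm_symb_le i k, wt_pos L k]

/-- The Fourier transform of `(1 - L²Δ)^{-17/12} δ_y` on the whole space. -/
def waveLp {L : ℝ} (hL : 0 < L) (y : E3) : Lp ℂ 2 (volume : Measure E3) := (memLp_wave hL y).toLp

/-- The partial derivatives of `waveLp` in `y`. -/
def dwaveLp {L : ℝ} (hL : 0 < L) (i : Fin 3) (y : E3) : Lp ℂ 2 (volume : Measure E3) :=
  (memLp_dwave hL i y).toLp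

/-- The derivative of `waveLp` in `y`. -/
def dwaveCLM {L : ℝ} (hL : 0 < L) (y : E3) : E3 →L[ℝ] Lp ℂ 2 (volume : Measure E3) :=
  ∑ i, (EuclideanSpace.proj (𝕜 := ℝ) i : E3 →L[ℝ] ℝ).smulRight (dwaveLp hL i y)

theorem dwaveCLM_apply {L : ℝ} (hL : 0 < L) (y v : E3) :
    dwaveCLM hL y v = v 0 • dwaveLp hL 0 y + v 1 • dwaveLp hL 1 y + v 2 • dwaveLp hL 2 y := by
  simp [dwaveCLM, Fin.sum_univ_three]

theorem dwaveCLM_unitVec {L : ℝ} (hL : 0 < L) (y : E3) (i : Fin 3) :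
    dwaveCLM hL y (unitVec i) = dwaveLp hL i y := by
  rw [dwaveCLM_apply]
  fin_cases i <;> simp [unitVec]

/-- The derivative of `wave` in `y`. -/
def dwave (y k : E3) : E3 →L[ℝ] ℂ :=
  wave y k • ((((-2 * Real.pi) • innerSL ℝ k : E3 →L[ℝ] ℝ)).smulRight Complex.I)

theorem hasFDerivAt_wave (y k : E3) : HasFDerivAt (fun y => wave y k) (dwave y k) y := by
  have h := ((((-2 * Real.pi) • innerSL ℝ k : E3 →L[ℝ] ℝ)).smulRight Complex.I).hasFDerivAt
    (x := y) |>.cexp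
  have e : ∀ z, (((-2 * Real.pi) • innerSL ℝ k : E3 →L[ℝ] ℝ)).smulRight Complex.I z
      = ((-2 * Real.pi * inner ℝ z k : ℝ) : ℂ) * Complex.I := fun z => by
    simp [innerSL_apply_apply, real_inner_comm]
  simp only [e] at h
  exact h

theorem dwave_apply (y k v : E3) :
    dwave y k v = (v 0 * (-symb 0 k) + v 1 * (-symb 1 k) + v 2 * (-symb 2 k)) * wave y k := by
  have : inner ℝ k v = k 0 * v 0 + k 1 * v 1 + k 2 * v 2 := by
    simp [PiLp.inner_apply, Fin.sum_univ_three, mul_comm]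
  simp only [dwave, smul_apply, ContinuousLinearMap.smulRight_apply, innerSL_apply_apply, this,
    symb, smul_eq_mul, Complex.real_smul]
  push_cast
  ring

theorem norm_dwave_apply_le (y k v : E3) : ‖dwave y k v‖ ≤ 2 * Real.pi * ‖k‖ * ‖v‖ := by
  have h : ‖dwave y k v‖ = 2 * Real.pi * |inner ℝ k v| := by
    simp [dwave, norm_wave, abs_of_pos Real.pi_pos]
  calc ‖dwave y k v‖ = 2 * Real.pi * |inner ℝ k v| := h
    _ ≤ 2 * Real.pi * (‖k‖ * ‖v‖) :=
      mul_le_mul_of_nonneg_left (abs_real_inner_le_norm k v) (by positivity)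
    _ = _ := by ring

theorem norm_wave_sub_le (y z k : E3) : ‖wave y k - wave z k‖ ≤ 2 * Real.pi * ‖k‖ * ‖y - z‖ := by
  have e : wave y k - wave z k = wave z k *
      (Complex.exp (Complex.I * ((-2 * Real.pi * inner ℝ (y - z) k : ℝ) : ℂ)) - 1) := by
    rw [mul_sub, mul_one, wave, wave, ← Complex.exp_add, inner_sub_left]
    congr 2
    push_cast
    ring
  rw [e, norm_mul, norm_wave, one_mul]
  refine (Real.norm_exp_I_mul_ofReal_sub_one_le).trans ?_
  rw [Real.norm_eq_abs, abs_mul, abs_mul, abs_neg, abs_two, abs_of_pos Real.pi_pos]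
  calc 2 * Real.pi * |inner ℝ (y - z) k| ≤ 2 * Real.pi * (‖y - z‖ * ‖k‖) :=
      mul_le_mul_of_nonneg_left (abs_real_inner_le_norm _ _) (by positivity)
    _ = _ := by ring

/-- Dominated convergence for the difference quotients. The remainder of the wave is at most 4π|k|
per unit step, 2π|k| from the Lipschitz bound and 2π|k| from the derivative, and λ^{-17/12}|k| is in
L². -/
theorem hasFDerivAt_waveLp {L : ℝ} (hL : 0 < L) (y : E3) :
    HasFDerivAt (waveLp hL) (dwaveCLM hL y) y := by
  rw [hasFDerivAt_iff_tendsto]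
  have h := tendsto_norm_Lp_of_dominated (l := 𝓝 y)
    (G := fun z => (‖z - y‖⁻¹ : ℝ) • (waveLp hL z - waveLp hL y - dwaveCLM hL y (z - y)))
    (F := fun z k => (wt L k : ℂ) * ((‖z - y‖⁻¹ : ℝ) • (wave z k - wave y k - dwave y k (z - y))))
    (g := fun k => 4 * Real.pi * (wt L k * ‖k‖)) ?_ (integrable_wt_mul_norm_sq hL _) ?_ ?_
  · refine h.congr fun z => ?_
    rw [norm_smul, Real.norm_eq_abs, abs_of_nonneg (by positivity)]
  · intro z
    rw [dwaveCLM_apply]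
    filter_upwards [Lp.coeFn_smul (‖z - y‖⁻¹ : ℝ) (waveLp hL z - waveLp hL y -
        ((z - y) 0 • dwaveLp hL 0 y + (z - y) 1 • dwaveLp hL 1 y + (z - y) 2 • dwaveLp hL 2 y)),
      Lp.coeFn_sub (waveLp hL z - waveLp hL y) ((z - y) 0 • dwaveLp hL 0 y +
        (z - y) 1 • dwaveLp hL 1 y + (z - y) 2 • dwaveLp hL 2 y),
      Lp.coeFn_sub (waveLp hL z) (waveLp hL y),
      Lp.coeFn_add ((z - y) 0 • dwaveLp hL 0 y + (z - y) 1 • dwaveLp hL 1 y)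
        ((z - y) 2 • dwaveLp hL 2 y),
      Lp.coeFn_add ((z - y) 0 • dwaveLp hL 0 y) ((z - y) 1 • dwaveLp hL 1 y),
      Lp.coeFn_smul ((z - y) 0) (dwaveLp hL 0 y), Lp.coeFn_smul ((z - y) 1) (dwaveLp hL 1 y),
      Lp.coeFn_smul ((z - y) 2) (dwaveLp hL 2 y), (memLp_wave hL z).coeFn_toLp,
      (memLp_wave hL y).coeFn_toLp, (memLp_dwave hL 0 y).coeFn_toLp,
      (memLp_dwave hL 1 y).coeFn_toLp, (memLp_dwave hL 2 y).coeFn_toLp]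
      with k c1 c2 c3 c4 c5 c6 c7 c8 c9 c10 c11 c12 c13
    rw [c1, Pi.smul_apply, c2, Pi.sub_apply, c3, Pi.sub_apply, c4, Pi.add_apply, c5, Pi.add_apply,
      c6, c7, c8, Pi.smul_apply, Pi.smul_apply, Pi.smul_apply, waveLp, waveLp, c9, c10, dwaveLp,
      dwaveLp, dwaveLp, c11, c12, c13, dwave_apply]
    simp only [Complex.real_smul]
    ring
  · intro z k
    have hw := wt_pos L k
    rw [norm_mul, norm_smul, Complex.norm_real, Real.norm_eq_abs, abs_of_pos hw, Real.norm_eq_abs,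
      abs_of_nonneg (by positivity)]
    have h1 : ‖wave z k - wave y k - dwave y k (z - y)‖ ≤ 4 * Real.pi * ‖k‖ * ‖z - y‖ := by
      refine (norm_sub_le _ _).trans ?_
      linarith [norm_wave_sub_le z y k, norm_dwave_apply_le y k (z - y)]
    have h2 : ‖z - y‖⁻¹ * ‖wave z k - wave y k - dwave y k (z - y)‖ ≤ 4 * Real.pi * ‖k‖ := by
      rcases (norm_nonneg (z - y)).eq_or_lt with h0 | h0
      · rw [← h0]; simp; positivity
      · rw [inv_mul_le_iff₀ h0]
        linarith
    calc wt L k * (‖z - y‖⁻¹ * ‖wave z k - wave y k - dwave y k (z - y)‖)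
        ≤ wt L k * (4 * Real.pi * ‖k‖) := by gcongr
      _ = _ := by ring
  · intro k
    have h1 := hasFDerivAt_iff_tendsto.mp (hasFDerivAt_wave y k)
    have h2 : Tendsto (fun z => (‖z - y‖⁻¹ : ℝ) • (wave z k - wave y k - dwave y k (z - y))) (𝓝 y)
        (𝓝 0) := by
      rw [tendsto_zero_iff_norm_tendsto_zero]
      refine h1.congr fun z => ?_
      rw [norm_smul, Real.norm_eq_abs, abs_of_nonneg (by positivity)]
    simpa using h2.const_mul (wt L k : ℂ)

/-- The Fourier transform of `A^{-17/12} δ_y`, extended with parity `σ`. -/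
def greenLp {L : ℝ} (hL : 0 < L) (σ : ℝ) (y : E3) : Lp ℂ 2 (volume : Measure E3) :=
  waveLp hL y + σ • waveLp hL (refl y)

/-- The partial derivatives of `greenLp` in `y`. -/
def dgreenLp {L : ℝ} (hL : 0 < L) (σ : ℝ) (i : Fin 3) (y : E3) : Lp ℂ 2 (volume : Measure E3) :=
  dwaveLp hL i y + flipParity σ i • dwaveLp hL i (refl y)

theorem hasFDerivAt_greenLp {L : ℝ} (hL : 0 < L) (σ : ℝ) (y : E3) :
    HasFDerivAt (greenLp hL σ) (dwaveCLM hL y +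
      σ • (dwaveCLM hL (refl y)).comp refl.toContinuousLinearEquiv.toContinuousLinearMap) y := by
  have h1 := hasFDerivAt_waveLp hL y
  have h2 : HasFDerivAt (fun z => waveLp hL (refl z)) _ y :=
    (hasFDerivAt_waveLp hL (refl y)).comp y (refl.toContinuousLinearEquiv.hasFDerivAt (x := y))
  exact h1.add (h2.const_smul σ)

theorem greenLp_ae {L : ℝ} (hL : 0 < L) (σ : ℝ) (y : E3) :
    greenLp hL σ y =ᵐ[volume] fun k => (wt L k : ℂ) * symWave σ y k := by
  filter_upwards [Lp.coeFn_add (waveLp hL y) (σ • waveLp hL (refl y)),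
    Lp.coeFn_smul σ (waveLp hL (refl y)), (memLp_wave hL y).coeFn_toLp,
    (memLp_wave hL (refl y)).coeFn_toLp] with k a b c d
  rw [greenLp, a, Pi.add_apply, b, Pi.smul_apply, waveLp, waveLp, c, d, symWave, Complex.real_smul]
  ring

theorem dgreenLp_ae {L : ℝ} (hL : 0 < L) (σ : ℝ) (i : Fin 3) (y : E3) :
    dgreenLp hL σ i y =ᵐ[volume]
      fun k => (wt L k : ℂ) * (-symb i k) * symWave (flipParity σ i) y k := by
  filter_upwards [Lp.coeFn_add (dwaveLp hL i y) (flipParity σ i • dwaveLp hL i (refl y)),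
    Lp.coeFn_smul (flipParity σ i) (dwaveLp hL i (refl y)), (memLp_dwave hL i y).coeFn_toLp,
    (memLp_dwave hL i (refl y)).coeFn_toLp] with k a b c d
  rw [dgreenLp, a, Pi.add_apply, b, Pi.smul_apply, dwaveLp, dwaveLp, c, d, symWave,
    Complex.real_smul]
  ring

theorem hasParity_dgreenLp {L σ : ℝ} (hL : 0 < L) (hσ : σ * σ = 1) (i : Fin 3) (y : E3) :
    HasParity σ (dgreenLp hL σ i y) := by
  refine hasParity_iff.mpr ?_
  have h := dgreenLp_ae hL σ i y
  filter_upwards [h, measurePreserving_refl.quasiMeasurePreserving.ae h] with k a b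
  rw [b, a, wt_refl, symb_refl, symWave, symWave, wave_refl, wave_refl, refl_refl]
  have hσ' : (σ : ℂ) * σ = 1 := by exact_mod_cast hσ
  unfold flipParity
  split_ifs
  · push_cast
    linear_combination (-(wt L k * symb i k * wave (refl y) k)) * hσ'
  · push_cast
    linear_combination (-wt L k * symb i k * wave (refl y) k) * -hσ'

theorem conj_dgreenLp {L : ℝ} (hL : 0 < L) (σ : ℝ) (i : Fin 3) (y : E3) :
    ∀ᵐ k, conj (dgreenLp hL σ i y (-k)) = dgreenLp hL σ i y k := by
  have h := dgreenLp_ae hL σ i y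
  filter_upwards [h, (Measure.measurePreserving_neg volume).quasiMeasurePreserving.ae h] with k a b
  have hs : symb i (-k) = -symb i k := by simp [symb]
  rw [b, a, wt_neg, hs, map_mul, map_mul, Complex.conj_ofReal, neg_neg, conj_symb, symWave, map_add,
    map_mul, Complex.conj_ofReal, conj_wave_neg, conj_wave_neg, symWave]

/-- Interference of the wave with its mirror image: their phases differ by 4π times the product of
the vertical coordinates. -/
theorem norm_symWave_one_sq (y k : E3) :
    ‖symWave 1 y k‖ ^ 2 = 2 + 2 * Real.cos (4 * Real.pi * y 2 * k 2) := by
  have h1 : inner ℝ y k = y 0 * k 0 + y 1 * k 1 + y 2 * k 2 := by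
    simp [PiLp.inner_apply, Fin.sum_univ_three, mul_comm]
  have h2 : inner ℝ (refl y) k = y 0 * k 0 + y 1 * k 1 - y 2 * k 2 := by
    simp [PiLp.inner_apply, Fin.sum_univ_three, mul_comm, refl_apply]
    ring
  rw [symWave, Complex.sq_norm, Complex.normSq_apply]
  simp only [wave, Complex.ofReal_one, one_mul, Complex.add_re, Complex.add_im,
    Complex.exp_ofReal_mul_I_re, Complex.exp_ofReal_mul_I_im]
  have h3 : 4 * Real.pi * y 2 * k 2 = (-2 * Real.pi * inner ℝ (refl y) k)
      - (-2 * Real.pi * inner ℝ y k) := by rw [h1, h2]; ring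
  rw [h3, Real.cos_sub]
  linear_combination Real.sin_sq_add_cos_sq (-2 * Real.pi * inner ℝ y k)
    + Real.sin_sq_add_cos_sq (-2 * Real.pi * inner ℝ (refl y) k)

/-- The hypothesis `hi` selects the derivatives in which the mirror wave enters with a plus sign;
all derivatives in the two horizontal velocities are of this kind. -/
theorem norm_sq_dgreenLp {L σ : ℝ} (hL : 0 < L) {i : Fin 3} (hi : flipParity σ i = 1) (y : E3) :
    ‖dgreenLp hL σ i y‖ ^ 2 = 8 * Real.pi ^ 2 *
      ∫ k : E3, lam L k ^ (-(17 / 6) : ℝ) * k i ^ 2 * (1 + Real.cos (4 * Real.pi * y 2 * k 2)) := by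
  rw [norm_sq_Lp, ← integral_const_mul]
  refine integral_congr_ae ?_
  filter_upwards [dgreenLp_ae hL σ i y] with k hk
  have hs : ‖symb i k‖ ^ 2 = (2 * Real.pi) ^ 2 * k i ^ 2 := by
    simp [symb, mul_pow]
  rw [hk, hi, norm_mul, norm_mul, mul_pow, mul_pow, norm_neg, hs, norm_symWave_one_sq,
    Complex.norm_real, Real.norm_eq_abs, sq_abs, wt_sq]
  ring

theorem continuous_symWave_left (σ : ℝ) (k : E3) : Continuous fun y => symWave σ y k := by
  have h1 := continuous_wave_left k
  have h2 : Continuous fun y => wave (refl y) k := h1.comp refl.continuous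
  unfold symWave
  fun_prop

theorem norm_symWave_le {σ : ℝ} (hσ : |σ| ≤ 1) (y k : E3) : ‖symWave σ y k‖ ≤ 2 := by
  refine (norm_add_le _ _).trans ?_
  rw [norm_mul, norm_wave, norm_wave, Complex.norm_real, Real.norm_eq_abs]
  linarith

theorem aestronglyMeasurable_integral_smul_symWave {φ : E3 → ℝ} (hφ : Continuous φ) (σ : ℝ) :
    AEStronglyMeasurable (fun k => ∫ y, φ y • symWave σ y k) volume := by
  have hr : Continuous fun p : E3 × E3 => refl p.2 := refl.continuous.comp continuous_snd
  have hφ' : Continuous fun p : E3 × E3 => φ p.2 := hφ.comp continuous_snd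
  have hm : Continuous fun p : E3 × E3 => φ p.2 • symWave σ p.2 p.1 := by
    unfold symWave wave
    fun_prop
  exact (hm.stronglyMeasurable.integral_prod_right').aestronglyMeasurable

section Field

variable {Ω : Type*} [MeasurableSpace Ω] {P : Measure Ω}

/-- The equation is known only in integrated form, so both sides are mollified at x. The left side
converges by mean-square continuity. On the right the averaged waves are bounded by 2 and converge
pointwise, so λ^{-17/12} ∈ L² gives convergence in L². -/
theorem IsSolution.eq_green {ξ : L2Vec ℝ →ₗ[ℝ] Lp ℝ 2 P} (hξ : IsWhiteNoise P ξ) {μ L : ℝ}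
    (hL : 0 < L) {ψ : RandomField P} (hψ : IsSolution P ξ μ L 0 ψ) (i : Fin 3) {x : E3}
    (hx : x ∈ halfSpace) :
    ψ i x = (μ * L ^ (17 / 6 : ℝ)) • hξ.isometry (singleL i (synth (greenLp hL (par i) x))) := by
  obtain ⟨ρ, hρ, h0, h1, hU⟩ := exists_mollifier hx
  have hsw := continuous_symWave_left (par i)
  have hbound : ∀ y k, ‖symWave (par i) y k‖ ≤ 2 := norm_symWave_le (by
    rcases par_cases i with h | h <;> simp [h])
  have hS : ∀ n k, ‖∫ y, ρ n y • symWave (par i) y k‖ ≤ 2 := fun n k => by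
    rw [← integral_halfVol_of_interior (hρ n)]
    have hρi : Integrable (ρ n) halfVol :=
      Integrable.of_integral_ne_zero (by rw [h1]; exact one_ne_zero)
    refine (norm_integral_le_of_norm_le (hρi.mul_const 2) (ae_of_all _ fun y => ?_)).trans ?_
    · rw [norm_smul, Real.norm_eq_abs, abs_of_nonneg (h0 n y)]
      exact mul_le_mul_of_nonneg_left (hbound y k) (h0 n y)
    · rw [integral_mul_const, h1, one_mul]
  have hSm := fun n => aestronglyMeasurable_integral_smul_symWave (hρ n).1.1.continuous (par i)
  have hmem : ∀ n, MemLp (fun k => (wt L k : ℂ) * ∫ y, ρ n y • symWave (par i) y k) 2 volume :=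
    fun n => by
      refine memLp_of_sq_le ((Complex.continuous_ofReal.comp (continuous_wt L)).aestronglyMeasurable.mul
        (hSm n)) (integrable_wt_sq hL 2) fun k => ?_
      rw [norm_mul, Complex.norm_real, Real.norm_eq_abs, abs_of_pos (wt_pos L k), mul_comm]
      exact mul_le_mul_of_nonneg_right (hS n k) (wt_pos L k).le
  have hlimΓ : Tendsto (fun n => (hmem n).toLp) atTop (𝓝 (greenLp hL (par i) x)) := by
    rw [tendsto_iff_norm_sub_tendsto_zero]
    refine tendsto_norm_Lp_of_dominated (F := fun n k => (wt L k : ℂ) *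
      ((∫ y, ρ n y • symWave (par i) y k) - symWave (par i) x k)) (g := fun k => 4 * wt L k)
      (fun n => ?_) (integrable_wt_sq hL 4) (fun n k => ?_) (fun k => ?_)
    · filter_upwards [Lp.coeFn_sub (hmem n).toLp (greenLp hL (par i) x), (hmem n).coeFn_toLp,
        greenLp_ae hL (par i) x] with k a b c
      rw [a, Pi.sub_apply, b, c, mul_sub]
    · rw [norm_mul, Complex.norm_real, Real.norm_eq_abs, abs_of_pos (wt_pos L k), mul_comm]
      refine mul_le_mul_of_nonneg_right ((norm_sub_le _ _).trans ?_) (wt_pos L k).le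
      linarith [hS n k, hbound x k]
    · have h := tendsto_mollify h0 h1 hU (hsw k).continuousAt
        (fun n => integrable_test_smul (hρ n).1 (hsw k) halfVol)
      simp_rw [integral_halfVol_of_interior (hρ _)] at h
      simpa using (h.sub_const (symWave (par i) x k)).const_mul (wt L k : ℂ)
  have hint : ∀ n, Integrable (fun y => ρ n y • ψ i y) halfVol := fun n => by
    have hK : IsCompact (tsupport (ρ n)) := (hρ n).1.2
    have h2 : IntegrableOn (fun y => ρ n y • ψ i y) (tsupport (ρ n)) halfVol :=
      ((hρ n).1.1.continuous.continuousOn.smul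
        ((hψ.continuousOn i).mono (hρ n).2)).integrableOn_compact hK
    refine (integrableOn_iff_integrable_of_support_subset fun y hy => ?_).mp h2
    by_contra h
    exact hy (by simp [image_eq_zero_of_notMem_tsupport h])
  have hL1 := tendsto_mollify h0 h1 hU
    ((hψ.continuousOn i).continuousAt (isOpen_halfSpace.mem_nhds hx)) hint
  have hR1 : Tendsto (fun n => (μ * L ^ (17 / 6 : ℝ)) •
      hξ.isometry (singleL i (synth (hmem n).toLp))) atTop
      (𝓝 ((μ * L ^ (17 / 6 : ℝ)) • hξ.isometry (singleL i (synth (greenLp hL (par i) x))))) := by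
    refine Tendsto.const_smul ?_ _
    exact ((hξ.isometry.continuous.comp ((singleL i).continuous.comp synth.continuous)).tendsto
      _).comp hlimΓ
  refine tendsto_nhds_unique hL1 (hR1.congr fun n => ?_)
  exact (hψ.integral_test hL i (hρ n) (hmem n).coeFn_toLp).symm

/-- Near x the field is the image of the Green function under a fixed continuous linear map, so
differentiability and derivative carry over. -/
theorem IsSolution.hasFDerivAt {ξ : L2Vec ℝ →ₗ[ℝ] Lp ℝ 2 P} (hξ : IsWhiteNoise P ξ) {μ L : ℝ}
    (hL : 0 < L) {ψ : RandomField P} (hψ : IsSolution P ξ μ L 0 ψ) (i : Fin 3) {x : E3}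
    (hx : x ∈ halfSpace) :
    ∃ D : E3 →L[ℝ] Lp ℝ 2 P, HasFDerivAt (ψ i) D x ∧ ∀ j, D (unitVec j) =
      (μ * L ^ (17 / 6 : ℝ)) • hξ.isometry (singleL i (synth (dgreenLp hL (par i) j x))) := by
  have h1 := hasFDerivAt_greenLp hL (par i) x
  have h2 := (((hξ.isometry.toContinuousLinearMap ∘L singleL i ∘L synth).hasFDerivAt).comp x
    h1).const_smul (μ * L ^ (17 / 6 : ℝ))
  refine ⟨_, h2.congr_of_eventuallyEq ?_, fun j => ?_⟩
  · filter_upwards [isOpen_halfSpace.mem_nhds hx] with y hy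
    exact hψ.eq_green hξ hL i hy
  · have e : (dwaveCLM hL x + par i • (dwaveCLM hL (refl x)).comp
        refl.toContinuousLinearEquiv.toContinuousLinearMap) (unitVec j) = dgreenLp hL (par i) j x := by
      have e1 : refl.toContinuousLinearEquiv.toContinuousLinearMap (unitVec j)
        = refl (unitVec j) := rfl
      rw [add_apply, smul_apply, ContinuousLinearMap.comp_apply, e1, refl_unitVec, map_smul,
        dwaveCLM_unitVec, dwaveCLM_unitVec, dgreenLp, flipParity, smul_smul]
      split_ifs <;> simp
    rw [smul_apply, ContinuousLinearMap.comp_apply, e]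
    rfl

/-- The energy integral `∫ λ^{-17/6} k_j² (1 + cos (4π z k_z)) dk`. -/
def energy (L : ℝ) (j : Fin 3) (z : ℝ) : ℝ :=
  ∫ k : E3, lam L k ^ (-(17 / 6) : ℝ) * k j ^ 2 * (1 + Real.cos (4 * Real.pi * z * k 2))

/-- A horizontal derivative preserves the even parity of ψ₃, and a vertical one makes the odd
tangential component even, so both terms contain 1 + cos. The constant 4π² is half of the 8π² in
`norm_sq_dgreenLp`, since the noise lives on the half-space only. -/
theorem reynoldsStress_eq {ξ : L2Vec ℝ →ₗ[ℝ] Lp ℝ 2 P} (hξ : IsWhiteNoise P ξ) {μ L : ℝ}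
    (hL : 0 < L) {ψ : RandomField P} (hψ : IsSolution P ξ μ L 0 ψ) {i j : Fin 3}
    (hij : i = 0 ∧ j = 1 ∨ i = 1 ∧ j = 0) {x : E3} (hx : x ∈ halfSpace) :
    reynoldsStress P (curl ψ) i x = (μ * L ^ (17 / 6 : ℝ)) ^ 2 * (4 * Real.pi ^ 2) *
      (energy L j (x 2) + energy L 2 (x 2)) := by
  have hd : ∀ c l, partialDeriv ψ l c x =
      (μ * L ^ (17 / 6 : ℝ)) • hξ.isometry (singleL c (synth (dgreenLp hL (par c) l x))) := fun c l => by
    obtain ⟨D, hD, hD'⟩ := hψ.hasFDerivAt hξ hL c hx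
    rw [partialDeriv, hD.fderiv, hD']
  have hn : ∀ c l, 2 * ‖synth (dgreenLp hL (par c) l x)‖ ^ 2 = ‖dgreenLp hL (par c) l x‖ ^ 2 :=
    fun c l => norm_sq_synth (par_sq c) (hasParity_dgreenLp hL (par_sq c) l x)
      (conj_dgreenLp hL (par c) l x)
  have hmain : ∀ c d l m, c ≠ d → flipParity (par c) l = 1 → flipParity (par d) m = 1 →
      ‖partialDeriv ψ l c x - partialDeriv ψ m d x‖ ^ 2 =
        (μ * L ^ (17 / 6 : ℝ)) ^ 2 * (4 * Real.pi ^ 2) * (energy L l (x 2) + energy L m (x 2)) := by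
    intro c d l m hcd hl hm
    have h1 := hn c l
    have h2 := hn d m
    rw [norm_sq_dgreenLp hL hl] at h1
    rw [norm_sq_dgreenLp hL hm] at h2
    rw [hd, hd, ← smul_sub, ← map_sub, norm_smul, mul_pow, LinearIsometry.norm_map,
      norm_sq_singleL_sub hcd, Real.norm_eq_abs, sq_abs, energy, energy]
    linear_combination (μ * L ^ (17 / 6 : ℝ)) ^ 2 / 2 * (h1 + h2)
  rw [reynoldsStress, integral_sq_Lp]
  rcases hij with ⟨rfl, rfl⟩ | ⟨rfl, rfl⟩
  · exact hmain 2 1 1 2 (by decide) (by simp [flipParity, par]) (by simp [flipParity, par])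
  · rw [add_comm]
    exact hmain 0 2 2 0 (by decide) (by simp [flipParity, par]) (by simp [flipParity, par])

end Field

/-! ### Gaussian integrals -/

theorem integrable_gaussian_cos {b : ℝ} (hb : 0 < b) (c : ℝ) :
    Integrable fun x : ℝ => Real.exp (-b * x ^ 2) * Real.cos (c * x) := by
  refine (integrable_exp_neg_mul_sq hb).mono'
    (by fun_prop : Continuous fun x : ℝ => Real.exp (-b * x ^ 2) * Real.cos (c * x)).aestronglyMeasurable
    (ae_of_all _ fun x => ?_)
  rw [Real.norm_eq_abs, abs_mul, Real.abs_exp]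
  exact mul_le_of_le_one_right (Real.exp_pos _).le (Real.abs_cos_le_one _)

theorem integrable_sq_gaussian {b : ℝ} (hb : 0 < b) :
    Integrable fun x : ℝ => x ^ 2 * Real.exp (-b * x ^ 2) := by
  have h := integrable_rpow_mul_exp_neg_mul_sq hb (s := 2) (by norm_num)
  simpa using h

theorem integrable_sq_gaussian_cos {b : ℝ} (hb : 0 < b) (c : ℝ) :
    Integrable fun x : ℝ => x ^ 2 * (Real.exp (-b * x ^ 2) * Real.cos (c * x)) := by
  refine (integrable_sq_gaussian hb).mono' (by fun_prop : Continuous fun x : ℝ =>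
    x ^ 2 * (Real.exp (-b * x ^ 2) * Real.cos (c * x))).aestronglyMeasurable
    (ae_of_all _ fun x => ?_)
  rw [Real.norm_eq_abs, abs_mul, abs_mul, Real.abs_exp, abs_of_nonneg (sq_nonneg x), ← mul_assoc]
  exact mul_le_of_le_one_right (by positivity) (Real.abs_cos_le_one _)

theorem integrable_mul_gaussian_of_le_one {b : ℝ} (hb : 0 < b) {g : ℝ → ℝ} (hg : Continuous g)
    (hg1 : ∀ x, |g x| ≤ 1) : Integrable fun x : ℝ => x * (Real.exp (-b * x ^ 2) * g x) := by
  refine ((integrable_exp_neg_mul_sq hb).add (integrable_sq_gaussian hb)).mono'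
    (by fun_prop : Continuous fun x : ℝ => x * (Real.exp (-b * x ^ 2) * g x)).aestronglyMeasurable
    (ae_of_all _ fun x => ?_)
  rw [Real.norm_eq_abs, abs_mul, abs_mul, Real.abs_exp, ← mul_assoc]
  calc |x| * Real.exp (-b * x ^ 2) * |g x| ≤ |x| * Real.exp (-b * x ^ 2) :=
        mul_le_of_le_one_right (by positivity) (hg1 x)
    _ ≤ (1 + x ^ 2) * Real.exp (-b * x ^ 2) := by
        gcongr
        rw [← sq_abs x]
        nlinarith [sq_nonneg (|x| - 1), abs_nonneg x]
    _ = _ := by simp only [Pi.add_apply]; ring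

theorem integral_gaussian_cos {b : ℝ} (hb : 0 < b) (c : ℝ) :
    ∫ x : ℝ, Real.exp (-b * x ^ 2) * Real.cos (c * x) =
      √(Real.pi / b) * Real.exp (-(c ^ 2 / (4 * b))) := by
  have h := fourierIntegral_gaussian (b := (b : ℂ)) (by simpa using hb) (c : ℂ)
  have hint : Integrable fun x : ℝ =>
      Complex.exp (Complex.I * c * x) * Complex.exp (-b * x ^ 2) := by
    refine (integrable_exp_neg_mul_sq hb).mono' (by fun_prop : Continuous fun x : ℝ =>
      Complex.exp (Complex.I * c * x) * Complex.exp (-b * x ^ 2)).aestronglyMeasurable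
      (ae_of_all _ fun x => ?_)
    rw [norm_mul, Complex.norm_exp, Complex.norm_exp]
    simp [← Complex.ofReal_pow]
  have h1 := congrArg Complex.re h
  rw [← Complex.reCLM_apply, ← Complex.reCLM.integral_comp_comm hint] at h1
  have e1 : ∀ x : ℝ, Complex.reCLM (Complex.exp (Complex.I * c * x) * Complex.exp (-b * x ^ 2)) =
      Real.exp (-b * x ^ 2) * Real.cos (c * x) := fun x => by
    have a1 : Complex.I * c * x = ((c * x : ℝ) : ℂ) * Complex.I := by push_cast; ring
    have a2 : Complex.exp (-b * x ^ 2) = ((Real.exp (-b * x ^ 2) : ℝ) : ℂ) := by push_cast; rfl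
    rw [a1, a2, Complex.reCLM_apply, Complex.re_mul_ofReal, Complex.exp_ofReal_mul_I_re, mul_comm]
  simp_rw [e1] at h1
  have e2 : (Real.pi / b : ℂ) ^ (1 / 2 : ℂ) * Complex.exp (-(c : ℂ) ^ 2 / (4 * b)) =
      ((√(Real.pi / b) * Real.exp (-(c ^ 2 / (4 * b))) : ℝ) : ℂ) := by
    rw [Real.sqrt_eq_rpow, Complex.ofReal_mul, Complex.ofReal_cpow (by positivity), neg_div]
    push_cast
    rfl
  rw [h1, e2, Complex.ofReal_re]

/-- The derivatives of e^{-bx²} sin(cx) and x e^{-bx²} cos(cx) have integral zero. These two linear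
relations eliminate the mixed integral of x e^{-bx²} sin(cx). -/
theorem integral_sq_gaussian_cos {b : ℝ} (hb : 0 < b) (c : ℝ) :
    ∫ x : ℝ, x ^ 2 * (Real.exp (-b * x ^ 2) * Real.cos (c * x)) =
      √(Real.pi / b) * Real.exp (-(c ^ 2 / (4 * b))) * (1 / (2 * b) - c ^ 2 / (4 * b ^ 2)) := by
  have hE : ∀ x : ℝ, HasDerivAt (fun x : ℝ => Real.exp (-b * x ^ 2))
      (Real.exp (-b * x ^ 2) * (-b * (2 * x))) x := fun x => by
    have := (((hasDerivAt_pow 2 x).const_mul (-b))).exp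
    simpa using this
  have hC : ∀ x : ℝ, HasDerivAt (fun x : ℝ => Real.cos (c * x)) (-Real.sin (c * x) * c) x := fun x => by
    have := ((hasDerivAt_id x).const_mul c).cos
    simpa using this
  have hS : ∀ x : ℝ, HasDerivAt (fun x : ℝ => Real.sin (c * x)) (Real.cos (c * x) * c) x := fun x => by
    have := ((hasDerivAt_id x).const_mul c).sin
    simpa using this
  have i0 := integrable_gaussian_cos hb c
  have i2 := integrable_sq_gaussian_cos hb c
  have i1 := integrable_mul_gaussian_of_le_one hb (g := fun x => Real.sin (c * x)) (by fun_prop)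
    fun x => Real.abs_sin_le_one _
  have i1' := integrable_mul_gaussian_of_le_one hb (g := fun x => Real.cos (c * x)) (by fun_prop)
    fun x => Real.abs_cos_le_one _
  have iS : Integrable fun x : ℝ => Real.exp (-b * x ^ 2) * Real.sin (c * x) := by
    refine (integrable_exp_neg_mul_sq hb).mono' (by fun_prop : Continuous fun x : ℝ =>
      Real.exp (-b * x ^ 2) * Real.sin (c * x)).aestronglyMeasurable (ae_of_all _ fun x => ?_)
    rw [Real.norm_eq_abs, abs_mul, Real.abs_exp]
    exact mul_le_of_le_one_right (Real.exp_pos _).le (Real.abs_sin_le_one _)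
  have j1 := integral_eq_zero_of_hasDerivAt_of_integrable
    (f := fun x : ℝ => Real.exp (-b * x ^ 2) * Real.sin (c * x))
    (f' := fun x => c * (Real.exp (-b * x ^ 2) * Real.cos (c * x))
      - 2 * b * (x * (Real.exp (-b * x ^ 2) * Real.sin (c * x))))
    (fun x => ((hE x).mul (hS x)).congr_deriv (by ring))
    ((i0.const_mul c).sub (i1.const_mul (2 * b))) iS
  have j2 := integral_eq_zero_of_hasDerivAt_of_integrable
    (f := fun x : ℝ => x * (Real.exp (-b * x ^ 2) * Real.cos (c * x)))
    (f' := fun x => Real.exp (-b * x ^ 2) * Real.cos (c * x)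
      - (2 * b * (x ^ 2 * (Real.exp (-b * x ^ 2) * Real.cos (c * x)))
        + c * (x * (Real.exp (-b * x ^ 2) * Real.sin (c * x)))))
    (fun x => ((hasDerivAt_id x).mul ((hE x).mul (hC x))).congr_deriv (by simp only [id, Pi.mul_apply]; ring))
    (i0.sub ((i2.const_mul (2 * b)).add (i1.const_mul c))) i1'
  rw [integral_sub (i0.const_mul c) (i1.const_mul (2 * b)), integral_const_mul,
    integral_const_mul] at j1
  have i21 : Integrable fun x : ℝ => 2 * b * (x ^ 2 * (Real.exp (-b * x ^ 2) * Real.cos (c * x)))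
        + c * (x * (Real.exp (-b * x ^ 2) * Real.sin (c * x))) :=
    (i2.const_mul (2 * b)).add (i1.const_mul c)
  rw [integral_sub i0 i21, integral_add (i2.const_mul (2 * b)) (i1.const_mul c), integral_const_mul,
    integral_const_mul] at j2
  rw [integral_gaussian_cos hb c] at j1 j2
  generalize ∫ x : ℝ, x ^ 2 * (Real.exp (-b * x ^ 2) * Real.cos (c * x)) = I2 at j2 ⊢
  generalize ∫ x : ℝ, x * (Real.exp (-b * x ^ 2) * Real.sin (c * x)) = I1 at j1 j2
  generalize √(Real.pi / b) * Real.exp (-(c ^ 2 / (4 * b))) = G at j1 j2 ⊢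
  have hb' := hb.ne'
  field_simp
  linear_combination (-4 * b) * j2 + 2 * c * j1

theorem integral_prod_E3 (f g h : ℝ → ℝ) :
    ∫ k : E3, f (k 0) * g (k 1) * h (k 2) = (∫ x, f x) * (∫ x, g x) * ∫ x, h x := by
  have e := integral_fintype_prod_volume_eq_prod (𝕜 := ℝ) (ι := Fin 3) (E := fun _ => ℝ) ![f, g, h]
  rw [← (PiLp.volume_preserving_toLp (Fin 3)).integral_comp
    (MeasurableEquiv.toLp 2 _).measurableEmbedding]
  simpa [Fin.prod_univ_three] using e

theorem integrable_prod_E3 {f g h : ℝ → ℝ} (hf : Integrable f) (hg : Integrable g)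
    (hh : Integrable h) : Integrable fun k : E3 => f (k 0) * g (k 1) * h (k 2) := by
  have e := Integrable.fintype_prod (𝕜 := ℝ) (ι := Fin 3) (E := ℝ) (f := ![f, g, h])
    (μ := fun _ => volume) (fun i => by fin_cases i <;> assumption)
  rw [← (PiLp.volume_preserving_toLp (Fin 3)).integrable_comp_emb
    (MeasurableEquiv.toLp 2 _).measurableEmbedding]
  simpa [Fin.prod_univ_three, Function.comp_def, volume_pi] using e

theorem exp_neg_mul_norm_sq (b : ℝ) (k : E3) : Real.exp (-b * ‖k‖ ^ 2) =
    Real.exp (-b * k 0 ^ 2) * Real.exp (-b * k 1 ^ 2) * Real.exp (-b * k 2 ^ 2) := by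
  rw [EuclideanSpace.norm_sq_eq, ← Real.exp_add, ← Real.exp_add, Fin.sum_univ_three]
  simp only [Real.norm_eq_abs, sq_abs]
  congr 1
  ring

/-- Relative to the Gaussian with cosine, k_j² contributes 1/(2b) and k_z² contributes 1/(2b) -
c²/(4b²). Their sum is the source of the factor 1 - s²/(4t) in the profile. -/
theorem integral_gaussian_E3 {j : Fin 3} (hj : j = 0 ∨ j = 1) {b : ℝ} (hb : 0 < b) (c : ℝ) :
    ∫ k : E3, Real.exp (-b * ‖k‖ ^ 2) * ((k j ^ 2 + k 2 ^ 2) * Real.cos (c * k 2)) =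
      √(Real.pi / b) ^ 3 / b * (Real.exp (-(c ^ 2 / (4 * b))) * (1 - c ^ 2 / (4 * b))) := by
  have g0 : ∫ x : ℝ, Real.exp (-b * x ^ 2) = √(Real.pi / b) := integral_gaussian b
  have g2 : ∫ x : ℝ, x ^ 2 * Real.exp (-b * x ^ 2) = √(Real.pi / b) * (1 / (2 * b)) := by
    simpa using integral_sq_gaussian_cos hb 0
  have i0 := integrable_exp_neg_mul_sq hb
  have i2 := integrable_sq_gaussian hb
  have ic := integrable_gaussian_cos hb c
  have ic2 := integrable_sq_gaussian_cos hb c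
  have hb' := hb.ne'
  rcases hj with rfl | rfl
  · have e : ∀ k : E3, Real.exp (-b * ‖k‖ ^ 2) * ((k 0 ^ 2 + k 2 ^ 2) * Real.cos (c * k 2)) =
        k 0 ^ 2 * Real.exp (-b * k 0 ^ 2) * Real.exp (-b * k 1 ^ 2)
            * (Real.exp (-b * k 2 ^ 2) * Real.cos (c * k 2))
          + Real.exp (-b * k 0 ^ 2) * Real.exp (-b * k 1 ^ 2)
            * (k 2 ^ 2 * (Real.exp (-b * k 2 ^ 2) * Real.cos (c * k 2))) := fun k => by
      rw [exp_neg_mul_norm_sq]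
      ring
    simp_rw [e]
    rw [integral_add (integrable_prod_E3 i2 i0 ic) (integrable_prod_E3 i0 i0 ic2),
      integral_prod_E3 (fun x => x ^ 2 * Real.exp (-b * x ^ 2)) (fun x => Real.exp (-b * x ^ 2))
        (fun x => Real.exp (-b * x ^ 2) * Real.cos (c * x)),
      integral_prod_E3 (fun x => Real.exp (-b * x ^ 2)) (fun x => Real.exp (-b * x ^ 2))
        (fun x => x ^ 2 * (Real.exp (-b * x ^ 2) * Real.cos (c * x))), g0, g2,
      integral_gaussian_cos hb, integral_sq_gaussian_cos hb]
    field_simp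
    ring
  · have e : ∀ k : E3, Real.exp (-b * ‖k‖ ^ 2) * ((k 1 ^ 2 + k 2 ^ 2) * Real.cos (c * k 2)) =
        Real.exp (-b * k 0 ^ 2) * (k 1 ^ 2 * Real.exp (-b * k 1 ^ 2))
            * (Real.exp (-b * k 2 ^ 2) * Real.cos (c * k 2))
          + Real.exp (-b * k 0 ^ 2) * Real.exp (-b * k 1 ^ 2)
            * (k 2 ^ 2 * (Real.exp (-b * k 2 ^ 2) * Real.cos (c * k 2))) := fun k => by
      rw [exp_neg_mul_norm_sq]
      ring
    simp_rw [e]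
    rw [integral_add (integrable_prod_E3 i0 i2 ic) (integrable_prod_E3 i0 i0 ic2),
      integral_prod_E3 (fun x => Real.exp (-b * x ^ 2)) (fun x => x ^ 2 * Real.exp (-b * x ^ 2))
        (fun x => Real.exp (-b * x ^ 2) * Real.cos (c * x)),
      integral_prod_E3 (fun x => Real.exp (-b * x ^ 2)) (fun x => Real.exp (-b * x ^ 2))
        (fun x => x ^ 2 * (Real.exp (-b * x ^ 2) * Real.cos (c * x))), g0, g2,
      integral_gaussian_cos hb, integral_sq_gaussian_cos hb]
    field_simp
    ring

/-! ### Subordination -/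

/-- The Gamma integral turns powers of the symbol into Gaussians. -/
theorem Gamma_mul_integral_lam_rpow {L β : ℝ} (hβ : 0 < β) {g : E3 → ℝ} (hg : Continuous g)
    (hi : Integrable fun k => lam L k ^ (-β) * g k) :
    Real.Gamma β * ∫ k, lam L k ^ (-β) * g k =
      ∫ t in Set.Ioi (0 : ℝ), t ^ (β - 1) * Real.exp (-t) *
        ∫ k : E3, Real.exp (-((2 * Real.pi * L) ^ 2 * t) * ‖k‖ ^ 2) * g k := by
  have hG : ∀ k, ∫ t in Set.Ioi (0 : ℝ), t ^ (β - 1) * Real.exp (-(lam L k * t)) =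
      lam L k ^ (-β) * Real.Gamma β := fun k => by
    rw [Real.integral_rpow_mul_exp_neg_mul_Ioi hβ (lam_pos L k), one_div,
      Real.inv_rpow (lam_pos L k).le, Real.rpow_neg (lam_pos L k).le]
  have hGi : ∀ k, IntegrableOn (fun t : ℝ => t ^ (β - 1) * Real.exp (-(lam L k * t))) (Set.Ioi 0) :=
    -- A non-integrable function has integral 0 by convention, so the nonzero value of the Gamma
    -- integral proves integrability.
    fun k => Integrable.of_integral_ne_zero (by
      rw [hG]
      exact (mul_pos (Real.rpow_pos_of_pos (lam_pos L k) _) (Real.Gamma_pos_of_pos hβ)).ne')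
  have hm : Measurable fun p : E3 × ℝ => p.2 ^ (β - 1) * Real.exp (-(lam L p.1 * p.2)) * g p.1 := by
    have h1 := (continuous_lam L).measurable
    have h2 := hg.measurable
    fun_prop
  have hint : Integrable (Function.uncurry fun (k : E3) (t : ℝ) =>
      t ^ (β - 1) * Real.exp (-(lam L k * t)) * g k)
      (volume.prod (volume.restrict (Set.Ioi 0))) := by
    refine (integrable_prod_iff hm.aestronglyMeasurable).mpr
      ⟨ae_of_all _ fun k => (hGi k).mul_const (g k), ?_⟩
    -- Integrating the absolute value over t gives back Γ(β) λ^{-β}|g|, so Fubini needs no more than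
    -- `hi`.
    refine (hi.norm.const_mul (Real.Gamma β)).congr (ae_of_all _ fun k => ?_)
    have e : ∫ t in Set.Ioi (0 : ℝ), ‖t ^ (β - 1) * Real.exp (-(lam L k * t)) * g k‖ =
        ∫ t in Set.Ioi (0 : ℝ), t ^ (β - 1) * Real.exp (-(lam L k * t)) * ‖g k‖ :=
      setIntegral_congr_fun measurableSet_Ioi fun t ht => by
        have ht' : (0 : ℝ) < t := ht
        simp only [norm_mul, Real.norm_eq_abs, Real.abs_exp, abs_of_pos (Real.rpow_pos_of_pos ht' _)]
    dsimp only
    rw [e, integral_mul_const, hG, norm_mul, Real.norm_eq_abs,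
      abs_of_pos (Real.rpow_pos_of_pos (lam_pos L k) _)]
    ring
  have h := integral_integral_swap hint
  have e1 : ∀ k, ∫ t in Set.Ioi (0 : ℝ), t ^ (β - 1) * Real.exp (-(lam L k * t)) * g k =
      Real.Gamma β * (lam L k ^ (-β) * g k) := fun k => by
    rw [integral_mul_const, hG]
    ring
  simp_rw [e1] at h
  rw [integral_const_mul] at h
  rw [h]
  congr 1
  ext t
  rw [← integral_const_mul]
  congr 1
  ext k
  have e2 : Real.exp (-(lam L k * t)) =
      Real.exp (-t) * Real.exp (-((2 * Real.pi * L) ^ 2 * t) * ‖k‖ ^ 2) := by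
    rw [← Real.exp_add, lam]
    congr 1
    ring
  rw [e2]
  ring

theorem sq_coord_add_le {j : Fin 3} (hj : j = 0 ∨ j = 1) (k : E3) :
    k j ^ 2 + k 2 ^ 2 ≤ ‖k‖ ^ 2 := by
  rw [EuclideanSpace.norm_sq_eq, Fin.sum_univ_three]
  simp only [Real.norm_eq_abs, sq_abs]
  rcases hj with rfl | rfl <;> nlinarith [sq_nonneg (k 0), sq_nonneg (k 1)]

theorem integrable_lam_rpow_cos {L : ℝ} (hL : 0 < L) {j : Fin 3} (hj : j = 0 ∨ j = 1) (c : ℝ) :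
    Integrable fun k : E3 =>
      lam L k ^ (-(17 / 6) : ℝ) * ((k j ^ 2 + k 2 ^ 2) * Real.cos (c * k 2)) := by
  have hc : Continuous fun k : E3 => lam L k ^ (-(17 / 6) : ℝ) :=
    (continuous_lam L).rpow_const fun k => Or.inl (lam_pos L k).ne'
  refine (integrable_wt_sq_mul hL).mono' (hc.mul (by fun_prop)).aestronglyMeasurable
    (ae_of_all _ fun k => ?_)
  rw [norm_mul, norm_mul, Real.norm_eq_abs, Real.norm_eq_abs, Real.norm_eq_abs, wt_sq,
    abs_of_pos (Real.rpow_pos_of_pos (lam_pos L k) _), abs_of_nonneg (by positivity)]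
  refine mul_le_mul_of_nonneg_left ?_ (Real.rpow_pos_of_pos (lam_pos L k) _).le
  refine (mul_le_of_le_one_right (by positivity) (Real.abs_cos_le_one _)).trans ?_
  linarith [sq_coord_add_le hj k]

/-- With b = (2πL)² t the Gaussian integral contributes t^{-3/2} t^{-1}, so the power of t is 17/6 -
1 - 5/2 = 1/3 - 1. The frequency c = 4πz gives c²/(4b) = (2z/L)²/(4t). -/
theorem Gamma_mul_integral_lam_rpow_cos {L : ℝ} (hL : 0 < L) {j : Fin 3} (hj : j = 0 ∨ j = 1)
    (z : ℝ) :
    Real.Gamma (17 / 6) * ∫ k : E3, lam L k ^ (-(17 / 6) : ℝ) *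
        ((k j ^ 2 + k 2 ^ 2) * Real.cos (4 * Real.pi * z * k 2)) =
      √(Real.pi / (2 * Real.pi * L) ^ 2) ^ 3 / (2 * Real.pi * L) ^ 2 *
        profileInt (1 / 3) (2 * z / L) := by
  have hπ := Real.pi_pos
  rw [Gamma_mul_integral_lam_rpow (by norm_num) (by fun_prop) (integrable_lam_rpow_cos hL hj _),
    profileInt, ← integral_const_mul]
  refine setIntegral_congr_fun measurableSet_Ioi fun t ht => ?_
  have ht' : (0 : ℝ) < t := ht
  have ha : 0 < (2 * Real.pi * L) ^ 2 := by positivity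
  simp only
  rw [integral_gaussian_E3 hj (by positivity), besselWeight_eq]
  have hq : (4 * Real.pi * z) ^ 2 / (4 * ((2 * Real.pi * L) ^ 2 * t)) =
      (2 * z / L) ^ 2 / (4 * t) := by
    field_simp
    ring
  have hs : √(Real.pi / ((2 * Real.pi * L) ^ 2 * t)) =
      √(Real.pi / (2 * Real.pi * L) ^ 2) * t ^ (-(1 / 2) : ℝ) := by
    rw [← div_div, Real.sqrt_div (by positivity), Real.sqrt_eq_rpow t, Real.rpow_neg ht'.le,
      div_eq_mul_inv]
  have hp : t ^ (17 / 6 - 1 : ℝ) * (t ^ (-(1 / 2) : ℝ)) ^ 3 / t = t ^ (1 / 3 - 1 : ℝ) := by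
    rw [← Real.rpow_natCast, ← Real.rpow_mul ht'.le, ← Real.rpow_add ht', ← Real.rpow_sub_one ht'.ne']
    norm_num
  rw [hq, hs, ← hp]
  field_simp

/-- The summand 1 in 1 + cos is the cosine at z = 0, so the previous formula is used twice, once
with profile value Γ(1/3). -/
theorem energy_add_energy {L : ℝ} (hL : 0 < L) {j : Fin 3} (hj : j = 0 ∨ j = 1) (z : ℝ) :
    energy L j z + energy L 2 z =
      √(Real.pi / (2 * Real.pi * L) ^ 2) ^ 3 / (2 * Real.pi * L) ^ 2 / Real.Gamma (17 / 6) *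
        (Real.Gamma (1 / 3) + profileInt (1 / 3) (2 * z / L)) := by
  have hΓ : (0 : ℝ) < Real.Gamma (17 / 6) := Real.Gamma_pos_of_pos (by norm_num)
  have h0 := Gamma_mul_integral_lam_rpow_cos hL hj 0
  have hz := Gamma_mul_integral_lam_rpow_cos hL hj z
  rw [mul_zero, mul_zero, zero_div, profileInt_zero (by norm_num)] at h0
  have hc : Continuous fun k : E3 => lam L k ^ (-(17 / 6) : ℝ) :=
    (continuous_lam L).rpow_const fun k => Or.inl (lam_pos L k).ne'
  have hi : ∀ l : Fin 3, Integrable fun k : E3 => lam L k ^ (-(17 / 6) : ℝ) * k l ^ 2 *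
      (1 + Real.cos (4 * Real.pi * z * k 2)) := fun l => by
    refine ((integrable_wt_sq_mul hL).const_mul 2).mono'
      ((hc.mul (by fun_prop)).mul (by fun_prop)).aestronglyMeasurable (ae_of_all _ fun k => ?_)
    have h1 := Real.neg_one_le_cos (4 * Real.pi * z * k 2)
    have h2 := Real.cos_le_one (4 * Real.pi * z * k 2)
    have h3 := Real.rpow_pos_of_pos (lam_pos L k) (-(17 / 6))
    have h4 : k l ^ 2 ≤ ‖k‖ ^ 2 := by
      rw [← sq_abs (k l)]
      exact pow_le_pow_left₀ (abs_nonneg _) (PiLp.norm_apply_le k l) 2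
    have h5 : 0 ≤ 1 + Real.cos (4 * Real.pi * z * k 2) := by linarith
    rw [Real.norm_eq_abs, abs_of_nonneg (by positivity), wt_sq]
    calc lam L k ^ (-(17 / 6) : ℝ) * k l ^ 2 * (1 + Real.cos (4 * Real.pi * z * k 2))
        ≤ lam L k ^ (-(17 / 6) : ℝ) * (1 + ‖k‖ ^ 2) * 2 := by
          gcongr <;> linarith
      _ = _ := by ring
  have e : energy L j z + energy L 2 z =
      (∫ k : E3, lam L k ^ (-(17 / 6) : ℝ) * ((k j ^ 2 + k 2 ^ 2) * Real.cos (0 * k 2))) +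
      ∫ k : E3, lam L k ^ (-(17 / 6) : ℝ) *
        ((k j ^ 2 + k 2 ^ 2) * Real.cos (4 * Real.pi * z * k 2)) := by
    rw [energy, energy, ← integral_add (hi j) (hi 2),
      ← integral_add (integrable_lam_rpow_cos hL hj _) (integrable_lam_rpow_cos hL hj _)]
    congr 1
    ext k
    rw [zero_mul, Real.cos_zero]
    ring
  rw [e, div_mul_eq_mul_div, eq_div_iff hΓ.ne']
  linear_combination h0 + hz

/-! ### The Reynolds stresses -/

/-- The limit of the horizontal Reynolds stresses at infinity. -/
def stressAtInfinity (μ L : ℝ) : ℝ :=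
  (μ * L ^ (17 / 6 : ℝ)) ^ 2 * (4 * Real.pi ^ 2) *
    (√(Real.pi / (2 * Real.pi * L) ^ 2) ^ 3 / (2 * Real.pi * L) ^ 2 / Real.Gamma (17 / 6)) *
    Real.Gamma (1 / 3)

theorem stressAtInfinity_pos {μ L : ℝ} (hμ : 0 < μ) (hL : 0 < L) : 0 < stressAtInfinity μ L := by
  have h1 : (0 : ℝ) < Real.Gamma (17 / 6) := Real.Gamma_pos_of_pos (by norm_num)
  have h2 : (0 : ℝ) < Real.Gamma (1 / 3) := Real.Gamma_pos_of_pos (by norm_num)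
  have h3 := Real.pi_pos
  unfold stressAtInfinity
  positivity

section Field

variable {Ω : Type*} [MeasurableSpace Ω] {P : Measure Ω}

theorem reynoldsStress_curl_eq {ξ : L2Vec ℝ →ₗ[ℝ] Lp ℝ 2 P} (hξ : IsWhiteNoise P ξ) {μ L : ℝ}
    (hL : 0 < L) {ψ : RandomField P} (hψ : IsSolution P ξ μ L 0 ψ) {i : Fin 3}
    (hi : i = 0 ∨ i = 1) {x : E3} (hx : x ∈ halfSpace) :
    reynoldsStress P (curl ψ) i x =
      stressAtInfinity μ L * (1 + profileInt (1 / 3) (2 * x 2 / L) / Real.Gamma (1 / 3)) := by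
  have h2 : (0 : ℝ) < Real.Gamma (1 / 3) := Real.Gamma_pos_of_pos (by norm_num)
  obtain ⟨j, hij, hj⟩ : ∃ j : Fin 3, (i = 0 ∧ j = 1 ∨ i = 1 ∧ j = 0) ∧ (j = 0 ∨ j = 1) := by
    rcases hi with rfl | rfl
    · exact ⟨1, by simp⟩
    · exact ⟨0, by simp⟩
  rw [reynoldsStress_eq hξ hL hψ hij hx, energy_add_energy hL hj, stressAtInfinity, one_add_div h2.ne']
  field_simp

end Field

end VonKarman

end

theorem mainTheorem2 {Ω : Type*} [MeasurableSpace Ω] (P : MeasureTheory.Measure Ω)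
    [MeasureTheory.IsProbabilityMeasure P]
    (ξ : VonKarman.L2Vec ℝ →ₗ[ℝ] MeasureTheory.Lp ℝ 2 P) (hξ : VonKarman.IsWhiteNoise P ξ)
    (μ L : ℝ) (hμ : 0 < μ) (hL : 0 < L)
    (ψ : VonKarman.RandomField P) (hψ : VonKarman.IsSolution P ξ μ L 0 ψ) :
    (∀ i, ∀ x ∈ VonKarman.halfSpace, DifferentiableAt ℝ (ψ i) x) ∧
    ∃ S : ℝ, 0 < S ∧
      ∀ i : Fin 3, i = 0 ∨ i = 1 →
        (∀ a b : ℝ, Filter.Tendsto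
          (fun z : ℝ => VonKarman.reynoldsStress P (VonKarman.curl ψ) i !₂[a, b, z])
          Filter.atTop (nhds S)) ∧
        (∀ x ∈ VonKarman.halfSpace,
          VonKarman.reynoldsStress P (VonKarman.curl ψ) i x / S
            = 1 + (1 / 3 + 1) * VonKarman.matern (1 / 3) (2 * x 2 / L)
              - 1 / 3 * VonKarman.matern (1 / 3 + 1) (2 * x 2 / L)) ∧
        Filter.Tendsto (fun x => VonKarman.reynoldsStress P (VonKarman.curl ψ) i x / S)
          (Filter.comap (fun x : VonKarman.E3 => x 2 / L) (nhdsWithin 0 (Set.Ioi 0))) (nhds 2) := by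
  have hΓ : (0 : ℝ) < Real.Gamma (1 / 3) := Real.Gamma_pos_of_pos (by norm_num)
  have hS := VonKarman.stressAtInfinity_pos hμ hL
  refine ⟨fun i x hx => ?_, VonKarman.stressAtInfinity μ L, hS, fun i hi => ?_⟩
  · obtain ⟨D, hD, -⟩ := hψ.hasFDerivAt hξ hL i hx
    exact hD.differentiableAt
  have hform : ∀ x ∈ VonKarman.halfSpace, VonKarman.reynoldsStress P (VonKarman.curl ψ) i x =
      VonKarman.stressAtInfinity μ L *
        (1 + VonKarman.profileInt (1 / 3) (2 * x 2 / L) / Real.Gamma (1 / 3)) :=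
    fun x hx => VonKarman.reynoldsStress_curl_eq hξ hL hψ hi hx
  refine ⟨fun a b => ?_, fun x hx => ?_, ?_⟩
  · have hz : Tendsto (fun z : ℝ => 2 * z / L) atTop atTop :=
      (tendsto_id.const_mul_atTop two_pos).atTop_div_const hL
    have h := (((VonKarman.tendsto_profileInt_atTop (ν := 1 / 3) (by norm_num)).comp
      hz).div_const (Real.Gamma (1 / 3))).const_add 1 |>.const_mul (VonKarman.stressAtInfinity μ L)
    rw [zero_div, add_zero, mul_one] at h
    refine h.congr' ?_
    filter_upwards [eventually_gt_atTop 0] with z hz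
    have hz2 : (!₂[a, b, z] : VonKarman.E3) 2 = z := rfl
    have hx : (!₂[a, b, z] : VonKarman.E3) ∈ VonKarman.halfSpace := by
      rw [VonKarman.halfSpace, Set.mem_ofPred_eq, hz2]
      exact hz
    rw [hform _ hx, hz2, Function.comp_apply]
  · have hx' : 0 < x 2 := hx
    rw [hform x hx, mul_div_cancel_left₀ _ hS.ne',
      VonKarman.profileInt_eq_matern (by norm_num) (by positivity), mul_div_cancel_left₀ _ hΓ.ne']
    ring
  · have hl : Tendsto (fun x : VonKarman.E3 => 2 * (x 2 / L))
        (comap (fun x : VonKarman.E3 => x 2 / L) (𝓝[>] 0)) (𝓝 0) := by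
      have h := (tendsto_comap (f := fun x : VonKarman.E3 => x 2 / L)
        (x := 𝓝[>] 0)).mono_right nhdsWithin_le_nhds
      simpa using h.const_mul 2
    have h := (((VonKarman.tendsto_profileInt_zero (ν := 1 / 3) (by norm_num)).comp
      hl).div_const (Real.Gamma (1 / 3))).const_add 1
    rw [div_self hΓ.ne', one_add_one_eq_two] at h
    refine h.congr' ?_
    -- The filter restricts only x₂/L, to small positive values. It thus stays in the half-space,
    -- where the formula holds, and lets the horizontal coordinates vary freely.
    filter_upwards [preimage_mem_comap self_mem_nhdsWithin] with x hx
    have hx' : 0 < x 2 := by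
      have : 0 < x 2 / L := hx
      exact (div_pos_iff_of_pos_right hL).mp this
    rw [hform x hx', mul_div_cancel_left₀ _ hS.ne', mul_div_assoc]
    rfl
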